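/- **Distorted monoidal categories.** A *distorted monoidal category* is a monoidal category $(\mathcal C,\otimes,\mathbf I,\alpha,\lambda,\rho)$ with a natural transformation $\Lambda:\mathrm{Id}_{\mathcal C}\Rightarrow\mathrm{Id}_{\mathcal C}$ and morphisms $\sigma_{X,Y}:X\otimes Y\to Y\otimes X$, natural in $X$ and $Y$ (not necessarily invertible), such that $\sigma_{X,\mathbf I}=\lambda_X^{-1}\rho_X$, $\sigma_{\mathbf I,X}=\rho_X^{-1}\lambda_X$, $\Lambda_{\mathbf I}=\mathrm{Id}_{\mathbf I}$, $\Lambda_{X\otimes Y}=\Lambda_X\otimes\Lambda_Y$, and $$\sigma_{X\otimes Y,Z}=\alpha_{Z,X,Y}(\sigma_{X,Z}\otimes \mathrm{Id}_Y)\alpha^{-1}_{X,Z,Y}(\mathrm{Id}_X\otimes\sigma_{Y,Z})\alpha_{X,Y,Z},$$ $$\sigma_{X,Y\otimes Z}=\alpha^{-1}_{Y,Z,X}(\mathrm{Id}_Y\otimes\sigma_{X,Z})\alpha_{Y,X,Z}(\sigma_{X,Y}\otimes\mathrm{Id}_Z)\alpha^{-1}_{X,Y,Z}.$$ A *$\sigma$-lax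 monoidal functor* $(F,\mu^F,\mu_0^F)$ is a lax monoidal functor, with $\mu^F_{X,Y}:FX\otimes FY\to F(X\otimes Y)$ and $\mu^F_0:\mathbf I\to F\mathbf I$, such that $F(\Lambda_Z)=\Lambda_{FZ}$ and $F(\sigma_{X,Y})\circ\mu^F_{X,Y}=\mu^F_{Y,X}\circ\sigma_{FX,FY}$. **The 2-monad.** Let $\mathsf T_\sigma$ be the 2-monad on categories that sends $\mathcal C$ to the free *strict* distorted monoidal category on $\mathcal C$: its objects are the finite words in the objects of $\mathcal C$, the tensor product of words is concatenation, and its morphisms are generated under composition and tensor product by the morphisms of $\mathcal C$, by binary distortions and by unit distortions, subject to the axioms of a strict monoidal category, the axioms above and functoriality of $\mathcal C\to\mathsf T_\sigma\mathcal C$. The unit of the 2-monad sends $x$ to the one-letter word $[x]$, and the multiplication concatenates words of words. Pseudoalgebras $(A,a)$ (an action $a:\mathsf T_\sigma A\to A$ with coherent isomorphisms $\mathrm{Id}\cong a\circ\eta_A$ and $a\circ \mathsf T_\sigma a\cong a\circ m_A$, where $\eta$ and $m$ are the unit and the multiplication of the 2-monad), lax morphisms $(F,\bar F)$ with $\bar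 F:b\circ\mathsf T_\sigma F\Rightarrow F\circ a$, and transformations of lax morphisms are the standard ones. A pseudoalgebra has the underlying tensor product $X\otimes Y=a[X,Y]$, unit $\mathbf I=a[\,]$, binary distortion $a(\sigma_{[X],[Y]})$, unit distortion obtained from $a(\Lambda_{[X]})$ through $X\cong a[X]$, and associator and unitors obtained from the coherence isomorphisms. The *laxators* of a lax morphism $F$ are $\mu^F_{X,Y}=\bar F_{[X,Y]}:FX\otimes FY\to F(X\otimes Y)$ and $\mu^F_0=\bar F_{[\,]}:\mathbf I\to F\mathbf I$. **Statement.** Categories are taken with objects and morphisms in arbitrary fixed universes. 1. $\mathsf T_\sigma$-pseudoalgebras, lax $\mathsf T_\sigma$-morphisms and $\mathsf T_\sigma$-transformations form a strict 2-category. Its 1-cells compose by composition of the underlying functors, its 2-cells compose vertically, by whiskering and horizontally like natural transformations, and identities are the usual ones. 2. For composable lax morphisms $F,G$, $$\mu^{GF}_{X,Y}=G(\mu^F_{X,Y})\circ\mu^G_{FX,FY},\qquad \mu^{GF}_0=G(\mu^F_0)\circ\mu^G_0,$$ and the laxators of an identity are identities. 3. For composable $F,G,H$ one has the equalities $\mu^{H(GF)}_{X,Y}=\mu^{(HG)F}_{X,Y}$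 and $\mu_0^{H(GF)}=\mu_0^{(HG)F}$. 4. The interchange law holds as an equality of 2-cells: $(\psi\circ\phi)\ast(\eta\circ\theta)=(\psi\ast\eta)\circ(\phi\ast\theta)$. 5. Hence the strict 2-category of distorted monoidal categories is recovered: * The underlying data of a pseudoalgebra form a distorted monoidal category; a lax morphism with its laxators is a $\sigma$-lax monoidal functor; a transformation is a monoidal natural transformation. This defines a strict 2-functor from the 2-category of (1) to that of distorted monoidal categories, $\sigma$-lax monoidal functors and monoidal natural transformations. It is a biequivalence (surjective on objects up to equivalence and an equivalence on all hom-categories), and between any two pseudoalgebras it is bijective on 1-cells and on 2-cells. * Distorted monoidal categories, $\sigma$-lax monoidal functors and monoidal natural transformations form a strict 2-category, with the usual identities, functor composition, and vertical and horizontal composition of natural transformations, with composite and identity laxators as in (2), equal laxators of triple composites as in (3), strictly associative and unital horizontal composition of 2-cells, and the interchange law as in (4). -/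

import Mathlib

open CategoryTheory

universe v u v₁ u₁ v₂ u₂ v₃ u₃ v₄ u₄

namespace Distorted

/-! ### The free strict distorted monoidal category -/

/-- The words in the objects of `C`, which are the objects of the free strict distorted monoidal
category on `C`. -/
def T (C : Type u) : Type u := List C

namespace T

section Words

variable {C : Type u}

/-- The empty word, the tensor unit. -/
def nil : T C := ([] : List C)

/-- Concatenation of words, the tensor product of objects. -/
def append (X Y : T C) : T C := List.append X Y

/-- The one-letter word. -/
def single (x : C) : T C := [x]

theorem nil_append (X : T C) : append nil X = X := rfl

theorem append_nil (X : T C) : append X nil = X := List.append_nil X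

theorem append_assoc (X Y Z : T C) : append (append X Y) Z = append X (append Y Z) :=
  List.append_assoc X Y Z

/-- The letterwise image of a word. -/
def mapWord {D : Type u₁} (f : C → D) (X : T C) : T D := List.map f X

/-- The concatenation of a word of words. -/
def join (W : T (T C)) : T C := List.flatten (α := C) W

theorem mapWord_append {D : Type u₁} (f : C → D) (X Y : T C) :
    mapWord f (append X Y) = append (mapWord f X) (mapWord f Y) := List.map_append

theorem join_append (V W : T (T C)) : join (append V W) = append (join V) (join W) :=
  List.flatten_append

theorem join_single (X : T C) : join (single X) = X := List.append_nil X

/-- Induction over words. -/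
theorem word_induction {P : T C → Prop} (nil : P nil)
    (cons : ∀ (x : C) (X : T C), P X → P (append (single x) X)) (X : T C) : P X := by
  induction X with
  | nil => exact nil
  | cons x X ih => exact cons x X ih

theorem join_pair (X Y : T C) :
    T.join (T.append (T.single X) (T.single Y)) = T.append X Y := by
  rw [T.join_append, T.join_single, T.join_single]

end Words

end T

open T in
/-- Formal expressions between words: composites and tensor products of the morphisms of `C`,
of binary distortions `swap` and of unit distortions `dist`. -/
inductive Term (C : Type u) [Category.{v} C] : T C → T C → Type (max u v)
  | id (X : T C) : Term C X X
  | comp {X Y Z : T C} (f : Term C X Y) (g : Term C Y Z) : Term C X Z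
  | tensor {X X' Y Y' : T C} (f : Term C X X') (g : Term C Y Y') :
      Term C (append X Y) (append X' Y')
  | of {x y : C} (f : x ⟶ y) : Term C (single x) (single y)
  | swap (X Y : T C) : Term C (append X Y) (append Y X)
  | dist (X : T C) : Term C X X

/-- The identity between two equal words. -/
def Term.ofEq {C : Type u} [Category.{v} C] {X Y : T C} (h : X = Y) : Term C X Y :=
  h ▸ Term.id X

open Term T in
/-- The relations of a strict monoidal category (in which concatenation is the tensor product), of
a functor `C ⥤ T C`, and of a distorted monoidal category; `Term.ofEq` accounts for the strict associativity and
unitality of concatenation. -/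
inductive Rel (C : Type u) [Category.{v} C] : {X Y : T C} → Term C X Y → Term C X Y → Prop
  -- congruence
  | comp_left {X Y Z : T C} {f f' : Term C X Y} (g : Term C Y Z) :
      Rel C f f' → Rel C (comp f g) (comp f' g)
  | comp_right {X Y Z : T C} (f : Term C X Y) {g g' : Term C Y Z} :
      Rel C g g' → Rel C (comp f g) (comp f g')
  | tensor_left {X X' Y Y' : T C} {f f' : Term C X X'} (g : Term C Y Y') :
      Rel C f f' → Rel C (tensor f g) (tensor f' g)
  | tensor_right {X X' Y Y' : T C} (f : Term C X X') {g g' : Term C Y Y'} :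
      Rel C g g' → Rel C (tensor f g) (tensor f g')
  -- category
  | id_comp {X Y : T C} (f : Term C X Y) : Rel C (comp (id X) f) f
  | comp_id {X Y : T C} (f : Term C X Y) : Rel C (comp f (id Y)) f
  | assoc {X Y Z W : T C} (f : Term C X Y) (g : Term C Y Z) (h : Term C Z W) :
      Rel C (comp (comp f g) h) (comp f (comp g h))
  -- strict monoidal structure
  | tensor_id (X Y : T C) : Rel C (tensor (id X) (id Y)) (id (append X Y))
  | tensor_comp {X X' X'' Y Y' Y'' : T C} (f : Term C X X') (f' : Term C X' X'')
      (g : Term C Y Y') (g' : Term C Y' Y'') :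
      Rel C (tensor (comp f f') (comp g g')) (comp (tensor f g) (tensor f' g'))
  | unit_tensor {X Y : T C} (f : Term C X Y) :
      Rel C (comp (tensor (id nil) f) (ofEq (nil_append Y)))
        (comp (ofEq (nil_append X)) f)
  | tensor_unit {X Y : T C} (f : Term C X Y) :
      Rel C (comp (tensor f (id nil)) (ofEq (append_nil Y)))
        (comp (ofEq (append_nil X)) f)
  | tensor_assoc {X X' Y Y' Z Z' : T C} (f : Term C X X') (g : Term C Y Y')
      (h : Term C Z Z') :
      Rel C (comp (tensor (tensor f g) h) (ofEq (append_assoc X' Y' Z')))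
        (comp (ofEq (append_assoc X Y Z)) (tensor f (tensor g h)))
  -- functoriality of the inclusion of `C`
  | of_id (x : C) : Rel C (of (𝟙 x)) (id (single x))
  | of_comp {x y z : C} (f : x ⟶ y) (g : y ⟶ z) : Rel C (of (f ≫ g)) (comp (of f) (of g))
  -- naturality of the unit distortion
  | dist_natural {X Y : T C} (f : Term C X Y) : Rel C (comp f (dist Y)) (comp (dist X) f)
  -- binaturality of the binary distortion
  | swap_natural {X X' Y Y' : T C} (f : Term C X X') (g : Term C Y Y') :
      Rel C (comp (swap X Y) (tensor g f)) (comp (tensor f g) (swap X' Y'))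
  -- unit normalization
  | swap_unit (X : T C) :
      Rel C (swap X nil) (ofEq ((append_nil X).trans (nil_append X).symm))
  | unit_swap (X : T C) :
      Rel C (swap nil X) (ofEq ((nil_append X).trans (append_nil X).symm))
  | dist_unit : Rel C (dist nil) (id nil)
  -- hexagons
  | hexagon_left (X Y Z : T C) :
      Rel C (swap (append X Y) Z)
        (comp (ofEq (append_assoc X Y Z))
          (comp (tensor (id X) (swap Y Z))
            (comp (ofEq (append_assoc X Z Y).symm)
              (comp (tensor (swap X Z) (id Y)) (ofEq (append_assoc Z X Y))))))
  | hexagon_right (X Y Z : T C) :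
      Rel C (swap X (append Y Z))
        (comp (ofEq (append_assoc X Y Z).symm)
          (comp (tensor (swap X Y) (id Z))
            (comp (ofEq (append_assoc Y X Z))
              (comp (tensor (id Y) (swap X Z)) (ofEq (append_assoc Y Z X).symm)))))
  -- monoidality of the unit distortion
  | dist_tensor (X Y : T C) : Rel C (dist (append X Y)) (tensor (dist X) (dist Y))

namespace T

section Category

variable {C : Type u} [Category.{v} C]

instance : Category.{max u v} (T C) where
  Hom X Y := Quot (@Rel C _ X Y)
  id X := Quot.mk _ (Term.id X)
  comp f g := Quot.map₂ Term.comp (fun f _ _ h => Rel.comp_right f h)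
    (fun _ _ g h => Rel.comp_left g h) f g
  id_comp f := Quot.inductionOn f fun f => Quot.sound (Rel.id_comp f)
  comp_id f := Quot.inductionOn f fun f => Quot.sound (Rel.comp_id f)
  assoc f g h := Quot.inductionOn f fun f => Quot.inductionOn g fun g =>
    Quot.inductionOn h fun h => Quot.sound (Rel.assoc f g h)

/-- The class of an expression. -/
def mk {X Y : T C} (t : Term C X Y) : X ⟶ Y := Quot.mk _ t

/-- The tensor product of morphisms. -/
def tensor {X X' Y Y' : T C} (f : X ⟶ X') (g : Y ⟶ Y') : append X Y ⟶ append X' Y' :=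
  Quot.map₂ Term.tensor (fun f _ _ h => Rel.tensor_right f h)
    (fun _ _ g h => Rel.tensor_left g h) f g

def of {x y : C} (f : x ⟶ y) : single x ⟶ single y := mk (Term.of f)

def swap (X Y : T C) : append X Y ⟶ append Y X := mk (Term.swap X Y)

def dist (X : T C) : X ⟶ X := mk (Term.dist X)

theorem mk_ofEq {X Y : T C} (h : X = Y) : mk (Term.ofEq h) = eqToHom h := by
  subst h; rfl

theorem mk_comp {X Y Z : T C} (f : Term C X Y) (g : Term C Y Z) :
    mk (f.comp g) = mk f ≫ mk g := rfl

theorem mk_tensor {X X' Y Y' : T C} (f : Term C X X') (g : Term C Y Y') :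
    mk (f.tensor g) = tensor (mk f) (mk g) := rfl

theorem mk_eq {X Y : T C} {f g : Term C X Y} (h : Rel C f g) : mk f = mk g := Quot.sound h

theorem tensor_id (X Y : T C) : tensor (𝟙 X) (𝟙 Y) = 𝟙 (append X Y) :=
  mk_eq (Rel.tensor_id X Y)

theorem tensor_comp {X X' X'' Y Y' Y'' : T C} (f : X ⟶ X') (f' : X' ⟶ X'') (g : Y ⟶ Y')
    (g' : Y' ⟶ Y'') : tensor (f ≫ f') (g ≫ g') = tensor f g ≫ tensor f' g' :=
  Quot.inductionOn f fun f => Quot.inductionOn f' fun f' => Quot.inductionOn g fun g =>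
    Quot.inductionOn g' fun g' => mk_eq (Rel.tensor_comp f f' g g')

theorem tensor_comp_assoc {X X' X'' Y Y' Y'' Z : T C} (f : X ⟶ X') (f' : X' ⟶ X'') (g : Y ⟶ Y')
    (g' : Y' ⟶ Y'') (k : append X'' Y'' ⟶ Z) :
    tensor (f ≫ f') (g ≫ g') ≫ k = tensor f g ≫ tensor f' g' ≫ k := by
  rw [tensor_comp, Category.assoc]

theorem tensor_eqToHom {X X' Y Y' : T C} (h : X = X') (h' : Y = Y') :
    tensor (eqToHom h) (eqToHom h') = eqToHom (by rw [h, h']) := by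
  subst h; subst h'; exact tensor_id _ _

theorem unit_tensor {X Y : T C} (f : X ⟶ Y) : tensor (𝟙 nil) f = f := by
  induction f using Quot.inductionOn with
  | h f =>
    have h := mk_eq (Rel.unit_tensor f)
    rw [mk_comp, mk_comp, mk_ofEq, mk_ofEq] at h
    exact (Category.comp_id _).symm.trans (h.trans (Category.id_comp _))

theorem tensor_unit {X Y : T C} (f : X ⟶ Y) :
    tensor f (𝟙 nil) = eqToHom (append_nil X) ≫ f ≫ eqToHom (append_nil Y).symm := by
  induction f using Quot.inductionOn with
  | h f =>
    have h := mk_eq (Rel.tensor_unit f)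
    rw [mk_comp, mk_comp, mk_ofEq, mk_ofEq] at h
    rw [← Category.assoc, ← comp_eqToHom_iff]
    exact h

theorem tensor_assoc {X X' Y Y' Z Z' : T C} (f : X ⟶ X') (g : Y ⟶ Y') (h : Z ⟶ Z') :
    tensor (tensor f g) h = eqToHom (append_assoc X Y Z) ≫ tensor f (tensor g h) ≫
      eqToHom (append_assoc X' Y' Z').symm := by
  induction f using Quot.inductionOn with
  | h f =>
  induction g using Quot.inductionOn with
  | h g =>
  induction h using Quot.inductionOn with
  | h h =>
    have h := mk_eq (Rel.tensor_assoc f g h)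
    rw [mk_comp, mk_comp, mk_ofEq, mk_ofEq] at h
    rw [← Category.assoc, ← comp_eqToHom_iff]
    exact h

theorem of_id (x : C) : of (𝟙 x) = 𝟙 (single x) := mk_eq (Rel.of_id x)

theorem of_comp {x y z : C} (f : x ⟶ y) (g : y ⟶ z) : of (f ≫ g) = of f ≫ of g :=
  mk_eq (Rel.of_comp f g)

theorem dist_natural {X Y : T C} (f : X ⟶ Y) : f ≫ dist Y = dist X ≫ f :=
  Quot.inductionOn f fun f => mk_eq (Rel.dist_natural f)

theorem swap_natural {X X' Y Y' : T C} (f : X ⟶ X') (g : Y ⟶ Y') :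
    swap X Y ≫ tensor g f = tensor f g ≫ swap X' Y' :=
  Quot.inductionOn f fun f => Quot.inductionOn g fun g => mk_eq (Rel.swap_natural f g)

theorem swap_natural_assoc {X X' Y Y' Z : T C} (f : X ⟶ X') (g : Y ⟶ Y')
    (k : append Y' X' ⟶ Z) :
    swap X Y ≫ tensor g f ≫ k = tensor f g ≫ swap X' Y' ≫ k := by
  rw [← Category.assoc, swap_natural, Category.assoc]

theorem swap_unit (X : T C) : swap X nil = eqToHom ((append_nil X).trans (nil_append X).symm) := by
  rw [← mk_ofEq]; exact mk_eq (Rel.swap_unit X)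

theorem unit_swap (X : T C) : swap nil X = eqToHom ((nil_append X).trans (append_nil X).symm) := by
  rw [← mk_ofEq]; exact mk_eq (Rel.unit_swap X)

theorem dist_unit : dist (nil : T C) = 𝟙 nil := mk_eq Rel.dist_unit

theorem hexagon_left (X Y Z : T C) :
    swap (append X Y) Z = eqToHom (append_assoc X Y Z) ≫ tensor (𝟙 X) (swap Y Z) ≫
      eqToHom (append_assoc X Z Y).symm ≫ tensor (swap X Z) (𝟙 Y) ≫
        eqToHom (append_assoc Z X Y) := by
  simp only [← mk_ofEq]; exact mk_eq (Rel.hexagon_left X Y Z)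

theorem hexagon_right (X Y Z : T C) :
    swap X (append Y Z) = eqToHom (append_assoc X Y Z).symm ≫ tensor (swap X Y) (𝟙 Z) ≫
      eqToHom (append_assoc Y X Z) ≫ tensor (𝟙 Y) (swap X Z) ≫
        eqToHom (append_assoc Y Z X).symm := by
  simp only [← mk_ofEq]; exact mk_eq (Rel.hexagon_right X Y Z)

variable (C) in
/-- The unit distortion of `T C`. -/
def distNat : 𝟭 (T C) ⟶ 𝟭 (T C) where
  app := dist
  naturality _ _ f := dist_natural f

theorem dist_tensor (X Y : T C) : dist (append X Y) = tensor (dist X) (dist Y) :=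
  mk_eq (Rel.dist_tensor X Y)

theorem swap_eqToHom {X X' Y Y' : T C} (h : X = X') (h' : Y = Y') :
    swap X Y = eqToHom (by rw [h, h']) ≫ swap X' Y' ≫ eqToHom (by rw [h, h']) := by
  subst h; subst h'; simp

theorem dist_eqToHom {X X' : T C} (h : X = X') :
    dist X = eqToHom h ≫ dist X' ≫ eqToHom h.symm := by
  subst h; simp

theorem tensor_congr_left {X X' Y Y' U U' : T C} (hX : X = U) (hX' : U' = X')
    (f : U ⟶ U') (g : Y ⟶ Y') :
    tensor (eqToHom hX ≫ f ≫ eqToHom hX') g =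
      eqToHom (by rw [hX]) ≫ tensor f g ≫ eqToHom (by rw [hX']) := by
  subst hX hX'; simp

theorem tensor_congr_right {X X' Y Y' V V' : T C} (hY : Y = V) (hY' : V' = Y')
    (f : X ⟶ X') (g : V ⟶ V') :
    tensor f (eqToHom hY ≫ g ≫ eqToHom hY') =
      eqToHom (by rw [hY]) ≫ tensor f g ≫ eqToHom (by rw [hY']) := by
  subst hY hY'; simp

theorem unit_tensor' {X Y N : T C} (h : N = nil) (f : X ⟶ Y) :
    tensor (𝟙 N) f = eqToHom (by rw [h, nil_append]) ≫ f ≫ eqToHom (by rw [h, nil_append]) := by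
  subst h
  exact (unit_tensor f).trans ((Category.comp_id _).symm.trans (Category.id_comp _).symm)

theorem tensor_unit' {X Y N : T C} (h : N = nil) (f : X ⟶ Y) :
    tensor f (𝟙 N) = eqToHom (by rw [h, append_nil]) ≫ f ≫ eqToHom (by rw [h, append_nil]) := by
  subst h
  exact tensor_unit f

/-- Induction over the morphisms of `T C`. -/
theorem hom_induction {P : ∀ {X Y : T C}, (X ⟶ Y) → Prop}
    (id : ∀ X : T C, P (𝟙 X))
    (comp : ∀ {X Y Z : T C} (f : X ⟶ Y) (g : Y ⟶ Z), P f → P g → P (f ≫ g))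
    (tensor : ∀ {X X' Y Y' : T C} (f : X ⟶ X') (g : Y ⟶ Y'), P f → P g → P (tensor f g))
    (of : ∀ {x y : C} (f : x ⟶ y), P (of f))
    (swap : ∀ X Y : T C, P (swap X Y)) (dist : ∀ X : T C, P (dist X))
    {X Y : T C} (f : X ⟶ Y) : P f := by
  induction f using Quot.inductionOn with
  | h t =>
    induction t with
    | id X => exact id X
    | comp f g hf hg => exact comp _ _ hf hg
    | tensor f g hf hg => exact tensor _ _ hf hg
    | of f => exact of f
    | swap X Y => exact swap X Y
    | dist X => exact dist X

end Category

section Extend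

variable {C : Type u₁} [Category.{v₁} C] {D : Type u₂} [Category.{v₂} D]

section

variable (o : T C → T D) (o_nil : o nil = nil)
  (o_append : ∀ X Y : T C, o (append X Y) = append (o X) (o Y))
  (g : ∀ {x y : C}, (x ⟶ y) → (o (single x) ⟶ o (single y)))

/-- The interpretation of expressions determined by a monoid homomorphism on words and by a map on
the morphisms of `C`. -/
def interp : {X Y : T C} → Term C X Y → (o X ⟶ o Y)
  | _, _, .id X => 𝟙 (o X)
  | _, _, .comp f g => interp f ≫ interp g
  | _, _, .tensor f g =>
      eqToHom (o_append _ _) ≫ tensor (interp f) (interp g) ≫ eqToHom (o_append _ _).symm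
  | _, _, .of f => g f
  | _, _, .swap X Y => eqToHom (o_append X Y) ≫ swap (o X) (o Y) ≫ eqToHom (o_append Y X).symm
  | _, _, .dist X => dist (o X)

theorem interp_ofEq {X Y : T C} (h : X = Y) :
    interp o o_append g (Term.ofEq h) = eqToHom (congrArg o h) := by
  subst h; rfl

theorem interp_rel (h_nil : o nil = nil) (g_id : ∀ x : C, g (𝟙 x) = 𝟙 _)
    (g_comp : ∀ {x y z : C} (f : x ⟶ y) (f' : y ⟶ z), g (f ≫ f') = g f ≫ g f')
    {X Y : T C} {f f' : Term C X Y} (h : Rel C f f') :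
    interp o o_append g f = interp o o_append g f' := by
  induction h with
  | comp_left g h ih => simp only [interp, ih]
  | comp_right g h ih => simp only [interp, ih]
  | tensor_left g h ih => simp only [interp, ih]
  | tensor_right g h ih => simp only [interp, ih]
  | id_comp f => simp [interp]
  | comp_id f => simp [interp]
  | assoc f g h => simp [interp]
  | tensor_id X Y => simp [interp, tensor_id]
  | tensor_comp f f' g g' => simp [interp, tensor_comp]
  | unit_tensor f =>
    simp [interp, interp_ofEq, unit_tensor' h_nil]
  | tensor_unit f =>
    simp [interp, interp_ofEq, tensor_unit' h_nil]
  | tensor_assoc f g h =>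
    simp [interp, interp_ofEq, tensor_congr_left, tensor_congr_right, tensor_assoc]
  | of_id x => exact g_id x
  | of_comp f g => exact g_comp f g
  | dist_natural f => exact dist_natural _
  | swap_natural f g => simp [interp, swap_natural_assoc]
  | swap_unit X => 
    simp only [interp, interp_ofEq, swap_eqToHom rfl h_nil, swap_unit]
    simp
  | unit_swap X => 
    simp only [interp, interp_ofEq, swap_eqToHom h_nil rfl, unit_swap]
    simp
  | dist_unit => simp [interp, dist_eqToHom h_nil, dist_unit]
  | hexagon_left X Y Z =>
    simp [interp, interp_ofEq, tensor_congr_left, tensor_congr_right, swap_eqToHom (o_append X Y) rfl, hexagon_left]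
  | hexagon_right X Y Z =>
    simp [interp, interp_ofEq, tensor_congr_left, tensor_congr_right, swap_eqToHom rfl (o_append Y Z), hexagon_right]
  | dist_tensor X Y =>
    simp [interp, dist_eqToHom (o_append X Y), dist_tensor]

/-- The extension to `T C` of a functor from `C` to `T D`. -/
def extend (g_id : ∀ x : C, g (𝟙 x) = 𝟙 _)
    (g_comp : ∀ {x y z : C} (f : x ⟶ y) (f' : y ⟶ z), g (f ≫ f') = g f ≫ g f') : T C ⥤ T D where
  obj := o
  map f := Quot.lift (interp o o_append g)
    (fun _ _ h => interp_rel o o_append g o_nil g_id g_comp h) f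
  map_id _ := rfl
  map_comp f f' := Quot.inductionOn f fun _ => Quot.inductionOn f' fun _ => rfl

end

/-- The strict morphisms between free strict distorted monoidal categories. -/
structure IsStrict (P : T C ⥤ T D) : Prop where
  obj_nil : P.obj nil = nil
  obj_append (X Y : T C) : P.obj (append X Y) = append (P.obj X) (P.obj Y)
  map_tensor {X X' Y Y' : T C} (f : X ⟶ X') (g : Y ⟶ Y') :
    P.map (tensor f g) = eqToHom (obj_append X Y) ≫ tensor (P.map f) (P.map g) ≫
      eqToHom (obj_append X' Y').symm
  map_swap (X Y : T C) :
    P.map (swap X Y) = eqToHom (obj_append X Y) ≫ swap (P.obj X) (P.obj Y) ≫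
      eqToHom (obj_append Y X).symm
  map_dist (X : T C) : P.map (dist X) = dist (P.obj X)

theorem extend_isStrict {o : T C → T D} {o_nil : o nil = nil}
    {o_append : ∀ X Y : T C, o (append X Y) = append (o X) (o Y)}
    {g : ∀ {x y : C}, (x ⟶ y) → (o (single x) ⟶ o (single y))}
    {g_id : ∀ x : C, g (𝟙 x) = 𝟙 _}
    (g_comp : ∀ {x y z : C} (f : x ⟶ y) (f' : y ⟶ z), g (f ≫ f') = g f ≫ g f') :
    IsStrict (extend o o_nil o_append g g_id g_comp) where
  obj_nil := o_nil
  obj_append := o_append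
  map_tensor f g := Quot.inductionOn f fun _ => Quot.inductionOn g fun _ => rfl
  map_swap _ _ := rfl
  map_dist _ := rfl

theorem IsStrict.id : IsStrict (𝟭 (T C)) where
  obj_nil := rfl
  obj_append _ _ := rfl
  map_tensor f g := by simp
  map_swap X Y := by simp
  map_dist X := by simp

theorem IsStrict.comp {E : Type u₃} [Category.{v₃} E] {P : T C ⥤ T D} {Q : T D ⥤ T E}
    (hP : IsStrict P) (hQ : IsStrict Q) : IsStrict (P ⋙ Q) where
  obj_nil := by rw [Functor.comp_obj, hP.obj_nil, hQ.obj_nil]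
  obj_append X Y := by rw [Functor.comp_obj, hP.obj_append, hQ.obj_append]; rfl
  map_tensor f g := by
    simp [hP.map_tensor, hQ.map_tensor, eqToHom_map]
  map_swap X Y := by
    simp [hP.map_swap, hQ.map_swap, eqToHom_map]
  map_dist X := by simp [hP.map_dist, hQ.map_dist]

/-- A strict morphism is determined by its values on one-letter words. -/
theorem IsStrict.ext {P Q : T C ⥤ T D} (hP : IsStrict P) (hQ : IsStrict Q)
    (h_obj : ∀ x : C, P.obj (single x) = Q.obj (single x))
    (h_map : ∀ {x y : C} (f : x ⟶ y),
      P.map (of f) = eqToHom (h_obj x) ≫ Q.map (of f) ≫ eqToHom (h_obj y).symm) : P = Q := by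
  have h : ∀ X : T C, P.obj X = Q.obj X := by
    intro X
    induction X with
    | nil => exact hP.obj_nil.trans hQ.obj_nil.symm
    | cons x X ih =>
      exact (hP.obj_append (single x) X).trans
        ((congrArg₂ append (h_obj x) ih).trans (hQ.obj_append (single x) X).symm)
  refine CategoryTheory.Functor.ext h fun X Y f => ?_
  induction f using hom_induction with
  | id X => simp
  | comp f g hf hg => simp [hf, hg]
  | tensor f g hf hg =>
    simp [hP.map_tensor, hQ.map_tensor, hf, hg, tensor_congr_left, tensor_congr_right]
  | of f => exact h_map f
  | swap X Y => simp [hP.map_swap, hQ.map_swap, swap_eqToHom (h X) (h Y)]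
  | dist X => simp [hP.map_dist, hQ.map_dist, dist_eqToHom (h X)]

end Extend

/-! ### The 2-monad structure -/

section Monad

variable {C : Type u₁} [Category.{v₁} C] {D : Type u₂} [Category.{v₂} D]
  {E : Type u₃} [Category.{v₃} E]

/-- The action of `T` on functors. -/
def map (F : C ⥤ D) : T C ⥤ T D :=
  extend (mapWord F.obj) rfl (mapWord_append F.obj)
    (fun f => of (F.map f)) (fun x => by rw [F.map_id]; exact of_id _)
    (fun f g => by rw [F.map_comp]; exact of_comp _ _)

theorem map_isStrict (F : C ⥤ D) : IsStrict (map F) := by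
  unfold map; exact extend_isStrict (fun f g => by rw [F.map_comp]; exact of_comp _ _)

variable (C) in
/-- The unit of `T`: the inclusion of one-letter words. -/
def unit : C ⥤ T C where
  obj := single
  map := of
  map_id := of_id
  map_comp := of_comp

variable (C) in
/-- The multiplication of `T`: the concatenation of words of words. -/
def mult : T (T C) ⥤ T C :=
  extend join rfl join_append
    (fun {X Y} f => eqToHom (join_single X) ≫ f ≫ eqToHom (join_single Y).symm)
    (fun X => by simp) (fun f g => by simp)

theorem mult_isStrict : IsStrict (mult C) := by
  unfold mult; exact extend_isStrict (fun f g => by simp)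

/-- The components of the action of `T` on natural transformations. -/
def map₂App {F G : C ⥤ D} (θ : F ⟶ G) : (X : List C) → ((map F).obj X ⟶ (map G).obj X)
  | [] => 𝟙 nil
  | x :: X => tensor (of (θ.app x)) (map₂App θ X)

theorem eqToHom_conj {X Y X' Y' X'' Y'' : T C} (a : X = X') (b : X' = X'') (f : X'' ⟶ Y'')
    (c : Y'' = Y') (d : Y' = Y) :
    eqToHom a ≫ (eqToHom b ≫ f ≫ eqToHom c) ≫ eqToHom d =
      eqToHom (a.trans b) ≫ f ≫ eqToHom (c.trans d) := by
  simp

theorem map₂App_append {F G : C ⥤ D} (θ : F ⟶ G) (X Y : T C) :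
    map₂App θ (append X Y) = eqToHom ((map_isStrict F).obj_append X Y) ≫
      tensor (map₂App θ X) (map₂App θ Y) ≫ eqToHom ((map_isStrict G).obj_append X Y).symm := by
  induction X with
  | nil => 
    refine Eq.trans ?_ ((Category.id_comp _).trans (Category.comp_id _)).symm
    exact (unit_tensor _).symm
  | cons x X ih =>
    refine (congrArg (tensor (of (θ.app x))) ih).trans ?_
    rw [tensor_congr_right]
    have h := tensor_assoc (of (θ.app x)) (map₂App θ X) (map₂App θ Y)
    refine Eq.trans ?_ (congrArg (fun t => eqToHom ((map_isStrict F).obj_append (x :: X) Y) ≫ t ≫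
      eqToHom ((map_isStrict G).obj_append (x :: X) Y).symm) h).symm
    exact (eqToHom_conj _ _ _ _ _).symm

/-- The action of `T` on natural transformations. -/
def map₂ {F G : C ⥤ D} (θ : F ⟶ G) : map F ⟶ map G where
  app X := map₂App θ X
  naturality X Y f := by
    induction f using hom_induction with
    | id X => simp
    | comp f g hf hg => simp [reassoc_of% hf, hg]
    | tensor f g hf hg => 
      simp [(map_isStrict F).map_tensor, (map_isStrict G).map_tensor, map₂App_append, ← tensor_comp_assoc, hf, hg]
    | of f =>
      rename_i x y
      have h : ∀ z, map₂App θ (single z) = of (θ.app z) := fun z =>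
        (tensor_unit (of (θ.app z))).trans ((Category.id_comp _).trans (Category.comp_id _))
      rw [h, h]
      exact (of_comp _ _).symm.trans ((congrArg of (θ.naturality f)).trans (of_comp _ _))
    | swap X Y => 
      simp [(map_isStrict F).map_swap, (map_isStrict G).map_swap, map₂App_append,
        swap_natural_assoc]
    | dist X => 
      simp [(map_isStrict F).map_dist, (map_isStrict G).map_dist, dist_natural]

theorem map_obj_single (F : C ⥤ D) (x : C) : (map F).obj (single x) = single (F.obj x) := rfl

theorem map_map_of (F : C ⥤ D) {x y : C} (f : x ⟶ y) :
    (map F).map (of f) = eqToHom (map_obj_single F x) ≫ of (F.map f) ≫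
      eqToHom (map_obj_single F y).symm :=
  ((Category.id_comp _).trans (Category.comp_id _)).symm

theorem mult_obj_single (X : T C) : (mult C).obj (single X) = X := join_single X

theorem mult_map_of {X Y : T C} (f : X ⟶ Y) :
    (mult C).map (of f) = eqToHom (mult_obj_single X) ≫ f ≫ eqToHom (mult_obj_single Y).symm :=
  rfl

theorem map₂_nil {F G : C ⥤ D} (θ : F ⟶ G) :
    (map₂ θ).app nil = eqToHom ((map_isStrict F).obj_nil.trans (map_isStrict G).obj_nil.symm) :=
  rfl

theorem map₂_single {F G : C ⥤ D} (θ : F ⟶ G) (x : C) :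
    (map₂ θ).app (single x) = eqToHom (map_obj_single F x) ≫ of (θ.app x) ≫
      eqToHom (map_obj_single G x).symm :=
  tensor_unit (of (θ.app x))

theorem map₂_append {F G : C ⥤ D} (θ : F ⟶ G) (X Y : T C) :
    (map₂ θ).app (append X Y) = eqToHom ((map_isStrict F).obj_append X Y) ≫
      tensor ((map₂ θ).app X) ((map₂ θ).app Y) ≫
        eqToHom ((map_isStrict G).obj_append X Y).symm :=
  map₂App_append θ X Y

theorem map_id : map (𝟭 C) = 𝟭 (T C) :=
  IsStrict.ext (map_isStrict _) IsStrict.id (fun _ => rfl) (fun _ => by simp [map_map_of])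

theorem map_comp (F : C ⥤ D) (G : D ⥤ E) : map (F ⋙ G) = map F ⋙ map G :=
  IsStrict.ext (map_isStrict _) ((map_isStrict _).comp (map_isStrict _)) (fun _ => rfl)
    (fun _ => by simpa [map_map_of, eqToHom_map] using (eqToHom_trans_assoc _ _ _).symm)

theorem unit_naturality (F : C ⥤ D) : F ⋙ unit D = unit C ⋙ map F :=
  rfl

theorem mult_naturality (F : C ⥤ D) : map (map F) ⋙ mult D = mult C ⋙ map F :=
  IsStrict.ext ((map_isStrict _).comp mult_isStrict) (mult_isStrict.comp (map_isStrict _))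
    (fun X => (join_single _).trans (congrArg (map F).obj (join_single X)).symm)
    (fun f => by
      simpa [map_map_of, mult_map_of, eqToHom_map] using (eqToHom_trans_assoc _ _ _).symm)

theorem unit_mult : unit (T C) ⋙ mult C = 𝟭 (T C) :=
  CategoryTheory.Functor.ext join_single (fun _ _ f => by simp [unit, mult_map_of])

theorem map_unit_mult : map (unit C) ⋙ mult C = 𝟭 (T C) :=
  IsStrict.ext ((map_isStrict _).comp mult_isStrict) IsStrict.id (fun _ => rfl)
    (fun f => by simp [map_map_of, mult_map_of, eqToHom_map, unit])

theorem mult_mult : map (mult C) ⋙ mult C = mult (T C) ⋙ mult C :=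
  IsStrict.ext ((map_isStrict _).comp mult_isStrict) (mult_isStrict.comp mult_isStrict)
    (fun X => (join_single _).trans (congrArg (mult C).obj (join_single X)).symm)
    (fun f => by
      simpa [map_map_of, mult_map_of, eqToHom_map] using (eqToHom_trans_assoc _ _ _).symm)

theorem map₂_id (F : C ⥤ D) : map₂ (𝟙 F) = 𝟙 (map F) := by
  ext X
  induction X using word_induction with
  | nil => rfl
  | cons x X ih => simp [map₂_append, map₂_single, ih, of_id, tensor_id]

theorem map₂_comp {F G H : C ⥤ D} (θ : F ⟶ G) (φ : G ⟶ H) :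
    map₂ (θ ≫ φ) = map₂ θ ≫ map₂ φ := by
  ext X
  induction X using word_induction with
  | nil => exact (Category.id_comp _).symm
  | cons x X ih =>
    have h : (map₂ (θ ≫ φ)).app (single x) = (map₂ θ).app (single x) ≫ (map₂ φ).app (single x) := by
      simp [map₂_single, of_comp]
    simp [map₂_append, h, ih, tensor_comp]

theorem map_obj_comp (F : C ⥤ D) (G : D ⥤ E) (X : T C) :
    (map (F ⋙ G)).obj X = (map G).obj ((map F).obj X) := by rw [map_comp]; rfl

theorem mult_obj_map (F : C ⥤ D) (W : T (T C)) :
    (mult D).obj ((map (map F)).obj W) = (map F).obj ((mult C).obj W) :=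
  congrArg (fun P => P.obj W) (mult_naturality F)

theorem map₂_whiskerLeft (F : C ⥤ D) {G H : D ⥤ E} (θ : G ⟶ H) (X : T C) :
    (map₂ (F.whiskerLeft θ)).app X = eqToHom (map_obj_comp F G X) ≫
      (map₂ θ).app ((map F).obj X) ≫ eqToHom (map_obj_comp F H X).symm := by
  induction X using word_induction with
  | nil => exact ((Category.id_comp _).trans (Category.comp_id _)).symm
  | cons x X ih => 
    rw [NatTrans.congr (map₂ θ) ((map_isStrict F).obj_append _ _)]
    simp [map₂_append, map₂_single, ih, tensor_congr_left, tensor_congr_right, eqToHom_map, NatTrans.congr (map₂ θ) (map_obj_single F x)]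

theorem map₂_whiskerRight {F G : C ⥤ D} (θ : F ⟶ G) (H : D ⥤ E) (X : T C) :
    (map₂ (Functor.whiskerRight θ H)).app X = eqToHom (map_obj_comp F H X) ≫
      (map H).map ((map₂ θ).app X) ≫ eqToHom (map_obj_comp G H X).symm := by
  induction X using word_induction with
  | nil => simp [map₂_nil, eqToHom_map]
  | cons x X ih => 
    simp [map₂_append, map₂_single, ih, tensor_congr_left, tensor_congr_right, eqToHom_map, (map_isStrict H).map_tensor, map_map_of]

theorem map₂_mult {F G : C ⥤ D} (θ : F ⟶ G) (W : T (T C)) :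
    (mult D).map ((map₂ (map₂ θ)).app W) = eqToHom (mult_obj_map F W) ≫
      (map₂ θ).app ((mult C).obj W) ≫ eqToHom (mult_obj_map G W).symm := by
  induction W using word_induction with
  | nil => rw [map₂_nil, eqToHom_map, NatTrans.congr (map₂ θ) mult_isStrict.obj_nil, map₂_nil]; simp [eqToHom_map]
  | cons X W ih => 
    rw [NatTrans.congr (map₂ θ) (mult_isStrict.obj_append _ _)]
    simp [map₂_append, map₂_single, ih, tensor_congr_left, tensor_congr_right, eqToHom_map, mult_isStrict.map_tensor, mult_map_of, NatTrans.congr (map₂ θ) (mult_obj_single X)]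

end Monad

end T
end Distorted

namespace Distorted

/-! ### Pseudoalgebras, lax morphisms and transformations -/

theorem T.map_obj_id {C : Type u} [Category.{v} C] (X : T C) :
    (T.map (𝟭 C)).obj X = X := by
  rw [T.map_id]; rfl

theorem T.mult_obj_unit {C : Type u} [Category.{v} C] (X : T C) :
    (T.mult C).obj ((T.unit (T C)).obj X) = X :=
  T.mult_obj_single X

theorem T.mult_obj_map_unit {C : Type u} [Category.{v} C] (X : T C) :
    (T.mult C).obj ((T.map (T.unit C)).obj X) = X :=
  congrArg (fun P => P.obj X) T.map_unit_mult

theorem T.mult_obj_map_mult {C : Type u} [Category.{v} C] (V : T (T (T C))) :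
    (T.mult C).obj ((T.map (T.mult C)).obj V) = (T.mult C).obj ((T.mult (T C)).obj V) :=
  congrArg (fun P => P.obj V) T.mult_mult

/-- A pseudoalgebra structure for the 2-monad `T` on a category: an action together with coherent
invertible comparisons replacing the unit law and the multiplication law. -/
structure PseudoAlgebra (A : Type u) [Category.{v} A] where
  act : T A ⥤ A
  unitIso : 𝟭 A ≅ T.unit A ⋙ act
  multIso : T.map act ⋙ act ≅ T.mult A ⋙ act
  unit_left (X : T A) :
    unitIso.hom.app (act.obj X) ≫ multIso.hom.app ((T.unit (T A)).obj X) =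
      act.map (eqToHom (T.mult_obj_unit X).symm)
  unit_right (X : T A) :
    act.map (eqToHom (T.map_obj_id X).symm ≫ (T.map₂ unitIso.hom).app X ≫
        eqToHom (T.map_obj_comp (T.unit A) act X)) ≫
      multIso.hom.app ((T.map (T.unit A)).obj X) =
    act.map (eqToHom (T.mult_obj_map_unit X).symm)
  assoc (V : T (T (T A))) :
    multIso.hom.app ((T.map (T.map act)).obj V) ≫ act.map (eqToHom (T.mult_obj_map act V)) ≫
      multIso.hom.app ((T.mult (T A)).obj V) =
    act.map (eqToHom (T.map_obj_comp (T.map act) act V).symm ≫ (T.map₂ multIso.hom).app V ≫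
        eqToHom (T.map_obj_comp (T.mult A) act V)) ≫
      multIso.hom.app ((T.map (T.mult A)).obj V) ≫
        act.map (eqToHom (T.mult_obj_map_mult V))

/-- A category with a pseudoalgebra structure for the 2-monad `T`. -/
structure PsAlg where
  carrier : Type u
  [category : Category.{v} carrier]
  str : PseudoAlgebra carrier

attribute [instance] PsAlg.category

/-- A lax morphism of pseudoalgebras: a functor with a transformation `b ∘ T F ⟶ F ∘ a` compatible
with the unit and multiplication comparisons. -/
structure LaxMor (A : PsAlg.{v₁, u₁}) (B : PsAlg.{v₂, u₂}) where
  functor : A.carrier ⥤ B.carrier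
  lax : T.map functor ⋙ B.str.act ⟶ A.str.act ⋙ functor
  unit (x : A.carrier) :
    B.str.unitIso.hom.app (functor.obj x) ≫ lax.app ((T.unit A.carrier).obj x) =
      functor.map (A.str.unitIso.hom.app x)
  mult (W : T (T A.carrier)) :
    B.str.multIso.hom.app ((T.map (T.map functor)).obj W) ≫
      B.str.act.map (eqToHom (T.mult_obj_map functor W)) ≫ lax.app ((T.mult A.carrier).obj W) =
    B.str.act.map (eqToHom (T.map_obj_comp (T.map functor) B.str.act W).symm ≫
        (T.map₂ lax).app W ≫ eqToHom (T.map_obj_comp A.str.act functor W)) ≫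
      lax.app ((T.map A.str.act).obj W) ≫ functor.map (A.str.multIso.hom.app W)

/-- A transformation of lax morphisms. -/
@[ext]
structure LaxMor.Hom {A : PsAlg.{v₁, u₁}} {B : PsAlg.{v₂, u₂}} (F G : LaxMor A B) where
  nat : F.functor ⟶ G.functor
  comm (X : T A.carrier) :
    F.lax.app X ≫ nat.app (A.str.act.obj X) =
      B.str.act.map ((T.map₂ nat).app X) ≫ G.lax.app X

namespace LaxMor

instance {A : PsAlg.{v₁, u₁}} {B : PsAlg.{v₂, u₂}} : Category (LaxMor A B) where
  Hom := LaxMor.Hom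
  id F := ⟨𝟙 _, fun X => by simp [T.map₂_id]⟩
  comp η θ := ⟨η.nat ≫ θ.nat, fun X => by
    simp [T.map₂_comp, reassoc_of% η.comm, θ.comm]⟩

@[ext]
theorem hom_ext {A : PsAlg.{v₁, u₁}} {B : PsAlg.{v₂, u₂}} {F G : LaxMor A B} {η θ : F ⟶ G}
    (h : η.nat = θ.nat) : η = θ := Hom.ext h

@[simp]
theorem id_nat {A : PsAlg.{v₁, u₁}} {B : PsAlg.{v₂, u₂}} (F : LaxMor A B) :
    Hom.nat (𝟙 F) = 𝟙 F.functor := rfl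

@[simp]
theorem comp_nat {A : PsAlg.{v₁, u₁}} {B : PsAlg.{v₂, u₂}} {F G H : LaxMor A B} (η : F ⟶ G)
    (θ : G ⟶ H) : (η ≫ θ).nat = η.nat ≫ θ.nat := rfl

theorem map₂_congr {C : Type u₁} [Category.{v₁} C] {D : Type u₂} [Category.{v₂} D]
    {F G F' G' : C ⥤ D} (hF : F = F') (hG : G = G') (θ : F ⟶ G) (θ' : F' ⟶ G')
    (h : θ = eqToHom hF ≫ θ' ≫ eqToHom hG.symm) (X : T C) :
    (T.map₂ θ).app X = eqToHom (by rw [hF]) ≫ (T.map₂ θ').app X ≫ eqToHom (by rw [hG]) := by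
  subst hF hG h; simp

/-- The identity lax morphism. -/
def id (A : PsAlg.{v₁, u₁}) : LaxMor A A where
  functor := 𝟭 _
  lax := { app := fun X => A.str.act.map (eqToHom (T.map_obj_id X))
           naturality := fun X Y f => by
            simp [← Functor.map_comp, Functor.congr_hom T.map_id f] }
  unit x := by
    have h : A.str.act.map (eqToHom (T.map_obj_id ((T.unit A.carrier).obj x))) = 𝟙 _ :=
      A.str.act.map_id _
    simp only [h]
    exact Category.comp_id _
  mult W := by
    rw [map₂_congr (congrArg (· ⋙ A.str.act) T.map_id) rfl _ (𝟙 _)]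
    · rw [NatTrans.congr A.str.multIso.hom
        (show (T.map (T.map (𝟭 A.carrier))).obj W = W by rw [T.map_id, T.map_id]; rfl)]
      simp [T.map₂_id, eqToHom_map]
    · ext X
      simp [eqToHom_app, eqToHom_map]

/-- The comparison of a composite of lax morphisms. -/
def compLax {A : PsAlg.{v₁, u₁}} {B : PsAlg.{v₂, u₂}} {C : PsAlg.{v₃, u₃}} (F : LaxMor A B)
    (G : LaxMor B C) : T.map (F.functor ⋙ G.functor) ⋙ C.str.act ⟶
      A.str.act ⋙ F.functor ⋙ G.functor where
  app X := C.str.act.map (eqToHom (T.map_obj_comp F.functor G.functor X)) ≫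
    G.lax.app ((T.map F.functor).obj X) ≫ G.functor.map (F.lax.app X)
  naturality X Y f := by
    have h₁ := F.lax.naturality f
    have h₂ := G.lax.naturality ((T.map F.functor).map f)
    dsimp at h₁ h₂ ⊢
    simp only [Category.assoc, ← Functor.map_comp, ← h₁]
    rw [G.functor.map_comp, ← reassoc_of% h₂, Functor.congr_hom (T.map_comp F.functor G.functor) f]
    simp [eqToHom_map]

theorem map_map_obj_comp {A : PsAlg.{v₁, u₁}} {B : PsAlg.{v₂, u₂}} {C : PsAlg.{v₃, u₃}}
    (F : LaxMor A B) (G : LaxMor B C) (W : T (T A.carrier)) :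
    (T.map (T.map (F.functor ⋙ G.functor))).obj W =
      (T.map (T.map G.functor)).obj ((T.map (T.map F.functor)).obj W) := by
  rw [T.map_comp, T.map_obj_comp]

theorem map₂_compLax {A : PsAlg.{v₁, u₁}} {B : PsAlg.{v₂, u₂}} {C : PsAlg.{v₃, u₃}}
    (F : LaxMor A B) (G : LaxMor B C) (W : T (T A.carrier)) :
    (T.map₂ (compLax F G)).app W =
      eqToHom (by rw [T.map_obj_comp, T.map_obj_comp, map_map_obj_comp]) ≫
        (T.map₂ G.lax).app ((T.map (T.map F.functor)).obj W) ≫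
          eqToHom (by simp only [T.map_obj_comp]) ≫
            (T.map G.functor).map ((T.map₂ F.lax).app W) ≫
              eqToHom (by simp only [T.map_obj_comp]) := by
  let s : T.map (F.functor ⋙ G.functor) ⋙ C.str.act ⟶
    T.map F.functor ⋙ T.map G.functor ⋙ C.str.act :=
    { app X := C.str.act.map (eqToHom (T.map_obj_comp F.functor G.functor X))
      naturality X Y f := by
        simp [Functor.congr_hom (T.map_comp F.functor G.functor) f, ← Functor.map_comp] }
  have h : compLax F G = (s ≫ Functor.whiskerLeft (T.map F.functor) G.lax) ≫
    Functor.whiskerRight F.lax G.functor := by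
    ext X
    exact (Category.assoc _ _ _).symm
  have hs : (T.map₂ s).app W =
      eqToHom (by rw [T.map_obj_comp, T.map_obj_comp, map_map_obj_comp, T.map_obj_comp]) := by
    rw [map₂_congr (congrArg (· ⋙ C.str.act) (T.map_comp F.functor G.functor)) rfl s (𝟙 _)]
    · simp [T.map₂_id]
    · ext X
      simp [s, eqToHom_app, eqToHom_map]
  have hr : (T.map₂ (Functor.whiskerRight F.lax G.functor)).app W = _ :=
    T.map₂_whiskerRight F.lax G.functor W
  have ht := T.map₂_whiskerLeft (T.map F.functor) G.lax W
  rw [h, T.map₂_comp, T.map₂_comp, NatTrans.comp_app, NatTrans.comp_app, hs, ht]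
  refine (congrArg (fun t => _ ≫ t) hr).trans ?_
  simp

/-- The composite of lax morphisms. -/
def comp {A : PsAlg.{v₁, u₁}} {B : PsAlg.{v₂, u₂}} {C : PsAlg.{v₃, u₃}} (F : LaxMor A B)
    (G : LaxMor B C) : LaxMor A C where
  functor := F.functor ⋙ G.functor
  lax := compLax F G
  unit x := by
    have h₁ := F.unit x
    have h₂ := G.unit (F.functor.obj x)
    have h : C.str.act.map (eqToHom (T.map_obj_comp F.functor G.functor
       ((T.unit A.carrier).obj x))) = 𝟙 _ := C.str.act.map_id _
    simp only [compLax, h]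
    refine (congrArg (fun t => _ ≫ t) (Category.id_comp _)).trans ?_
    refine (Category.assoc _ _ _).symm.trans ?_
    refine (congrArg (fun t => t ≫ _) h₂).trans ?_
    exact (G.functor.map_comp _ _).symm.trans (congrArg _ h₁)
  mult W := by
    have h₁ := congrArg G.functor.map (F.mult W)
    have h₂ := G.mult ((T.map (T.map F.functor)).obj W)
    have h₃ := G.lax.naturality (eqToHom (T.map_obj_comp (T.map F.functor) B.str.act W).symm ≫
        (T.map₂ F.lax).app W ≫ eqToHom (T.map_obj_comp A.str.act F.functor W))
    rw [map₂_compLax]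
    simp only [compLax, Functor.map_comp, eqToHom_map, Functor.comp_map, Functor.comp_obj, Category.assoc] at h₁ h₂ h₃ ⊢
    rw [NatTrans.congr C.str.multIso.hom (map_map_obj_comp F G W),
      NatTrans.congr G.lax (T.mult_obj_map F.functor W).symm]
    have h₁' := (eqToHom_comp_iff _ _ _).1 h₁.symm
    have h₂' := (eqToHom_comp_iff _ _ _).1 h₂.symm
    have h₃' := (eqToHom_comp_iff _ _ _).1 h₃
    simp only [Category.assoc, eqToHom_trans_assoc]
    rw [reassoc_of% h₃', h₁']
    simp only [eqToHom_trans_assoc, eqToHom_refl, Category.id_comp]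
    rw [reassoc_of% h₂']
    simp only [eqToHom_map, eqToHom_trans_assoc]

theorem ext_of_app {A : PsAlg.{v₁, u₁}} {B : PsAlg.{v₂, u₂}} {F G : LaxMor A B}
    (h : F.functor = G.functor)
    (h' : ∀ X, F.lax.app X = eqToHom (by rw [h]) ≫ G.lax.app X ≫ eqToHom (by rw [h])) :
    F = G := by
  obtain ⟨F, l, _, _⟩ := F
  obtain ⟨G, l', _, _⟩ := G
  obtain rfl : F = G := h
  obtain rfl : l = l' := by
    ext X
    simpa using h' X
  rfl

theorem id_comp {A : PsAlg.{v₁, u₁}} {B : PsAlg.{v₂, u₂}} (F : LaxMor A B) :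
    comp (id A) F = F := by
  refine ext_of_app rfl fun X => ?_
  simp only [comp, compLax, id]
  rw [NatTrans.congr F.lax (T.map_obj_id X)]
  simp [eqToHom_map]
  exact (Category.id_comp _).symm

theorem comp_id {A : PsAlg.{v₁, u₁}} {B : PsAlg.{v₂, u₂}} (F : LaxMor A B) :
    comp F (id B) = F := by
  refine ext_of_app rfl fun X => ?_
  simp [comp, compLax, id, eqToHom_map]
  exact (Category.id_comp _).symm

theorem assoc {A : PsAlg.{v₁, u₁}} {B : PsAlg.{v₂, u₂}} {C : PsAlg.{v₃, u₃}}
    {D : PsAlg.{v₄, u₄}} (F : LaxMor A B) (G : LaxMor B C) (H : LaxMor C D) :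
    comp (comp F G) H = comp F (comp G H) := by
  refine ext_of_app rfl fun X => ?_
  simp only [comp, compLax]
  rw [NatTrans.congr H.lax (T.map_obj_comp F.functor G.functor X)]
  simpa [eqToHom_map] using (eqToHom_trans_assoc _ _ _).symm

theorem eqToHom_nat {A : PsAlg.{v₁, u₁}} {B : PsAlg.{v₂, u₂}} {F G : LaxMor A B} (h : F = G)
    (x : A.carrier) : (eqToHom h : F ⟶ G).nat.app x = eqToHom (by rw [h]) := by
  subst h; rfl

/-- Whiskering of a transformation by a lax morphism on the source side. -/
def whiskerLeft {A : PsAlg.{v₁, u₁}} {B : PsAlg.{v₂, u₂}} {C : PsAlg.{v₃, u₃}} (F : LaxMor A B)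
    {G G' : LaxMor B C} (θ : G ⟶ G') : comp F G ⟶ comp F G' where
  nat := Functor.whiskerLeft F.functor θ.nat
  comm X := by
    have h := θ.comm ((T.map F.functor).obj X)
    simp [comp, compLax, T.map₂_whiskerLeft, eqToHom_map]
    rw [← reassoc_of% h]

/-- Whiskering of a transformation by a lax morphism on the target side. -/
def whiskerRight {A : PsAlg.{v₁, u₁}} {B : PsAlg.{v₂, u₂}} {C : PsAlg.{v₃, u₃}}
    {F F' : LaxMor A B} (θ : F ⟶ F') (G : LaxMor B C) : comp F G ⟶ comp F' G where
  nat := Functor.whiskerRight θ.nat G.functor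
  comm X := by
    have h := congrArg G.functor.map (θ.comm X)
    have h' := G.lax.naturality ((T.map₂ θ.nat).app X)
    simp [comp, compLax, T.map₂_whiskerRight, eqToHom_map] at *
    rw [reassoc_of% h', h]

theorem whiskerLeft_app {A : PsAlg.{v₁, u₁}} {B : PsAlg.{v₂, u₂}} {C : PsAlg.{v₃, u₃}}
    (F : LaxMor A B) {G G' : LaxMor B C} (θ : G ⟶ G') (x : A.carrier) :
    (whiskerLeft F θ).nat.app x = θ.nat.app (F.functor.obj x) := rfl

theorem whiskerRight_app {A : PsAlg.{v₁, u₁}} {B : PsAlg.{v₂, u₂}} {C : PsAlg.{v₃, u₃}}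
    {F F' : LaxMor A B} (θ : F ⟶ F') (G : LaxMor B C) (x : A.carrier) :
    (whiskerRight θ G).nat.app x = G.functor.map (θ.nat.app x) := rfl

end LaxMor

/-- The 2-category of pseudoalgebras, lax morphisms and transformations. -/
instance : Bicategory PsAlg.{v, u} where
  Hom A B := LaxMor A B
  id A := LaxMor.id A
  comp F G := LaxMor.comp F G
  whiskerLeft F _ _ θ := LaxMor.whiskerLeft F θ
  whiskerRight θ G := LaxMor.whiskerRight θ G
  associator F G H := eqToIso (LaxMor.assoc F G H)
  leftUnitor F := eqToIso (LaxMor.id_comp F)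
  rightUnitor F := eqToIso (LaxMor.comp_id F)
  whiskerLeft_id F G := by ext x; rfl
  whiskerLeft_comp F _ _ _ θ φ := by ext x; rfl
  id_whiskerLeft θ := by
    ext x
    simp only [LaxMor.comp_nat, NatTrans.comp_app, eqToIso.hom, eqToIso.inv, LaxMor.eqToHom_nat]
    exact ((Category.id_comp _).trans (Category.comp_id _)).symm
  comp_whiskerLeft F G _ _ θ := by
    ext x
    simp only [LaxMor.comp_nat, NatTrans.comp_app, eqToIso.hom, eqToIso.inv, LaxMor.eqToHom_nat]
    exact ((Category.id_comp _).trans (Category.comp_id _)).symm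
  id_whiskerRight F G := by ext x; exact G.functor.map_id _
  comp_whiskerRight θ φ G := by ext x; exact G.functor.map_comp _ _
  whiskerRight_id θ := by
    ext x
    simp only [LaxMor.comp_nat, NatTrans.comp_app, eqToIso.hom, eqToIso.inv, LaxMor.eqToHom_nat]
    exact ((Category.id_comp _).trans (Category.comp_id _)).symm
  whiskerRight_comp θ G H := by
    ext x
    simp only [LaxMor.comp_nat, NatTrans.comp_app, eqToIso.hom, eqToIso.inv, LaxMor.eqToHom_nat]
    exact ((Category.id_comp _).trans (Category.comp_id _)).symm
  whisker_assoc _ _ _ _ _ := by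
    ext x
    simp only [LaxMor.comp_nat, NatTrans.comp_app, eqToIso.hom, eqToIso.inv, LaxMor.eqToHom_nat]
    exact ((Category.id_comp _).trans (Category.comp_id _)).symm
  whisker_exchange θ φ := by ext x; exact (φ.nat.naturality (θ.nat.app x)).symm
  pentagon F G H K := by
    ext x
    simp [LaxMor.eqToHom_nat, LaxMor.whiskerLeft_app, LaxMor.whiskerRight_app, eqToHom_map]
    exact (Category.id_comp _).trans (Category.id_comp _)
  triangle F G := by
    ext x
    simp [LaxMor.eqToHom_nat, LaxMor.whiskerLeft_app, LaxMor.whiskerRight_app, eqToHom_map]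
    exact Category.id_comp _

end Distorted

namespace Distorted

/-! ### Distorted monoidal categories -/

open MonoidalCategory

/-- The axioms for a unit distortion `Λ` and a binary distortion `σ` on a monoidal category:
binaturality, unit normalization, the two hexagons, and monoidality of `Λ`. -/
structure IsDistortion (C : Type u) [Category.{v} C] [MonoidalCategory C] (Λ : 𝟭 C ⟶ 𝟭 C)
    (σ : ∀ X Y : C, X ⊗ Y ⟶ Y ⊗ X) : Prop where
  binatural {X X' Y Y' : C} (f : X ⟶ X') (g : Y ⟶ Y') :
    σ X Y ≫ (g ⊗ₘ f) = (f ⊗ₘ g) ≫ σ X' Y'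
  σ_unit (X : C) : σ X (𝟙_ C) = (ρ_ X).hom ≫ (λ_ X).inv
  unit_σ (X : C) : σ (𝟙_ C) X = (λ_ X).hom ≫ (ρ_ X).inv
  Λ_unit : Λ.app (𝟙_ C) = 𝟙 (𝟙_ C)
  hexagon_left (X Y Z : C) :
    σ (X ⊗ Y) Z = (α_ X Y Z).hom ≫ (𝟙 X ⊗ₘ σ Y Z) ≫ (α_ X Z Y).inv ≫ (σ X Z ⊗ₘ 𝟙 Y) ≫
      (α_ Z X Y).hom
  hexagon_right (X Y Z : C) :
    σ X (Y ⊗ Z) = (α_ X Y Z).inv ≫ (σ X Y ⊗ₘ 𝟙 Z) ≫ (α_ Y X Z).hom ≫ (𝟙 Y ⊗ₘ σ X Z) ≫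
      (α_ Y Z X).inv
  Λ_tensor (X Y : C) : Λ.app (X ⊗ Y) = Λ.app X ⊗ₘ Λ.app Y

/-- A distorted monoidal category. -/
structure DistMon where
  carrier : Type u
  [category : Category.{v} carrier]
  [monoidal : MonoidalCategory carrier]
  Λ : 𝟭 carrier ⟶ 𝟭 carrier
  σ : ∀ X Y : carrier, X ⊗ Y ⟶ Y ⊗ X
  isDistortion : IsDistortion carrier Λ σ

attribute [instance] DistMon.category DistMon.monoidal

/-- A `σ`-lax monoidal functor. -/
structure SigmaLax (A : DistMon.{v₁, u₁}) (B : DistMon.{v₂, u₂}) where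
  functor : A.carrier ⥤ B.carrier
  [lax : functor.LaxMonoidal]
  map_Λ (Z : A.carrier) : functor.map (A.Λ.app Z) = B.Λ.app (functor.obj Z)
  map_σ (X Y : A.carrier) :
    Functor.LaxMonoidal.μ functor X Y ≫ functor.map (A.σ X Y) =
      B.σ (functor.obj X) (functor.obj Y) ≫ Functor.LaxMonoidal.μ functor Y X

attribute [instance] SigmaLax.lax

/-- A monoidal natural transformation. -/
@[ext]
structure SigmaLax.Hom {A : DistMon.{v₁, u₁}} {B : DistMon.{v₂, u₂}} (F G : SigmaLax A B) where
  nat : F.functor ⟶ G.functor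
  isMonoidal : NatTrans.IsMonoidal nat

namespace SigmaLax

variable {A : DistMon.{v₁, u₁}} {B : DistMon.{v₂, u₂}} {C : DistMon.{v₃, u₃}}

instance : Category (SigmaLax A B) where
  Hom := SigmaLax.Hom
  id F := ⟨𝟙 _, inferInstance⟩
  comp η θ := ⟨η.nat ≫ θ.nat,
    haveI := η.isMonoidal; haveI := θ.isMonoidal; inferInstance⟩

@[ext]
theorem hom_ext {F G : SigmaLax A B} {η θ : F ⟶ G} (h : η.nat = θ.nat) : η = θ := Hom.ext h

@[simp]
theorem id_nat (F : SigmaLax A B) : Hom.nat (𝟙 F) = 𝟙 F.functor := rfl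

@[simp]
theorem comp_nat {F G H : SigmaLax A B} (η : F ⟶ G) (θ : G ⟶ H) :
    (η ≫ θ).nat = η.nat ≫ θ.nat := rfl

/-- The identity `σ`-lax monoidal functor. -/
def id (A : DistMon.{v₁, u₁}) : SigmaLax A A where
  functor := 𝟭 _
  map_Λ _ := rfl
  map_σ _ _ := by simp

/-- The composite of `σ`-lax monoidal functors. -/
def comp (F : SigmaLax A B) (G : SigmaLax B C) : SigmaLax A C where
  functor := F.functor ⋙ G.functor
  map_Λ Z := by simp [F.map_Λ, G.map_Λ]
  map_σ X Y := by
    have h := G.map_σ (F.functor.obj X) (F.functor.obj Y)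
    simp only [Functor.LaxMonoidal.comp_μ, Functor.comp_map, Category.assoc,
      ← Functor.map_comp, F.map_σ]
    rw [Functor.map_comp, reassoc_of% h]
    rfl

/-- The laxator. -/
def μ (F : SigmaLax A B) (X Y : A.carrier) :
    F.functor.obj X ⊗ F.functor.obj Y ⟶ F.functor.obj (X ⊗ Y) :=
  Functor.LaxMonoidal.μ F.functor X Y

/-- The unit laxator. -/
def μ₀ (F : SigmaLax A B) : 𝟙_ B.carrier ⟶ F.functor.obj (𝟙_ A.carrier) :=
  Functor.LaxMonoidal.ε F.functor

theorem ext_of_app {F G : SigmaLax A B} (h : F.functor = G.functor)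
    (h₀ : F.μ₀ = G.μ₀ ≫ eqToHom (by rw [h]))
    (h₂ : ∀ X Y, F.μ X Y = eqToHom (by rw [h]) ≫ G.μ X Y ≫ eqToHom (by rw [h])) :
    F = G := by
  obtain @⟨F, l, _, _⟩ := F
  obtain @⟨G, l', _, _⟩ := G
  obtain rfl : F = G := h
  obtain rfl : l = l' := by
    apply Functor.LaxMonoidal.ext
    · simpa [μ₀] using h₀
    · ext X Y
      simpa [μ] using h₂ X Y
  rfl

theorem id_comp (F : SigmaLax A B) : comp (id A) F = F := by
  refine ext_of_app rfl ?_ fun X Y => ?_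
  · exact congrArg (fun t => F.μ₀ ≫ t) (F.functor.map_id _)
  · exact (congrArg (fun t => F.μ X Y ≫ t) (F.functor.map_id _)).trans (Category.id_comp _).symm

theorem comp_id (F : SigmaLax A B) : comp F (id B) = F := by
  refine ext_of_app rfl ?_ fun X Y => ?_
  · exact (Category.id_comp F.μ₀).trans (Category.comp_id _).symm
  · exact (Category.id_comp (F.μ X Y)).trans
      ((Category.id_comp _).trans (Category.comp_id _)).symm

theorem assoc {D : DistMon.{v₄, u₄}} (F : SigmaLax A B) (G : SigmaLax B C) (H : SigmaLax C D) :
    comp (comp F G) H = comp F (comp G H) := by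
  refine ext_of_app rfl ?_ fun X Y => ?_
  · change H.μ₀ ≫ H.functor.map (G.μ₀ ≫ G.functor.map F.μ₀) =
      ((H.μ₀ ≫ H.functor.map G.μ₀) ≫ H.functor.map (G.functor.map F.μ₀)) ≫ 𝟙 _
    simp
  · change H.μ _ _ ≫ H.functor.map (G.μ _ _ ≫ G.functor.map (F.μ X Y)) =
      𝟙 _ ≫ ((H.μ _ _ ≫ H.functor.map (G.μ _ _)) ≫ H.functor.map (G.functor.map (F.μ X Y))) ≫ 𝟙 _
    simp

theorem eqToHom_nat {F G : SigmaLax A B} (h : F = G) (x : A.carrier) :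
    (eqToHom h : F ⟶ G).nat.app x = eqToHom (by rw [h]) := by
  subst h; rfl

/-- Whiskering on the source side. -/
def whiskerLeft (F : SigmaLax A B) {G G' : SigmaLax B C} (θ : G ⟶ G') : comp F G ⟶ comp F G' where
  nat := Functor.whiskerLeft F.functor θ.nat
  isMonoidal :=
    haveI := θ.isMonoidal
    NatTrans.IsMonoidal.whiskerLeft θ.nat

/-- Whiskering on the target side. -/
def whiskerRight {F F' : SigmaLax A B} (θ : F ⟶ F') (G : SigmaLax B C) : comp F G ⟶ comp F' G where
  nat := Functor.whiskerRight θ.nat G.functor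
  isMonoidal :=
    haveI := θ.isMonoidal
    NatTrans.IsMonoidal.whiskerRight θ.nat

theorem whiskerLeft_app (F : SigmaLax A B) {G G' : SigmaLax B C} (θ : G ⟶ G') (x : A.carrier) :
    (whiskerLeft F θ).nat.app x = θ.nat.app (F.functor.obj x) := rfl

theorem whiskerRight_app {F F' : SigmaLax A B} (θ : F ⟶ F') (G : SigmaLax B C) (x : A.carrier) :
    (whiskerRight θ G).nat.app x = G.functor.map (θ.nat.app x) := rfl

end SigmaLax

/-- The 2-category of distorted monoidal categories, `σ`-lax monoidal functors and monoidal natural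
transformations. -/
instance : Bicategory DistMon.{v, u} where
  Hom A B := SigmaLax A B
  id A := SigmaLax.id A
  comp F G := SigmaLax.comp F G
  whiskerLeft F _ _ θ := SigmaLax.whiskerLeft F θ
  whiskerRight θ G := SigmaLax.whiskerRight θ G
  associator F G H := eqToIso (SigmaLax.assoc F G H)
  leftUnitor F := eqToIso (SigmaLax.id_comp F)
  rightUnitor F := eqToIso (SigmaLax.comp_id F)
  whiskerLeft_id F G := by ext x; rfl
  whiskerLeft_comp F _ _ _ θ φ := by ext x; rfl
  id_whiskerLeft θ := by
    ext x
    simp only [SigmaLax.comp_nat, NatTrans.comp_app, eqToIso.hom, eqToIso.inv, SigmaLax.eqToHom_nat]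
    exact ((Category.id_comp _).trans (Category.comp_id _)).symm
  comp_whiskerLeft F G _ _ θ := by
    ext x
    simp only [SigmaLax.comp_nat, NatTrans.comp_app, eqToIso.hom, eqToIso.inv, SigmaLax.eqToHom_nat]
    exact ((Category.id_comp _).trans (Category.comp_id _)).symm
  id_whiskerRight F G := by ext x; exact G.functor.map_id _
  comp_whiskerRight θ φ G := by ext x; exact G.functor.map_comp _ _
  whiskerRight_id θ := by
    ext x
    simp only [SigmaLax.comp_nat, NatTrans.comp_app, eqToIso.hom, eqToIso.inv, SigmaLax.eqToHom_nat]
    exact ((Category.id_comp _).trans (Category.comp_id _)).symm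
  whiskerRight_comp θ G H := by
    ext x
    simp only [SigmaLax.comp_nat, NatTrans.comp_app, eqToIso.hom, eqToIso.inv, SigmaLax.eqToHom_nat]
    exact ((Category.id_comp _).trans (Category.comp_id _)).symm
  whisker_assoc _ _ _ _ _ := by
    ext x
    simp only [SigmaLax.comp_nat, NatTrans.comp_app, eqToIso.hom, eqToIso.inv, SigmaLax.eqToHom_nat]
    exact ((Category.id_comp _).trans (Category.comp_id _)).symm
  whisker_exchange θ φ := by ext x; exact (φ.nat.naturality (θ.nat.app x)).symm
  pentagon F G H K := by
    ext x
    simp [SigmaLax.eqToHom_nat, SigmaLax.whiskerLeft_app, SigmaLax.whiskerRight_app, eqToHom_map]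
    exact (Category.id_comp _).trans (Category.id_comp _)
  triangle F G := by
    ext x
    simp [SigmaLax.eqToHom_nat, SigmaLax.whiskerLeft_app, SigmaLax.whiskerRight_app, eqToHom_map]
    exact Category.id_comp _

end Distorted

namespace Distorted

/-! ### The distorted monoidal category underlying a pseudoalgebra -/

open MonoidalCategory

namespace PseudoAlgebra

variable {A : Type u} [Category.{v} A] (a : PseudoAlgebra A)

/-- The binary tensor product: the action on words of length two. -/
def tensorObj (x y : A) : A := a.act.obj (T.append (T.single x) (T.single y))

def tensorHom {x x' y y' : A} (f : x ⟶ x') (g : y ⟶ y') : a.tensorObj x y ⟶ a.tensorObj x' y' :=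
  a.act.map (T.tensor (T.of f) (T.of g))

def tensorIso {x x' y y' : A} (f : x ≅ x') (g : y ≅ y') : a.tensorObj x y ≅ a.tensorObj x' y' where
  hom := a.tensorHom f.hom g.hom
  inv := a.tensorHom f.inv g.inv
  hom_inv_id := by
    simp [tensorHom, tensorObj, ← Functor.map_comp, ← T.tensor_comp, ← T.of_comp, T.of_id,
      T.tensor_id]
  inv_hom_id := by
    simp [tensorHom, tensorObj, ← Functor.map_comp, ← T.tensor_comp, ← T.of_comp, T.of_id,
      T.tensor_id]

/-- The isomorphism of an object with the action on the one-letter word. -/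
def unitCmp (x : A) : x ≅ a.act.obj (T.single x) := a.unitIso.app x

/-- The multiplication comparison at a word of two words. -/
def tensorCmp (X Y : T A) :
    a.tensorObj (a.act.obj X) (a.act.obj Y) ≅ a.act.obj (T.append X Y) :=
  a.multIso.app (T.append (T.single X) (T.single Y)) ≪≫ a.act.mapIso (eqToIso (T.join_pair X Y))

/-- The tensor product, unit, associator and unitors of a pseudoalgebra. -/
@[reducible]
def monoidalStruct : MonoidalCategoryStruct A where
  tensorObj := a.tensorObj
  tensorHom f g := a.tensorHom f g
  whiskerLeft x _ _ f := a.tensorHom (𝟙 x) f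
  whiskerRight f y := a.tensorHom f (𝟙 y)
  tensorUnit := a.act.obj T.nil
  associator x y z :=
    a.tensorIso (Iso.refl _) (a.unitCmp z) ≪≫
      a.tensorCmp (T.append (T.single x) (T.single y)) (T.single z) ≪≫
      a.act.mapIso (eqToIso (T.append_assoc _ _ _)) ≪≫
      (a.tensorCmp (T.single x) (T.append (T.single y) (T.single z))).symm ≪≫
      (a.tensorIso (a.unitCmp x) (Iso.refl _)).symm
  leftUnitor x :=
    a.tensorIso (Iso.refl _) (a.unitCmp x) ≪≫ a.tensorCmp T.nil (T.single x) ≪≫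
      a.act.mapIso (eqToIso (T.nil_append _)) ≪≫ (a.unitCmp x).symm
  rightUnitor x :=
    a.tensorIso (a.unitCmp x) (Iso.refl _) ≪≫ a.tensorCmp (T.single x) T.nil ≪≫
      a.act.mapIso (eqToIso (T.append_nil _)) ≪≫ (a.unitCmp x).symm

/-- The unit distortion of a pseudoalgebra. -/
def Λ : 𝟭 A ⟶ 𝟭 A :=
  a.unitIso.hom ≫
    Functor.whiskerRight (Functor.whiskerLeft (T.unit A) (T.distNat A)) a.act ≫ a.unitIso.inv

/-- The binary distortion of a pseudoalgebra. -/
def σ (x y : A) : a.tensorObj x y ⟶ a.tensorObj y x :=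
  a.act.map (T.swap (T.single x) (T.single y))

end PseudoAlgebra

/-- The laxator of a lax morphism: its comparison at a word of length two. -/
def LaxMor.μ {A : PsAlg.{v₁, u₁}} {B : PsAlg.{v₂, u₂}} (F : LaxMor A B) (x y : A.carrier) :
    B.str.tensorObj (F.functor.obj x) (F.functor.obj y) ⟶ F.functor.obj (A.str.tensorObj x y) :=
  F.lax.app (T.append (T.single x) (T.single y))

/-- The unit laxator of a lax morphism: its comparison at the empty word. -/
def LaxMor.μ₀ {A : PsAlg.{v₁, u₁}} {B : PsAlg.{v₂, u₂}} (F : LaxMor A B) :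
    B.str.act.obj T.nil ⟶ F.functor.obj (A.str.act.obj T.nil) :=
  F.lax.app T.nil

theorem LaxMor.comp_μ {A : PsAlg.{v₁, u₁}} {B : PsAlg.{v₂, u₂}} {C : PsAlg.{v₃, u₃}}
    (F : LaxMor A B) (G : LaxMor B C) (x y : A.carrier) :
    (comp F G).μ x y =
      G.μ (F.functor.obj x) (F.functor.obj y) ≫ G.functor.map (F.μ x y) :=
  (congrArg (fun t => t ≫ _) (C.str.act.map_id _)).trans (Category.id_comp _)

theorem LaxMor.comp_μ₀ {A : PsAlg.{v₁, u₁}} {B : PsAlg.{v₂, u₂}} {C : PsAlg.{v₃, u₃}}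
    (F : LaxMor A B) (G : LaxMor B C) :
    (comp F G).μ₀ = G.μ₀ ≫ G.functor.map F.μ₀ :=
  (congrArg (fun t => t ≫ _) (C.str.act.map_id _)).trans (Category.id_comp _)

/-- The data of a monoidal category satisfy the axioms. -/
def IsMonoidalStruct {C : Type u} [Category.{v} C] (s : MonoidalCategoryStruct C) : Prop :=
  ∃ M : MonoidalCategory C, M.toMonoidalCategoryStruct = s

/-- The monoidal category with given data. -/
@[reducible]
def monoidalOfStruct {C : Type u} [Category.{v} C] (s : MonoidalCategoryStruct C)
    (h : IsMonoidalStruct s) : MonoidalCategory C :=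
  { s with
    tensorHom_def := by obtain ⟨M, rfl⟩ := h; exact M.tensorHom_def
    id_tensorHom_id := by obtain ⟨M, rfl⟩ := h; exact M.id_tensorHom_id
    tensorHom_comp_tensorHom := by obtain ⟨M, rfl⟩ := h; exact M.tensorHom_comp_tensorHom
    whiskerLeft_id := by obtain ⟨M, rfl⟩ := h; exact M.whiskerLeft_id
    id_whiskerRight := by obtain ⟨M, rfl⟩ := h; exact M.id_whiskerRight
    associator_naturality := by obtain ⟨M, rfl⟩ := h; exact M.associator_naturality
    leftUnitor_naturality := by obtain ⟨M, rfl⟩ := h; exact M.leftUnitor_naturality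
    rightUnitor_naturality := by obtain ⟨M, rfl⟩ := h; exact M.rightUnitor_naturality
    pentagon := by obtain ⟨M, rfl⟩ := h; exact M.pentagon
    triangle := by obtain ⟨M, rfl⟩ := h; exact M.triangle }

/-- The data underlying a pseudoalgebra form a distorted monoidal category. -/
def PsAlg.IsDistorted (A : PsAlg.{v, u}) : Prop :=
  ∃ h : IsMonoidalStruct A.str.monoidalStruct,
    @IsDistortion A.carrier _ (monoidalOfStruct _ h) A.str.Λ A.str.σ

/-- The distorted monoidal category underlying a pseudoalgebra. -/
def PsAlg.toDistMon (A : PsAlg.{v, u}) (h : A.IsDistorted) : DistMon.{v, u} where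
  carrier := A.carrier
  monoidal := monoidalOfStruct A.str.monoidalStruct h.1
  Λ := A.str.Λ
  σ := A.str.σ
  isDistortion := h.2

/-- A functor with a laxator and a unit laxator satisfies the axioms of a `σ`-lax monoidal
functor. -/
structure IsSigmaLax {A : DistMon.{v₁, u₁}} {B : DistMon.{v₂, u₂}} (F : A.carrier ⥤ B.carrier)
    (μ : ∀ X Y : A.carrier, F.obj X ⊗ F.obj Y ⟶ F.obj (X ⊗ Y))
    (μ₀ : 𝟙_ B.carrier ⟶ F.obj (𝟙_ A.carrier)) : Prop where
  lax : ∃ L : F.LaxMonoidal, L.μ = μ ∧ L.ε = μ₀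
  map_Λ (Z : A.carrier) : F.map (A.Λ.app Z) = B.Λ.app (F.obj Z)
  map_σ (X Y : A.carrier) : μ X Y ≫ F.map (A.σ X Y) = B.σ (F.obj X) (F.obj Y) ≫ μ Y X

/-- The `σ`-lax monoidal functor with given data. -/
def IsSigmaLax.toSigmaLax {A : DistMon.{v₁, u₁}} {B : DistMon.{v₂, u₂}}
    {F : A.carrier ⥤ B.carrier} {μ : ∀ X Y : A.carrier, F.obj X ⊗ F.obj Y ⟶ F.obj (X ⊗ Y)}
    {μ₀ : 𝟙_ B.carrier ⟶ F.obj (𝟙_ A.carrier)} (h : IsSigmaLax F μ μ₀) : SigmaLax A B :=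
  letI : F.LaxMonoidal :=
    { μ := μ
      ε := μ₀
      μ_natural_left := by obtain ⟨L, rfl, rfl⟩ := h.lax; exact L.μ_natural_left
      μ_natural_right := by obtain ⟨L, rfl, rfl⟩ := h.lax; exact L.μ_natural_right
      associativity := by obtain ⟨L, rfl, rfl⟩ := h.lax; exact L.associativity
      left_unitality := by obtain ⟨L, rfl, rfl⟩ := h.lax; exact L.left_unitality
      right_unitality := by obtain ⟨L, rfl, rfl⟩ := h.lax; exact L.right_unitality }
  { functor := F
    map_Λ := h.map_Λ
    map_σ := h.map_σ }

/-- The data underlying pseudoalgebras, lax morphisms and transformations form distorted monoidal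
categories, `σ`-lax monoidal functors and monoidal natural transformations. -/
structure HasUnderlying : Prop where
  obj (A : PsAlg.{v, u}) : A.IsDistorted
  map {A B : PsAlg.{v, u}} (F : A ⟶ B) :
    IsSigmaLax (A := A.toDistMon (obj A)) (B := B.toDistMon (obj B)) (LaxMor.functor F)
      (LaxMor.μ F) (LaxMor.μ₀ F)
  map₂ {A B : PsAlg.{v, u}} {F G : A ⟶ B} (θ : F ⟶ G) :
    NatTrans.IsMonoidal (F₁ := (map F).toSigmaLax.functor) (F₂ := (map G).toSigmaLax.functor)
      (LaxMor.Hom.nat θ)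

/-- The strict 2-functor sending a pseudoalgebra to its underlying distorted monoidal category, a
lax morphism to its underlying `σ`-lax monoidal functor, and a transformation to itself. -/
def HasUnderlying.functor (h : HasUnderlying.{v, u}) :
    StrictPseudofunctor PsAlg.{v, u} DistMon.{v, u} :=
  StrictPseudofunctor.mk'
    { obj := fun A => A.toDistMon (h.obj A)
      map := fun F => (h.map F).toSigmaLax
      map₂ := fun θ => ⟨LaxMor.Hom.nat θ, h.map₂ θ⟩
      map_id := fun A => by
        refine SigmaLax.ext_of_app rfl ?_ fun X Y => ?_
        · exact (A.str.act.map_id _).trans (Category.comp_id _).symm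
        · exact (A.str.act.map_id _).trans ((Category.id_comp _).trans (Category.comp_id _)).symm
      map_comp := fun F G => by
        refine SigmaLax.ext_of_app rfl ?_ fun X Y => ?_
        · refine Eq.trans ?_ (Category.comp_id _).symm
          exact LaxMor.comp_μ₀ F G
        · refine Eq.trans ?_ ((Category.id_comp _).trans (Category.comp_id _)).symm
          exact LaxMor.comp_μ F G X Y
      map₂_whisker_left := fun F _ _ θ => by
        refine SigmaLax.hom_ext (NatTrans.ext (funext fun x => ?_))
        rw [SigmaLax.comp_nat, SigmaLax.comp_nat, NatTrans.comp_app, NatTrans.comp_app,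
          SigmaLax.eqToHom_nat, SigmaLax.eqToHom_nat]
        exact ((Category.id_comp _).trans (Category.comp_id _)).symm
      map₂_whisker_right := fun θ G => by
        refine SigmaLax.hom_ext (NatTrans.ext (funext fun x => ?_))
        rw [SigmaLax.comp_nat, SigmaLax.comp_nat, NatTrans.comp_app, NatTrans.comp_app,
          SigmaLax.eqToHom_nat, SigmaLax.eqToHom_nat]
        exact ((Category.id_comp _).trans (Category.comp_id _)).symm
      map₂_left_unitor := fun F => by
        refine SigmaLax.hom_ext (NatTrans.ext (funext fun x => ?_))
        rw [SigmaLax.comp_nat, NatTrans.comp_app, SigmaLax.eqToHom_nat]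
        refine (LaxMor.eqToHom_nat _ _).trans ?_
        have k := SigmaLax.eqToHom_nat (SigmaLax.id_comp (h.map F).toSigmaLax) x
        exact ((congrArg (fun t => 𝟙 _ ≫ t) k).trans (Category.id_comp _)).symm
      map₂_right_unitor := fun F => by
        refine SigmaLax.hom_ext (NatTrans.ext (funext fun x => ?_))
        rw [SigmaLax.comp_nat, NatTrans.comp_app, SigmaLax.eqToHom_nat]
        refine (LaxMor.eqToHom_nat _ _).trans ?_
        have k := SigmaLax.eqToHom_nat (SigmaLax.comp_id (h.map F).toSigmaLax) x
        exact ((congrArg (fun t => 𝟙 _ ≫ t) k).trans (Category.id_comp _)).symm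
      map₂_associator := fun F G H => by
        refine SigmaLax.hom_ext (NatTrans.ext (funext fun x => ?_))
        rw [SigmaLax.comp_nat, SigmaLax.comp_nat, NatTrans.comp_app, NatTrans.comp_app,
          SigmaLax.eqToHom_nat, SigmaLax.eqToHom_nat]
        refine (LaxMor.eqToHom_nat _ _).trans ?_
        have k := SigmaLax.eqToHom_nat (SigmaLax.assoc (h.map F).toSigmaLax (h.map G).toSigmaLax
          (h.map H).toSigmaLax) x
        exact ((congrArg (fun t => 𝟙 _ ≫ t ≫ 𝟙 _) k).trans
          ((Category.id_comp _).trans (Category.comp_id _))).symm }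

end Distorted

namespace Distorted

/-! ### Horizontal composition and biequivalences -/

open Bicategory

/-- The horizontal composite of 2-cells. -/
def hcomp {B : Type u} [Bicategory.{v₁, v} B] {a b c : B} {f f' : a ⟶ b} {g g' : b ⟶ c}
    (θ : f ⟶ f') (φ : g ⟶ g') : f ≫ g ⟶ f' ≫ g' :=
  θ ▷ g ≫ f' ◁ φ

/-- A strict 2-functor is a biequivalence: it is surjective on objects up to equivalence, and an
equivalence on each category of 1-cells and 2-cells. -/
structure IsBiequivalence {B : Type u₁} [Bicategory.{v₁, u₂} B] {C : Type u} [Bicategory.{v₂, v} C]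
    (U : StrictPseudofunctor B C) : Prop where
  essSurj (c : C) : ∃ b : B, Nonempty (Bicategory.Equivalence (U.obj b) c)
  isEquivalence (a b : B) : (U.mapFunctor a b).IsEquivalence

end Distorted

/-! The engine is a universal property of free objects. Let `P` and `Q` be σ-lax monoidal functors
from the free object on `C` to `D`, with `P` strong. A monoidal transformation `P ⟶ Q` is then the
same thing as a family of morphisms at one-letter words that is natural in `C`
(`SigmaLax.hom_ext_single`, `SigmaLax.extend`). A word is a tensor product of letters, so
invertibility of the laxators of `P` forces the value at every word; naturality with respect to the
distortions comes for free, since `P` and `Q` both respect them. Since the 2-monad acts by strict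
morphisms, which are strong, the coherence laws of pseudoalgebras and lax morphisms become equations
between monoidal transformations and need only be checked on one-letter words. The strict 2-monad
laws enter as equalities of σ-lax functors (`T.mapLax_mult`, `T.multLax_mult`, ...).

From a pseudoalgebra to a distorted monoidal category: the action `a` is a functor from the strict
monoidal category of words, it hits every object up to isomorphism (`x ≅ a[x]`), and the
multiplication comparison at `[X, Y]` gives isomorphisms `aX ⊗ aY ≅ a(XY)`. The associativity and
unit laws of the pseudoalgebra say that these are compatible with associators and unitors
(`PseudoAlgebra.multApp_append`, `PseudoAlgebra.tensorCmp_assoc`), so pentagon, triangle, hexagons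
and the remaining axioms are transported along `a` from the words (`MonoidalPresentation`,
`isDistortion_of_dense`). The axioms of a σ-lax functor for a lax morphism are transported in the
same way (`LaxPresentation`), because its comparison is invertible on one-letter words.

From a distorted monoidal category to a pseudoalgebra: words act by right-nested tensor products.
The relations of the free object hold in `D` (`DistMon.wordHom_rel`), and the multiplication
comparison and its laws come from the universal property.

On 1-cells, the unit law of a lax morphism fixes its comparison at one-letter words, hence
everywhere, and any σ-lax functor supplies such a comparison by extension
(`LaxMor.sigmaLax_bijective`); 2-cells are treated likewise (`LaxMor.sigmaHom_bijective`). For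
objects, the identity functor carries mutually inverse σ-lax structures between `D` and the category
underlying its pseudoalgebra (`DistMon.actEquivalence`). Interchange is the exchange law of
whiskerings. -/

namespace Distorted

open MonoidalCategory

/-! ### Laxator identities and strong functors -/

namespace SigmaLax

variable {A : DistMon.{v₁, u₁}} {B : DistMon.{v₂, u₂}}

/-- A monoidal transformation from its components. -/
def homMk {F G : SigmaLax A B} (θ : F.functor ⟶ G.functor)
    (unit : F.μ₀ ≫ θ.app (𝟙_ A.carrier) = G.μ₀)
    (tensor : ∀ X Y, F.μ X Y ≫ θ.app (X ⊗ Y) = (θ.app X ⊗ₘ θ.app Y) ≫ G.μ X Y) : F ⟶ G :=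
  ⟨θ, { unit := unit, tensor := tensor }⟩

theorem hom_unit {F G : SigmaLax A B} (θ : F ⟶ G) :
    F.μ₀ ≫ θ.nat.app (𝟙_ A.carrier) = G.μ₀ :=
  θ.isMonoidal.unit

theorem hom_tensor {F G : SigmaLax A B} (θ : F ⟶ G) (X Y : A.carrier) :
    F.μ X Y ≫ θ.nat.app (X ⊗ Y) = (θ.nat.app X ⊗ₘ θ.nat.app Y) ≫ G.μ X Y :=
  θ.isMonoidal.tensor X Y

theorem μ_naturality (F : SigmaLax A B) {X X' Y Y' : A.carrier} (f : X ⟶ X') (g : Y ⟶ Y') :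
    (F.functor.map f ⊗ₘ F.functor.map g) ≫ F.μ X' Y' = F.μ X Y ≫ F.functor.map (f ⊗ₘ g) :=
  Functor.LaxMonoidal.μ_natural F.functor f g

theorem μ_assoc (F : SigmaLax A B) (X Y Z : A.carrier) :
    (F.μ X Y ⊗ₘ 𝟙 (F.functor.obj Z)) ≫ F.μ (X ⊗ Y) Z ≫ F.functor.map (α_ X Y Z).hom =
      (α_ _ _ _).hom ≫ (𝟙 (F.functor.obj X) ⊗ₘ F.μ Y Z) ≫ F.μ X (Y ⊗ Z) := by
  rw [tensorHom_id, id_tensorHom]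
  exact Functor.LaxMonoidal.associativity F.functor X Y Z

theorem μ_leftUnit (F : SigmaLax A B) (X : A.carrier) :
    (F.μ₀ ⊗ₘ 𝟙 (F.functor.obj X)) ≫ F.μ (𝟙_ _) X ≫ F.functor.map (λ_ X).hom = (λ_ _).hom := by
  rw [tensorHom_id]
  exact (Functor.LaxMonoidal.left_unitality F.functor X).symm

theorem μ_rightUnit (F : SigmaLax A B) (X : A.carrier) :
    (𝟙 (F.functor.obj X) ⊗ₘ F.μ₀) ≫ F.μ X (𝟙_ _) ≫ F.functor.map (ρ_ X).hom = (ρ_ _).hom := by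
  rw [id_tensorHom]
  exact (Functor.LaxMonoidal.right_unitality F.functor X).symm

theorem comp_μ {C : DistMon.{v₃, u₃}} (F : SigmaLax A B) (G : SigmaLax B C) (X Y : A.carrier) :
    (comp F G).μ X Y = G.μ _ _ ≫ G.functor.map (F.μ X Y) := rfl

theorem comp_μ₀ {C : DistMon.{v₃, u₃}} (F : SigmaLax A B) (G : SigmaLax B C) :
    (comp F G).μ₀ = G.μ₀ ≫ G.functor.map F.μ₀ := rfl

/-- A `σ`-lax monoidal functor is strong if its laxators are invertible. -/
structure IsStrong (F : SigmaLax A B) : Prop where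
  isIso_μ (X Y : A.carrier) : IsIso (F.μ X Y)
  isIso_μ₀ : IsIso F.μ₀

theorem IsStrong.comp {C : DistMon.{v₃, u₃}} {F : SigmaLax A B} {G : SigmaLax B C}
    (hF : F.IsStrong) (hG : G.IsStrong) : (F.comp G).IsStrong where
  isIso_μ X Y := by
    have := hF.isIso_μ X Y
    exact IsIso.comp_isIso' (hG.isIso_μ (F.functor.obj X) (F.functor.obj Y))
      (inferInstanceAs (IsIso (G.functor.map (F.μ X Y))))
  isIso_μ₀ := by
    have := hF.isIso_μ₀
    exact IsIso.comp_isIso' hG.isIso_μ₀ (inferInstanceAs (IsIso (G.functor.map F.μ₀)))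

end SigmaLax

/-! ### The free strict distorted monoidal category as a distorted monoidal category -/

namespace T

section Monoidal

variable {C : Type u} [Category.{v} C]

/-- Concatenation of lists is associative and right unital only propositionally, so the structure
isomorphisms are `eqToIso` rather than identities. -/
instance : MonoidalCategoryStruct (T C) where
  tensorObj := append
  tensorHom f g := tensor f g
  whiskerLeft X _ _ f := tensor (𝟙 X) f
  whiskerRight f Y := tensor f (𝟙 Y)
  tensorUnit := nil
  associator X Y Z := eqToIso (append_assoc X Y Z)
  leftUnitor X := eqToIso (nil_append X)
  rightUnitor X := eqToIso (append_nil X)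

/-- Pentagon and triangle compare composites of `eqToHom`, which agree as soon as their endpoints
do; the other axioms are relations imposed in `Rel`. -/
instance : MonoidalCategory (T C) where
  tensorHom_def f g := by
    change tensor f g = tensor f (𝟙 _) ≫ tensor (𝟙 _) g
    rw [← tensor_comp, Category.comp_id, Category.id_comp]
  id_tensorHom_id X Y := tensor_id X Y
  tensorHom_comp_tensorHom f g f' g' := (tensor_comp f f' g g').symm
  whiskerLeft_id X Y := tensor_id X Y
  id_whiskerRight X Y := tensor_id X Y
  associator_naturality f g h := by
    change tensor (tensor f g) h ≫ eqToHom (append_assoc _ _ _) =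
      eqToHom (append_assoc _ _ _) ≫ tensor f (tensor g h)
    rw [tensor_assoc]
    simp only [Category.assoc, eqToHom_trans, eqToHom_refl, Category.comp_id]
  leftUnitor_naturality f := by
    change tensor (𝟙 nil) f ≫ eqToHom (nil_append _) = eqToHom (nil_append _) ≫ f
    rw [unit_tensor' rfl, Category.assoc, Category.assoc, eqToHom_trans, eqToHom_refl,
      Category.comp_id]
  rightUnitor_naturality f := by
    change tensor f (𝟙 nil) ≫ eqToHom (append_nil _) = eqToHom (append_nil _) ≫ f
    rw [tensor_unit, Category.assoc, Category.assoc, eqToHom_trans, eqToHom_refl,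
      Category.comp_id]
  pentagon W X Y Z := by
    change tensor (eqToHom (append_assoc W X Y)) (eqToHom (Eq.refl Z)) ≫
      eqToHom (append_assoc W (append X Y) Z) ≫
        tensor (eqToHom (Eq.refl W)) (eqToHom (append_assoc X Y Z)) =
      eqToHom (append_assoc (append W X) Y Z) ≫ eqToHom (append_assoc W X (append Y Z))
    rw [tensor_eqToHom, tensor_eqToHom]
    simp only [eqToHom_trans]
  triangle X Y := by
    change eqToHom (append_assoc X nil Y) ≫
      tensor (eqToHom (Eq.refl X)) (eqToHom (nil_append Y)) =
        tensor (eqToHom (append_nil X)) (eqToHom (Eq.refl Y))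
    rw [tensor_eqToHom, tensor_eqToHom, eqToHom_trans]

variable (C) in
theorem isDistortion : IsDistortion (T C) (distNat C) swap where
  binatural f g := swap_natural f g
  σ_unit X := (swap_unit X).trans (eqToHom_trans (append_nil X) (nil_append X).symm).symm
  unit_σ X := (unit_swap X).trans (eqToHom_trans (nil_append X) (append_nil X).symm).symm
  Λ_unit := dist_unit
  hexagon_left X Y Z := hexagon_left X Y Z
  hexagon_right X Y Z := hexagon_right X Y Z
  Λ_tensor X Y := dist_tensor X Y

variable (C) in
/-- The free strict distorted monoidal category. -/
@[reducible]
def distMon : DistMon.{max u v, u} where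
  carrier := T C
  Λ := distNat C
  σ := swap
  isDistortion := isDistortion C

/-- Induction over words, with the tensor product of the monoidal category of words. -/
theorem tensor_induction {P : T C → Prop} (unit : P (𝟙_ (T C)))
    (cons : ∀ (x : C) (X : T C), P X → P (single x ⊗ X)) (X : T C) : P X :=
  word_induction unit cons X

/-- Induction over morphisms, with the structure of a distorted monoidal category. -/
theorem tensorHom_induction {P : ∀ {X Y : (distMon C).carrier}, (X ⟶ Y) → Prop}
    (id : ∀ X : (distMon C).carrier, P (𝟙 X))
    (comp : ∀ {X Y Z : (distMon C).carrier} (f : X ⟶ Y) (g : Y ⟶ Z), P f → P g → P (f ≫ g))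
    (tensor : ∀ {X X' Y Y' : (distMon C).carrier} (f : X ⟶ X') (g : Y ⟶ Y'),
      P f → P g → P (f ⊗ₘ g))
    (of : ∀ {x y : C} (f : x ⟶ y), P (X := single x) (Y := single y) (of f))
    (σ : ∀ X Y : (distMon C).carrier, P ((distMon C).σ X Y))
    (Λ : ∀ X : (distMon C).carrier, P (X := X) (Y := X) ((distMon C).Λ.app X))
    {X Y : (distMon C).carrier} (f : X ⟶ Y) : P f :=
  hom_induction (P := fun f => P f) id comp tensor of σ Λ f

end Monoidal

/-! ### Strict morphisms and the laws of the 2-monad as equalities of σ-lax functors -/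

section Strict

variable {C : Type u₁} [Category.{v₁} C] {D : Type u₂} [Category.{v₂} D]
  {E : Type u₃} [Category.{v₃} E]

/-- A strict morphism as a lax monoidal functor. -/
@[reducible]
def IsStrict.laxMonoidal {P : T C ⥤ T D} (hP : IsStrict P) : P.LaxMonoidal where
  ε := eqToHom hP.obj_nil.symm
  μ X Y := eqToHom (hP.obj_append X Y).symm
  μ_natural_left f X' := by
    change tensor (P.map f) (𝟙 _) ≫ eqToHom _ = eqToHom _ ≫ P.map (tensor f (𝟙 X'))
    simp [hP.map_tensor]
  μ_natural_right X' f := by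
    change tensor (𝟙 _) (P.map f) ≫ eqToHom _ = eqToHom _ ≫ P.map (tensor (𝟙 X') f)
    simp [hP.map_tensor]
  associativity X Y Z := by
    change tensor (eqToHom (hP.obj_append X Y).symm) (eqToHom (Eq.refl (P.obj Z))) ≫
      eqToHom (hP.obj_append (append X Y) Z).symm ≫ P.map (eqToHom (append_assoc X Y Z)) =
        eqToHom (append_assoc (P.obj X) (P.obj Y) (P.obj Z)) ≫
          tensor (eqToHom (Eq.refl (P.obj X))) (eqToHom (hP.obj_append Y Z).symm) ≫
            eqToHom (hP.obj_append X (append Y Z)).symm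
    rw [tensor_eqToHom, tensor_eqToHom, eqToHom_map]
    simp only [eqToHom_trans]
  left_unitality X := by
    change eqToHom (nil_append (P.obj X)) =
      tensor (eqToHom hP.obj_nil.symm) (eqToHom (Eq.refl (P.obj X))) ≫
        eqToHom (hP.obj_append nil X).symm ≫ P.map (eqToHom (nil_append X))
    rw [tensor_eqToHom, eqToHom_map]
    simp only [eqToHom_trans]
  right_unitality X := by
    change eqToHom (append_nil (P.obj X)) =
      tensor (eqToHom (Eq.refl (P.obj X))) (eqToHom hP.obj_nil.symm) ≫
        eqToHom (hP.obj_append X nil).symm ≫ P.map (eqToHom (append_nil X))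
    rw [tensor_eqToHom, eqToHom_map]
    simp only [eqToHom_trans]

/-- A strict morphism as a `σ`-lax monoidal functor. -/
def IsStrict.toSigmaLax {P : T C ⥤ T D} (hP : IsStrict P) : SigmaLax (distMon C) (distMon D) :=
  { functor := P
    lax := hP.laxMonoidal
    map_Λ := hP.map_dist
    map_σ := fun X Y => by
      change eqToHom (hP.obj_append X Y).symm ≫ P.map (swap X Y) =
        swap (P.obj X) (P.obj Y) ≫ eqToHom (hP.obj_append Y X).symm
      simp [hP.map_swap] }

theorem IsStrict.toSigmaLax_isStrong {P : T C ⥤ T D} (hP : IsStrict P) :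
    hP.toSigmaLax.IsStrong where
  isIso_μ X Y := inferInstanceAs (IsIso (eqToHom (hP.obj_append X Y).symm))
  isIso_μ₀ := inferInstanceAs (IsIso (eqToHom hP.obj_nil.symm))

/-- Strictness is a property and the laxators it induces are `eqToHom`, so an equality of functors
upgrades to one of σ-lax functors. This is how each 2-monad law below is lifted. -/
theorem IsStrict.toSigmaLax_congr {P Q : T C ⥤ T D} (hP : IsStrict P) (hQ : IsStrict Q)
    (h : P = Q) : hP.toSigmaLax = hQ.toSigmaLax := by
  subst h; rfl

theorem IsStrict.toSigmaLax_comp {P : T C ⥤ T D} (hP : IsStrict P) {Q : T D ⥤ T E}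
    (hQ : IsStrict Q) :
    SigmaLax.comp hP.toSigmaLax hQ.toSigmaLax = (hP.comp hQ).toSigmaLax := by
  refine SigmaLax.ext_of_app rfl ?_ fun X Y => ?_
  · change eqToHom hQ.obj_nil.symm ≫ Q.map (eqToHom hP.obj_nil.symm) =
      eqToHom (hP.comp hQ).obj_nil.symm ≫ 𝟙 _
    rw [eqToHom_map, eqToHom_trans, Category.comp_id]
  · change eqToHom (hQ.obj_append (P.obj X) (P.obj Y)).symm ≫
        Q.map (eqToHom (hP.obj_append X Y).symm) =
      𝟙 _ ≫ eqToHom ((hP.comp hQ).obj_append X Y).symm ≫ 𝟙 _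
    rw [eqToHom_map, eqToHom_trans, Category.comp_id, Category.id_comp]

theorem IsStrict.toSigmaLax_id : (IsStrict.id (C := C)).toSigmaLax = SigmaLax.id (distMon C) := by
  refine SigmaLax.ext_of_app rfl ?_ fun X Y => ?_
  · exact (Category.comp_id _).symm
  · exact ((Category.id_comp _).trans (Category.id_comp _)).symm

/-- The action of the 2-monad on a functor, as a `σ`-lax monoidal functor. -/
def mapLax (F : C ⥤ D) : SigmaLax (distMon C) (distMon D) := (map_isStrict F).toSigmaLax

variable (C) in
/-- The multiplication of the 2-monad, as a `σ`-lax monoidal functor. -/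
def multLax : SigmaLax (distMon (T C)) (distMon C) := (mult_isStrict (C := C)).toSigmaLax

/-- This and the next equalities provide the `eqToHom` transformations that make both sides of a
coherence law composable as monoidal transformations. -/
theorem mapLax_comp (F : C ⥤ D) (G : D ⥤ E) :
    mapLax (F ⋙ G) = SigmaLax.comp (mapLax F) (mapLax G) := by
  refine Eq.trans ?_ (IsStrict.toSigmaLax_comp (map_isStrict F) (map_isStrict G)).symm
  exact IsStrict.toSigmaLax_congr _ _ (map_comp F G)

theorem mapLax_mult (F : C ⥤ D) :
    SigmaLax.comp (mapLax (map F)) (multLax D) = SigmaLax.comp (multLax C) (mapLax F) := by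
  refine (IsStrict.toSigmaLax_comp (map_isStrict (map F)) mult_isStrict).trans ?_
  refine Eq.trans ?_ (IsStrict.toSigmaLax_comp mult_isStrict (map_isStrict F)).symm
  exact IsStrict.toSigmaLax_congr _ _ (mult_naturality F)

variable (C) in
theorem multLax_mult :
    SigmaLax.comp (mapLax (mult C)) (multLax C) = SigmaLax.comp (multLax (T C)) (multLax C) := by
  refine (IsStrict.toSigmaLax_comp (map_isStrict (mult C)) mult_isStrict).trans ?_
  refine Eq.trans ?_ (IsStrict.toSigmaLax_comp mult_isStrict mult_isStrict).symm
  exact IsStrict.toSigmaLax_congr _ _ mult_mult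

variable (C) in
theorem mapLax_unit_mult :
    SigmaLax.comp (mapLax (unit C)) (multLax C) = SigmaLax.id (distMon C) := by
  refine (IsStrict.toSigmaLax_comp (map_isStrict (unit C)) mult_isStrict).trans ?_
  refine Eq.trans ?_ IsStrict.toSigmaLax_id
  exact IsStrict.toSigmaLax_congr _ _ map_unit_mult

variable (C) in
theorem mapLax_id : mapLax (𝟭 C) = SigmaLax.id (distMon C) := by
  refine Eq.trans ?_ IsStrict.toSigmaLax_id
  exact IsStrict.toSigmaLax_congr _ _ map_id

/-- The action of the 2-monad on a natural transformation, as a monoidal transformation. -/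
def map₂Lax {F G : C ⥤ D} (θ : F ⟶ G) : mapLax F ⟶ mapLax G :=
  SigmaLax.homMk (map₂ θ) (Category.comp_id _) fun X Y => by
    change eqToHom ((map_isStrict F).obj_append X Y).symm ≫ (map₂ θ).app (append X Y) =
      tensor ((map₂ θ).app X) ((map₂ θ).app Y) ≫ eqToHom ((map_isStrict G).obj_append X Y).symm
    rw [map₂_append]
    simp

end Strict

end T

/-! ### Transformations between functors on a free strict distorted monoidal category -/

namespace SigmaLax

section Extension

variable {C : Type u₁} [Category.{v₁} C] {D : DistMon.{v₂, u₂}}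
  {P Q : SigmaLax (T.distMon C) D}

/-- Monoidal transformations out of a strong functor on a free distorted monoidal category are
determined by their components at one-letter words. -/
theorem hom_ext_single (hP : P.IsStrong) {θ φ : P ⟶ Q}
    (h : ∀ x : C, θ.nat.app (T.single x) = φ.nat.app (T.single x)) : θ = φ := by
  refine hom_ext (NatTrans.ext (funext fun X => ?_))
  induction X using T.tensor_induction with
  | unit =>
    -- Unitality of both transformations fixes their value after the invertible unit laxator of `P`.
    have := hP.isIso_μ₀
    exact (cancel_epi P.μ₀).1 ((hom_unit θ).trans (hom_unit φ).symm)
  | cons x X ih =>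
    have := hP.isIso_μ (T.single x) X
    refine (cancel_epi (P.μ (T.single x) X)).1 ?_
    refine (hom_tensor θ (T.single x) X).trans (Eq.trans ?_ (hom_tensor φ (T.single x) X).symm)
    rw [h, ih]

variable (P Q) in
/-- The extension of a family of morphisms at one-letter words to all words, by recursion on the
underlying lists. -/
noncomputable def extendList (hP : P.IsStrong)
    (t : ∀ x : C, P.functor.obj (T.single x) ⟶ Q.functor.obj (T.single x)) :
    (X : List C) → (P.functor.obj (show T C from X) ⟶ Q.functor.obj (show T C from X))
  | [] => inv P.μ₀ (I := hP.isIso_μ₀) ≫ Q.μ₀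
  | x :: X =>
    inv (P.μ (T.single x) X) (I := hP.isIso_μ (T.single x) X) ≫
      (t x ⊗ₘ extendList hP t X) ≫ Q.μ (T.single x) X

variable (P Q) in
/-- The extension of a family of morphisms at one-letter words to all words. -/
noncomputable def extendApp (hP : P.IsStrong)
    (t : ∀ x : C, P.functor.obj (T.single x) ⟶ Q.functor.obj (T.single x)) (X : T C) :
    P.functor.obj X ⟶ Q.functor.obj X :=
  extendList P Q hP t X

variable (hP : P.IsStrong) (t : ∀ x : C, P.functor.obj (T.single x) ⟶ Q.functor.obj (T.single x))

theorem extendApp_nil : P.μ₀ ≫ extendApp P Q hP t (𝟙_ (T C)) = Q.μ₀ := by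
  have := hP.isIso_μ₀
  exact IsIso.hom_inv_id_assoc P.μ₀ Q.μ₀

theorem extendApp_cons (x : C) (X : T C) :
    P.μ (T.single x) X ≫ extendApp P Q hP t (T.single x ⊗ X) =
      (t x ⊗ₘ extendApp P Q hP t X) ≫ Q.μ (T.single x) X := by
  have := hP.isIso_μ (T.single x) X
  exact IsIso.hom_inv_id_assoc (P.μ (T.single x) X) _

/-- The only instance of naturality available before the extension is known to be monoidal; it
suffices for the associators and unitors of words, which are of this form. -/
theorem extendApp_eqToHom {X Y : T C} (h : X = Y) :
    extendApp P Q hP t X ≫ Q.functor.map (eqToHom h) =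
      P.functor.map (eqToHom h) ≫ extendApp P Q hP t Y := by
  subst h; simp

/-- By construction the extension is compatible with laxators only when the first word is a letter.
Induction on the first word gives the general case: the empty word uses left unitality of `P` and
`Q`, and a further letter uses their associativity. -/
theorem extendApp_append (X Y : T C) :
    P.μ X Y ≫ extendApp P Q hP t (X ⊗ Y) =
      (extendApp P Q hP t X ⊗ₘ extendApp P Q hP t Y) ≫ Q.μ X Y := by
  induction X using T.tensor_induction with
  | unit =>
    have := hP.isIso_μ₀
    -- Precomposing with the unit laxator and postcomposing with the image of the unitor, both
    -- invertible, brings each side into the shape of the left unitality law.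
    rw [← cancel_epi (P.μ₀ ⊗ₘ 𝟙 (P.functor.obj Y)),
      ← cancel_mono (Q.functor.map (λ_ (Y : (T.distMon C).carrier)).hom)]
    have h : extendApp P Q hP t (𝟙_ (T C) ⊗ Y) ≫ Q.functor.map (λ_ Y).hom =
      P.functor.map (λ_ Y).hom ≫ extendApp P Q hP t Y := extendApp_eqToHom hP t (T.nil_append Y)
    simp only [Category.assoc, h, tensorHom_comp_tensorHom_assoc, extendApp_nil]
    have h₁ := P.μ_leftUnit Y
    have h₂ := Q.μ_leftUnit Y
    rw [reassoc_of% h₁, Category.id_comp,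
      show Q.μ₀ ⊗ₘ extendApp P Q hP t Y = (𝟙 _ ⊗ₘ extendApp P Q hP t Y) ≫ (Q.μ₀ ⊗ₘ 𝟙 _) by
        rw [tensorHom_comp_tensorHom, Category.id_comp, Category.comp_id],
      Category.assoc, h₂]
    simp
  | cons x X ih =>
    have := hP.isIso_μ (T.single x) X
    rw [← cancel_epi (P.μ (T.single x) X ⊗ₘ 𝟙 (P.functor.obj Y)),
      ← cancel_mono (Q.functor.map (α_ (T.single x) X Y).hom)]
    have h : extendApp P Q hP t ((T.single x ⊗ X) ⊗ Y) ≫ Q.functor.map (α_ (T.single x) X Y).hom =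
      P.functor.map (α_ (T.single x) X Y).hom ≫ extendApp P Q hP t (T.single x ⊗ X ⊗ Y) :=
        extendApp_eqToHom hP t (T.append_assoc (T.single x) X Y)
    have h₁ := P.μ_assoc (T.single x) X Y
    have h₂ := Q.μ_assoc (T.single x) X Y
    simp only [Category.assoc, h, tensorHom_comp_tensorHom_assoc, extendApp_cons]
    rw [reassoc_of% h₁, extendApp_cons, Category.id_comp, tensorHom_comp_tensorHom_assoc, ih,
      Category.id_comp]
    rw [show ((t x ⊗ₘ extendApp P Q hP t X) ≫ Q.μ (T.single x) X) ⊗ₘ extendApp P Q hP t Y =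
      ((t x ⊗ₘ extendApp P Q hP t X) ⊗ₘ extendApp P Q hP t Y) ≫ (Q.μ (T.single x) X ⊗ₘ 𝟙 _) by
        rw [tensorHom_comp_tensorHom, Category.comp_id],
      Category.assoc, h₂, associator_naturality_assoc, tensorHom_comp_tensorHom_assoc]
    simp

/-- The recursion treats `[x]` as `x` followed by the empty word, so its value is `t x` tensored
with a unit component; right unitality of `P` and `Q` removes that factor. -/
theorem extendApp_single (x : C) : extendApp P Q hP t (T.single x) = t x := by
  have := hP.isIso_μ₀
  rw [← cancel_epi (ρ_ (P.functor.obj (T.single x))).hom, ← P.μ_rightUnit]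
  have h : extendApp P Q hP t (T.single x ⊗ 𝟙_ (T C)) ≫ Q.functor.map (ρ_ (T.single x)).hom =
    P.functor.map (ρ_ (T.single x)).hom ≫ extendApp P Q hP t (T.single x) :=
      extendApp_eqToHom hP t (T.append_nil (T.single x))
  have h₂ := Q.μ_rightUnit (T.single x)
  rw [Category.assoc, Category.assoc, ← h, reassoc_of% (extendApp_cons (Q := Q) hP t x (𝟙_ (T C))),
    tensorHom_comp_tensorHom_assoc, extendApp_nil, P.μ_rightUnit, Category.id_comp,
    show t x ⊗ₘ Q.μ₀ = (t x ⊗ₘ 𝟙 _) ≫ (𝟙 _ ⊗ₘ Q.μ₀) by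
        rw [tensorHom_comp_tensorHom, Category.id_comp, Category.comp_id], Category.assoc, h₂]
  simp

variable (ht : ∀ {x y : C} (f : x ⟶ y),
  P.functor.map (T.of f) ≫ t y = t x ≫ Q.functor.map (T.of f))

-- Naturality is checked on generating morphisms. Tensor products reduce to compatibility with
-- laxators, letters are the hypothesis `ht`, swaps follow because `P` and `Q` respect σ and σ is
-- binatural in `D`, and unit distortions follow from naturality of Λ in `D`.
include ht in
theorem extendApp_naturality {X Y : (T.distMon C).carrier} (f : X ⟶ Y) :
    P.functor.map f ≫ extendApp P Q hP t Y = extendApp P Q hP t X ≫ Q.functor.map f := by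
  induction f using T.tensorHom_induction with
  | id X => simp
  | comp f g hf hg => simp only [Functor.map_comp, Category.assoc, hg, reassoc_of% hf]
  | @tensor X X' Y Y' f g hf hg =>
    have := hP.isIso_μ X Y
    rw [← cancel_epi (P.μ X Y), reassoc_of% (extendApp_append (Q := Q) hP t X Y),
      ← μ_naturality, ← Category.assoc, ← μ_naturality, Category.assoc, extendApp_append,
      tensorHom_comp_tensorHom_assoc, tensorHom_comp_tensorHom_assoc, hf, hg]
  | of f => rw [extendApp_single, extendApp_single, ht]
  | σ X Y =>
    have := hP.isIso_μ X Y
    have h₁ := P.map_σ X Y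
    have h₂ := Q.map_σ X Y
    change P.μ X Y ≫ _ = _ ≫ P.μ Y X at h₁
    change Q.μ X Y ≫ _ = _ ≫ Q.μ Y X at h₂
    rw [← cancel_epi (P.μ X Y), reassoc_of% (extendApp_append (Q := Q) hP t X Y),
      reassoc_of% h₁, h₂, extendApp_append, ← Category.assoc, D.isDistortion.binatural,
      Category.assoc]
  | Λ X =>
    rw [P.map_Λ, Q.map_Λ]
    exact (D.Λ.naturality _).symm

/-- The monoidal transformation with given natural components at one-letter words. -/
noncomputable def extend : P ⟶ Q :=
  homMk { app := extendApp P Q hP t, naturality := fun _ _ f => extendApp_naturality hP t ht f }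
    (extendApp_nil hP t) (extendApp_append hP t)

theorem extend_single (x : C) : (extend hP t ht).nat.app (T.single x) = t x :=
  extendApp_single hP t x

/-- The monoidal isomorphism with given natural components at one-letter words. -/
noncomputable def extendIso (hP : P.IsStrong) (hQ : Q.IsStrong)
    (e : ∀ x : C, P.functor.obj (T.single x) ≅ Q.functor.obj (T.single x))
    (he : ∀ {x y : C} (f : x ⟶ y),
      P.functor.map (T.of f) ≫ (e y).hom = (e x).hom ≫ Q.functor.map (T.of f)) : P ≅ Q where
  hom := extend hP (fun x => (e x).hom) he
  inv := extend hQ (fun x => (e x).inv) fun f => by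
    rw [Iso.comp_inv_eq, Category.assoc, he, Iso.inv_hom_id_assoc]
  hom_inv_id := hom_ext_single hP fun x => by
    rw [comp_nat, NatTrans.comp_app, extend_single, extend_single]
    exact (e x).hom_inv_id
  inv_hom_id := hom_ext_single hQ fun x => by
    rw [comp_nat, NatTrans.comp_app, extend_single, extend_single]
    exact (e x).inv_hom_id

theorem extendIso_hom_single (hP : P.IsStrong) (hQ : Q.IsStrong)
    (e : ∀ x : C, P.functor.obj (T.single x) ≅ Q.functor.obj (T.single x))
    (he : ∀ {x y : C} (f : x ⟶ y),
      P.functor.map (T.of f) ≫ (e y).hom = (e x).hom ≫ Q.functor.map (T.of f)) (x : C) :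
    (extendIso hP hQ e he).hom.nat.app (T.single x) = (e x).hom :=
  extend_single hP _ he x

end Extension

end SigmaLax

/-! ### The tensor products of words in a distorted monoidal category -/

namespace DistMon

variable (D : DistMon.{v, u})

/-- The right-nested tensor product of a list of objects. -/
def listObj : List D.carrier → D.carrier
  | [] => 𝟙_ D.carrier
  | x :: X => x ⊗ listObj X

/-- The right-nested tensor product of a word. -/
def wordObj (X : T D.carrier) : D.carrier := D.listObj X

/-- The comparison between the tensor product of two lists and that of their concatenation. -/
def listTensor : ∀ X Y : List D.carrier,
    D.wordObj X ⊗ D.wordObj Y ≅ D.wordObj (T.append (show T D.carrier from X) Y)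
  | [], Y => λ_ (D.wordObj Y)
  | x :: X, Y => α_ x (D.wordObj X) (D.wordObj Y) ≪≫ whiskerLeftIso x (listTensor X Y)

/-- The comparison between the tensor product of two words and that of their concatenation. -/
def wordTensor (X Y : T D.carrier) :
    D.wordObj X ⊗ D.wordObj Y ≅ D.wordObj (T.append X Y) :=
  D.listTensor X Y

/-- The morphism induced by an equality of words. -/
def wordEq {X Y : T D.carrier} (h : X = Y) : D.wordObj X ⟶ D.wordObj Y :=
  eqToHom (congrArg D.wordObj h)

theorem wordEq_trans {X Y Z : T D.carrier} (h : X = Y) (h' : Y = Z) :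
    D.wordEq h ≫ D.wordEq h' = D.wordEq (h.trans h') := eqToHom_trans _ _

theorem wordEq_symm' {X Y : T D.carrier} (h : X = Y) : D.wordEq h.symm ≫ D.wordEq h = 𝟙 _ :=
  eqToHom_trans _ _

instance {X Y : T D.carrier} (h : X = Y) : IsIso (D.wordEq h) :=
  inferInstanceAs (IsIso (eqToHom _))

theorem wordEq_cons (x : D.carrier) {X Y : T D.carrier} (h : X = Y) :
    D.wordEq (congrArg (T.append (T.single x)) h) = x ◁ D.wordEq h := by
  subst h
  exact (whiskerLeft_id x (D.wordObj X)).symm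

/-- Induction on `X`: the empty word gives the formula for the left unitor of a tensor product, and
adding a letter costs one pentagon. -/
theorem wordTensor_assoc (X Y Z : T D.carrier) :
    ((D.wordTensor X Y).hom ⊗ₘ 𝟙 (D.wordObj Z)) ≫ (D.wordTensor (T.append X Y) Z).hom ≫
        D.wordEq (T.append_assoc X Y Z) =
      (α_ _ _ _).hom ≫ (𝟙 (D.wordObj X) ⊗ₘ (D.wordTensor Y Z).hom) ≫
        (D.wordTensor X (T.append Y Z)).hom := by
  rw [tensorHom_id, id_tensorHom]
  induction X using T.word_induction with
  | nil =>
    change (λ_ (D.wordObj Y)).hom ▷ D.wordObj Z ≫ (D.wordTensor Y Z).hom ≫ 𝟙 _ =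
      (α_ (𝟙_ D.carrier) _ _).hom ≫ (𝟙_ D.carrier) ◁ (D.wordTensor Y Z).hom ≫ (λ_ _).hom
    rw [leftUnitor_naturality, leftUnitor_tensor_hom]
    simp
  | cons x X ih =>
    have h : D.wordEq (T.append_assoc (T.append (T.single x) X) Y Z) =
      x ◁ D.wordEq (T.append_assoc X Y Z) := D.wordEq_cons x _
    rw [h]
    change ((α_ x (D.wordObj X) (D.wordObj Y)).hom ≫ x ◁ (D.wordTensor X Y).hom) ▷ D.wordObj Z ≫
        ((α_ x (D.wordObj (T.append X Y)) (D.wordObj Z)).hom ≫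
          x ◁ (D.wordTensor (T.append X Y) Z).hom) ≫ x ◁ D.wordEq (T.append_assoc X Y Z) =
      (α_ (x ⊗ D.wordObj X) _ _).hom ≫ (x ⊗ D.wordObj X) ◁ (D.wordTensor Y Z).hom ≫
        (α_ x (D.wordObj X) (D.wordObj (T.append Y Z))).hom ≫
          x ◁ (D.wordTensor X (T.append Y Z)).hom
    rw [comp_whiskerRight, Category.assoc, Category.assoc, associator_naturality_middle_assoc,
      ← whiskerLeft_comp, ← whiskerLeft_comp, ih]
    simp

theorem wordTensor_assoc_inv (X Y Z : T D.carrier) :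
    (𝟙 (D.wordObj X) ⊗ₘ (D.wordTensor Y Z).hom) ≫ (D.wordTensor X (T.append Y Z)).hom ≫
        D.wordEq (T.append_assoc X Y Z).symm =
      (α_ _ _ _).inv ≫ ((D.wordTensor X Y).hom ⊗ₘ 𝟙 (D.wordObj Z)) ≫
        (D.wordTensor (T.append X Y) Z).hom := by
  rw [Iso.eq_inv_comp, ← cancel_mono (D.wordEq (T.append_assoc X Y Z))]
  simp only [Category.assoc, wordEq_symm', Category.comp_id, wordTensor_assoc]

theorem wordTensor_nil_left (X : T D.carrier) : (D.wordTensor T.nil X).hom = (λ_ _).hom := rfl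

/-- Induction on `X`: the two unitors agree at the unit object, and the right unitor of a tensor
product is computed on its second factor. -/
theorem wordTensor_nil_right (X : T D.carrier) :
    (D.wordTensor X T.nil).hom ≫ D.wordEq (T.append_nil X) = (ρ_ _).hom := by
  induction X using T.word_induction with
  | nil =>
    exact (Category.comp_id _).trans unitors_equal
  | cons x X ih =>
    have h : D.wordEq (T.append_nil (T.append (T.single x) X)) =
      x ◁ D.wordEq (T.append_nil X) := D.wordEq_cons x _
    rw [h]
    change ((α_ x (D.wordObj X) (𝟙_ D.carrier)).hom ≫ x ◁ (D.wordTensor X T.nil).hom) ≫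
      x ◁ D.wordEq (T.append_nil X) = (ρ_ (x ⊗ D.wordObj X)).hom
    refine (Category.assoc _ _ _).trans ((congrArg (fun k => (α_ x _ _).hom ≫ k)
      ((whiskerLeft_comp _ _ _).symm.trans (congrArg (fun k => x ◁ k) ih))).trans ?_)
    exact (rightUnitor_tensor_hom x (D.wordObj X)).symm

/-- The interpretation of expressions in a distorted monoidal category. -/
def wordHom : {X Y : T D.carrier} → Term D.carrier X Y → (D.wordObj X ⟶ D.wordObj Y)
  | _, _, .id X => 𝟙 (D.wordObj X)
  | _, _, .comp f g => wordHom f ≫ wordHom g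
  | _, _, .tensor f g =>
      (D.wordTensor _ _).inv ≫ (wordHom f ⊗ₘ wordHom g) ≫ (D.wordTensor _ _).hom
  | _, _, .of f => f ⊗ₘ 𝟙 (𝟙_ D.carrier)
  | _, _, .swap X Y => (D.wordTensor X Y).inv ≫ D.σ _ _ ≫ (D.wordTensor Y X).hom
  | _, _, .dist X => D.Λ.app (D.wordObj X)

theorem wordHom_ofEq {X Y : T D.carrier} (h : X = Y) :
    D.wordHom (Term.ofEq h) = D.wordEq h := by
  subst h; rfl

theorem wordHom_comp {X Y Z : T D.carrier} (f : Term D.carrier X Y) (g : Term D.carrier Y Z) :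
    D.wordHom (f.comp g) = D.wordHom f ≫ D.wordHom g := rfl

theorem wordHom_id (X : T D.carrier) : D.wordHom (Term.id X) = 𝟙 _ := rfl

theorem wordTensor_wordHom {X X' Y Y' : T D.carrier} (f : Term D.carrier X X')
    (g : Term D.carrier Y Y') :
    (D.wordTensor X Y).hom ≫ D.wordHom (f.tensor g) =
      (D.wordHom f ⊗ₘ D.wordHom g) ≫ (D.wordTensor X' Y').hom :=
  Iso.hom_inv_id_assoc _ _

theorem wordTensor_wordHom_swap (X Y : T D.carrier) :
    (D.wordTensor X Y).hom ≫ D.wordHom (Term.swap X Y) =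
      D.σ _ _ ≫ (D.wordTensor Y X).hom :=
  Iso.hom_inv_id_assoc _ _

/-- After the comparison isomorphisms are cancelled on the left, binaturality slides σ past them and
the hexagon of `D` applies. The comparisons are then reassembled by `wordTensor_assoc` and its
inverse form, once at each associator. -/
theorem wordHom_hexagon_left (X Y Z : T D.carrier) :
    D.wordHom (Term.swap (T.append X Y) Z) =
      D.wordEq (T.append_assoc X Y Z) ≫ D.wordHom ((Term.id X).tensor (Term.swap Y Z)) ≫
        D.wordEq (T.append_assoc X Z Y).symm ≫
          D.wordHom ((Term.swap X Z).tensor (Term.id Y)) ≫ D.wordEq (T.append_assoc Z X Y) := by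
  rw [← cancel_epi (D.wordTensor (T.append X Y) Z).hom, wordTensor_wordHom_swap,
    ← cancel_epi ((D.wordTensor X Y).hom ⊗ₘ 𝟙 (D.wordObj Z)), ← Category.assoc,
    ← D.isDistortion.binatural, D.isDistortion.hexagon_left]
  rw [reassoc_of% D.wordTensor_assoc X Y Z,
    reassoc_of% D.wordTensor_wordHom (Term.id X) (Term.swap Y Z)]
  rw [tensorHom_comp_tensorHom_assoc, wordTensor_wordHom_swap, wordHom_id, Category.comp_id,
    show 𝟙 (D.wordObj X) ⊗ₘ D.σ (D.wordObj Y) (D.wordObj Z) ≫ (D.wordTensor Z Y).hom =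
      (𝟙 _ ⊗ₘ D.σ _ _) ≫ (𝟙 _ ⊗ₘ (D.wordTensor Z Y).hom) by
        rw [tensorHom_comp_tensorHom, Category.id_comp]]
  simp only [Category.assoc]
  rw [reassoc_of% D.wordTensor_assoc_inv X Z Y,
    reassoc_of% D.wordTensor_wordHom (Term.swap X Z) (Term.id Y),
    tensorHom_comp_tensorHom_assoc, wordTensor_wordHom_swap, wordHom_id, Category.comp_id,
    show D.σ (D.wordObj X) (D.wordObj Z) ≫ (D.wordTensor Z X).hom ⊗ₘ 𝟙 (D.wordObj Y) =
      (D.σ _ _ ⊗ₘ 𝟙 _) ≫ ((D.wordTensor Z X).hom ⊗ₘ 𝟙 _) by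
        rw [tensorHom_comp_tensorHom, Category.id_comp]]
  simp only [Category.assoc]
  rw [D.wordTensor_assoc Z X Y]

theorem wordHom_hexagon_right (X Y Z : T D.carrier) :
    D.wordHom (Term.swap X (T.append Y Z)) =
      D.wordEq (T.append_assoc X Y Z).symm ≫ D.wordHom ((Term.swap X Y).tensor (Term.id Z)) ≫
        D.wordEq (T.append_assoc Y X Z) ≫
          D.wordHom ((Term.id Y).tensor (Term.swap X Z)) ≫
            D.wordEq (T.append_assoc Y Z X).symm := by
  rw [← cancel_epi (D.wordTensor X (T.append Y Z)).hom, wordTensor_wordHom_swap,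
    ← cancel_epi (𝟙 (D.wordObj X) ⊗ₘ (D.wordTensor Y Z).hom), ← Category.assoc,
    ← D.isDistortion.binatural, D.isDistortion.hexagon_right]
  rw [reassoc_of% D.wordTensor_assoc_inv X Y Z,
    reassoc_of% D.wordTensor_wordHom (Term.swap X Y) (Term.id Z)]
  rw [tensorHom_comp_tensorHom_assoc, wordTensor_wordHom_swap, wordHom_id, Category.comp_id,
    show D.σ (D.wordObj X) (D.wordObj Y) ≫ (D.wordTensor Y X).hom ⊗ₘ 𝟙 (D.wordObj Z) =
      (D.σ _ _ ⊗ₘ 𝟙 _) ≫ ((D.wordTensor Y X).hom ⊗ₘ 𝟙 _) by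
        rw [tensorHom_comp_tensorHom, Category.id_comp]]
  simp only [Category.assoc]
  rw [reassoc_of% D.wordTensor_assoc Y X Z,
    reassoc_of% D.wordTensor_wordHom (Term.id Y) (Term.swap X Z),
    tensorHom_comp_tensorHom_assoc, wordTensor_wordHom_swap, wordHom_id, Category.comp_id,
    show 𝟙 (D.wordObj Y) ⊗ₘ D.σ (D.wordObj X) (D.wordObj Z) ≫ (D.wordTensor Z X).hom =
      (𝟙 _ ⊗ₘ D.σ _ _) ≫ (𝟙 _ ⊗ₘ (D.wordTensor Z X).hom) by
        rw [tensorHom_comp_tensorHom, Category.id_comp]]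
  simp only [Category.assoc]
  rw [D.wordTensor_assoc_inv Y Z X]

/-- Soundness of the interpretation, which lets it descend to the free object. Strict associativity
and unitality become the compatibilities of `wordTensor` with associators and unitors; each
distortion relation becomes the corresponding axiom of `D`. -/
theorem wordHom_rel {X Y : T D.carrier} {f g : Term D.carrier X Y} (h : Rel D.carrier f g) :
    D.wordHom f = D.wordHom g := by
  induction h with
  | comp_left g h ih => simp only [wordHom, ih]
  | comp_right g h ih => simp only [wordHom, ih]
  | tensor_left g h ih => simp only [wordHom, ih]
  | tensor_right g h ih => simp only [wordHom, ih]
  | id_comp f => simp [wordHom]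
  | comp_id f => simp [wordHom]
  | assoc f g h => simp [wordHom]
  | tensor_id X Y => simp [wordHom]
  | tensor_comp f f' g g' =>
    simp only [wordHom, Category.assoc, Iso.hom_inv_id_assoc, tensorHom_comp_tensorHom_assoc]
  | @unit_tensor X Y f =>
    rw [wordHom_comp, wordHom_comp, wordHom_ofEq, wordHom_ofEq,
      ← cancel_epi (D.wordTensor T.nil X).hom, reassoc_of% D.wordTensor_wordHom (Term.id T.nil) f,
      wordTensor_nil_left, wordTensor_nil_left, wordHom_id, id_tensorHom]
    refine (leftUnitor_naturality_assoc _ _).trans ?_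
    exact congrArg (fun k => (λ_ (D.wordObj X)).hom ≫ k)
      ((Category.comp_id _).trans (Category.id_comp _).symm)
  | @tensor_unit X Y f =>
    rw [wordHom_comp, wordHom_comp, wordHom_ofEq, wordHom_ofEq,
      ← cancel_epi (D.wordTensor X T.nil).hom, reassoc_of% D.wordTensor_wordHom f (Term.id T.nil),
      wordTensor_nil_right, reassoc_of% D.wordTensor_nil_right X, wordHom_id, tensorHom_id]
    exact rightUnitor_naturality _
  | @tensor_assoc X X' Y Y' Z Z' f g h =>
    rw [wordHom_comp, wordHom_comp, wordHom_ofEq, wordHom_ofEq,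
      ← cancel_epi (D.wordTensor (T.append X Y) Z).hom,
      ← cancel_epi ((D.wordTensor X Y).hom ⊗ₘ 𝟙 (D.wordObj Z)),
      reassoc_of% D.wordTensor_wordHom (f.tensor g) h, reassoc_of% D.wordTensor_assoc X Y Z,
      tensorHom_comp_tensorHom_assoc, D.wordTensor_wordHom f g, Category.id_comp,
      show (D.wordHom f ⊗ₘ D.wordHom g) ≫ (D.wordTensor X' Y').hom ⊗ₘ D.wordHom h =
        ((D.wordHom f ⊗ₘ D.wordHom g) ⊗ₘ D.wordHom h) ≫ ((D.wordTensor X' Y').hom ⊗ₘ 𝟙 _) by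
          rw [tensorHom_comp_tensorHom, Category.comp_id],
      Category.assoc, D.wordTensor_assoc, associator_naturality_assoc,
      D.wordTensor_wordHom f (g.tensor h), tensorHom_comp_tensorHom_assoc,
      tensorHom_comp_tensorHom_assoc, D.wordTensor_wordHom g h, Category.comp_id,
      Category.id_comp]
  | of_id x => exact id_tensorHom_id _ _
  | of_comp f g =>
    exact (congrArg (fun k => (f ≫ g) ⊗ₘ k) (Category.comp_id (𝟙 (𝟙_ D.carrier))).symm).trans
      (tensorHom_comp_tensorHom _ _ _ _).symm
  | dist_natural f => exact D.Λ.naturality _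
  | @swap_natural X X' Y Y' f g =>
    rw [wordHom_comp, wordHom_comp, ← cancel_epi (D.wordTensor X Y).hom,
      reassoc_of% D.wordTensor_wordHom_swap X Y, reassoc_of% D.wordTensor_wordHom f g,
      wordTensor_wordHom, wordTensor_wordHom_swap, ← Category.assoc, D.isDistortion.binatural,
      Category.assoc]
  | swap_unit X =>
    rw [wordHom_ofEq, ← cancel_epi (D.wordTensor X T.nil).hom, wordTensor_wordHom_swap,
      ← D.wordEq_trans (T.append_nil X) (T.nil_append X).symm,
      reassoc_of% D.wordTensor_nil_right X]
    exact (congrArg (fun k => k ≫ _) (D.isDistortion.σ_unit (D.wordObj X))).trans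
      ((Category.assoc _ _ _).trans (congrArg (fun k => _ ≫ k) (Iso.inv_hom_id _)))
  | unit_swap X =>
    rw [wordHom_ofEq, ← cancel_epi (D.wordTensor T.nil X).hom, wordTensor_wordHom_swap,
      ← cancel_mono (D.wordEq (T.append_nil X)), Category.assoc, wordTensor_nil_right]
    refine (congrArg (fun k => k ≫ _) (D.isDistortion.unit_σ (D.wordObj X))).trans ?_
    rw [Category.assoc, Category.assoc, wordEq_trans]
    exact congrArg (fun k => _ ≫ k) (Iso.inv_hom_id _)
  | dist_unit => exact D.isDistortion.Λ_unit
  | hexagon_left X Y Z =>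
    simp only [wordHom_comp, wordHom_ofEq]
    exact D.wordHom_hexagon_left X Y Z
  | hexagon_right X Y Z =>
    simp only [wordHom_comp, wordHom_ofEq]
    exact D.wordHom_hexagon_right X Y Z
  | dist_tensor X Y =>
    rw [← cancel_epi (D.wordTensor X Y).hom, wordTensor_wordHom]
    exact (D.Λ.naturality _).trans
      (congrArg (fun k => k ≫ (D.wordTensor X Y).hom) (D.isDistortion.Λ_tensor _ _))

/-- The functor sending a word to its tensor product. -/
def evalFunctor : T D.carrier ⥤ D.carrier where
  obj := D.wordObj
  map f := Quot.lift D.wordHom (fun _ _ h => D.wordHom_rel h) f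
  map_id _ := rfl
  map_comp f g := Quot.inductionOn f fun _ => Quot.inductionOn g fun _ => rfl

theorem evalFunctor_map_eqToHom {X Y : T D.carrier} (h : X = Y) :
    D.evalFunctor.map (eqToHom h) = D.wordEq h :=
  eqToHom_map _ _

theorem wordTensor_naturality {X X' Y Y' : T D.carrier} (f : X ⟶ X') (g : Y ⟶ Y') :
    (D.evalFunctor.map f ⊗ₘ D.evalFunctor.map g) ≫ (D.wordTensor X' Y').hom =
      (D.wordTensor X Y).hom ≫ D.evalFunctor.map (T.tensor f g) :=
  Quot.inductionOn f fun f => Quot.inductionOn g fun g => (D.wordTensor_wordHom f g).symm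

/-- The lax monoidal structure on the functor sending a word to its tensor product. -/
@[reducible]
def evalLaxMonoidal : D.evalFunctor.LaxMonoidal where
  ε := 𝟙 (𝟙_ D.carrier)
  μ X Y := (D.wordTensor X Y).hom
  μ_natural_left {X Y} f Z := by
    rw [← tensorHom_id, ← D.evalFunctor.map_id]
    exact D.wordTensor_naturality f (𝟙 Z)
  μ_natural_right {X Y} Z f := by
    rw [← id_tensorHom, ← D.evalFunctor.map_id]
    exact D.wordTensor_naturality (𝟙 Z) f
  associativity X Y Z := by
    have h := D.wordTensor_assoc X Y Z
    rw [tensorHom_id, id_tensorHom, ← evalFunctor_map_eqToHom] at h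
    exact h
  left_unitality X :=
    Eq.symm ((congrArg (fun k => k ≫ _ ≫ _) (id_whiskerRight (𝟙_ D.carrier) (D.wordObj X))).trans
      ((Category.id_comp _).trans ((congrArg (fun k => (λ_ (D.wordObj X)).hom ≫ k)
        (D.evalFunctor_map_eqToHom (T.nil_append X))).trans (Category.comp_id _))))
  right_unitality X :=
    Eq.symm ((congrArg (fun k => k ≫ _ ≫ _) (whiskerLeft_id (D.wordObj X) (𝟙_ D.carrier))).trans
      ((Category.id_comp _).trans ((congrArg (fun k => (D.wordTensor X T.nil).hom ≫ k)
        (D.evalFunctor_map_eqToHom (T.append_nil X))).trans (D.wordTensor_nil_right X))))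

/-- The strong monoidal functor sending a word to its tensor product. -/
def eval : SigmaLax (T.distMon D.carrier) D where
  functor := D.evalFunctor
  lax := D.evalLaxMonoidal
  map_Λ _ := rfl
  map_σ X Y := D.wordTensor_wordHom_swap X Y

theorem eval_isStrong : D.eval.IsStrong where
  isIso_μ X Y := (D.wordTensor X Y).isIso_hom
  isIso_μ₀ := inferInstanceAs (IsIso (𝟙 (𝟙_ D.carrier)))

end DistMon

/-! ### The pseudoalgebra of a distorted monoidal category -/

namespace SigmaLax

variable {A : DistMon.{v₁, u₁}} {B : DistMon.{v₂, u₂}}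

theorem comp_app {F G H : SigmaLax A B} (η : F ⟶ G) (θ : G ⟶ H) (x : A.carrier) :
    (η ≫ θ).nat.app x = η.nat.app x ≫ θ.nat.app x := rfl

theorem app_congr {F G : SigmaLax A B} {η θ : F ⟶ G} (h : η = θ) (x : A.carrier) :
    η.nat.app x = θ.nat.app x := by rw [h]

/-- The natural isomorphism underlying an isomorphism of `σ`-lax monoidal functors. -/
def isoNat {F G : SigmaLax A B} (e : F ≅ G) : F.functor ≅ G.functor where
  hom := e.hom.nat
  inv := e.inv.nat
  hom_inv_id := congrArg Hom.nat e.hom_inv_id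
  inv_hom_id := congrArg Hom.nat e.inv_hom_id

end SigmaLax

namespace T

variable {C : Type u₁} [Category.{v₁} C] {D : Type u₂} [Category.{v₂} D]

theorem mapLax_isStrong (F : C ⥤ D) : (mapLax F).IsStrong :=
  IsStrict.toSigmaLax_isStrong _

variable (C) in
theorem multLax_isStrong : (multLax C).IsStrong :=
  IsStrict.toSigmaLax_isStrong _

end T

namespace DistMon

variable (D : DistMon.{v, u})

/-- The comparison of an object with the tensor product of the one-letter word. -/
def evalUnit : 𝟭 D.carrier ≅ T.unit D.carrier ⋙ D.evalFunctor :=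
  NatIso.ofComponents (fun x => (ρ_ x).symm) fun {x _} f =>
    (rightUnitor_inv_naturality f).trans
      (congrArg (fun k => (ρ_ x).inv ≫ k) (tensorHom_id f (𝟙_ D.carrier)).symm)

/-- The comparison of a one-letter word of words with its concatenation. -/
def singleIso (X : T D.carrier) : D.evalFunctor.obj X ⊗ 𝟙_ D.carrier ≅
    D.evalFunctor.obj ((T.mult D.carrier).obj (T.single X)) :=
  ρ_ (D.evalFunctor.obj X) ≪≫ D.evalFunctor.mapIso (eqToIso (T.mult_obj_single X).symm)

theorem singleIso_hom (X : T D.carrier) :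
    (D.singleIso X).hom = (ρ_ (D.evalFunctor.obj X)).hom ≫
      D.evalFunctor.map (eqToHom (T.mult_obj_single X).symm) := rfl

theorem singleIso_naturality {X Y : T D.carrier} (f : X ⟶ Y) :
    (D.evalFunctor.map f ⊗ₘ 𝟙 (𝟙_ D.carrier)) ≫ (D.singleIso Y).hom =
      (D.singleIso X).hom ≫ D.evalFunctor.map ((T.mult D.carrier).map (T.of f)) := by
  rw [singleIso_hom, singleIso_hom, T.mult_map_of, Category.assoc, ← Functor.map_comp,
    eqToHom_trans_assoc, eqToHom_refl, Category.id_comp, Functor.map_comp, tensorHom_id,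
    rightUnitor_naturality_assoc]

/-- The comparison of an iterated tensor product with the tensor product of the concatenation, as
a monoidal isomorphism. -/
noncomputable def evalMultLax :
    SigmaLax.comp (T.mapLax D.evalFunctor) D.eval ≅
      SigmaLax.comp (T.multLax D.carrier) D.eval :=
  SigmaLax.extendIso ((T.mapLax_isStrong _).comp D.eval_isStrong)
    ((T.multLax_isStrong _).comp D.eval_isStrong) D.singleIso D.singleIso_naturality

theorem evalMultLax_single (X : T D.carrier) :
    D.evalMultLax.hom.nat.app (T.single X) = (D.singleIso X).hom :=
  SigmaLax.extendIso_hom_single (P := SigmaLax.comp (T.mapLax D.evalFunctor) D.eval)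
    (Q := SigmaLax.comp (T.multLax D.carrier) D.eval) _ _ D.singleIso D.singleIso_naturality X

/-- The comparison of an iterated tensor product with the tensor product of the concatenation. -/
noncomputable def evalMult :
    T.map D.evalFunctor ⋙ D.evalFunctor ≅ T.mult D.carrier ⋙ D.evalFunctor :=
  SigmaLax.isoNat D.evalMultLax

/-- Both sides are monoidal transformations out of the strong functor `D.eval`, so a one-letter word
suffices. There every `eqToHom` is an identity, and `ρ⁻¹` of `x`, tensored with the unit object,
cancels against `ρ` of `x ⊗ 𝟙_`. -/
theorem evalMultLax_unit_right :
    eqToHom (by rw [T.mapLax_id, SigmaLax.id_comp]) ≫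
      SigmaLax.whiskerRight (T.map₂Lax D.evalUnit.hom) D.eval ≫
      eqToHom (by rw [T.mapLax_comp, SigmaLax.assoc]) ≫
      SigmaLax.whiskerLeft (T.mapLax (T.unit D.carrier)) D.evalMultLax.hom =
    eqToHom (X := D.eval) (by rw [← SigmaLax.assoc, T.mapLax_unit_mult, SigmaLax.id_comp]) := by
  refine SigmaLax.hom_ext_single D.eval_isStrong fun x => ?_
  rw [SigmaLax.comp_app, SigmaLax.comp_app, SigmaLax.comp_app, SigmaLax.eqToHom_nat,
    SigmaLax.eqToHom_nat, SigmaLax.eqToHom_nat, SigmaLax.whiskerRight_app,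
    SigmaLax.whiskerLeft_app]
  have h₁ : (T.map₂ D.evalUnit.hom).app (T.single x) = T.of (ρ_ x).inv :=
    (T.map₂_single _ x).trans ((Category.id_comp _).trans (Category.comp_id _))
  change 𝟙 _ ≫ D.evalFunctor.map ((T.map₂ D.evalUnit.hom).app (T.single x)) ≫ 𝟙 _ ≫
    D.evalMultLax.hom.nat.app (T.single (T.single x)) = 𝟙 _
  rw [h₁, evalMultLax_single]
  change 𝟙 _ ≫ ((ρ_ x).inv ⊗ₘ 𝟙 (𝟙_ D.carrier)) ≫ 𝟙 _ ≫ (ρ_ (x ⊗ 𝟙_ D.carrier)).hom ≫ 𝟙 _ = 𝟙 _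
  simp

/-- Again only one-letter words `[W]` matter. On them one of the two comparisons on each side is a
right unitor up to equality of words, and the law is naturality of the right unitor along
`D.evalMult` at `W`. -/
theorem evalMultLax_assoc :
    SigmaLax.whiskerLeft (T.mapLax (T.map D.evalFunctor)) D.evalMultLax.hom ≫
      eqToHom (by rw [← SigmaLax.assoc, T.mapLax_mult, SigmaLax.assoc]) ≫
      SigmaLax.whiskerLeft (T.multLax (T D.carrier)) D.evalMultLax.hom =
    eqToHom (by rw [← SigmaLax.assoc, ← T.mapLax_comp]) ≫
      SigmaLax.whiskerRight (T.map₂Lax (D.evalMult).hom) D.eval ≫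
      eqToHom (by
        rw [← SigmaLax.assoc]
        exact congrArg (fun k => SigmaLax.comp k D.eval)
          (T.mapLax_comp (T.mult D.carrier) D.evalFunctor)) ≫
      SigmaLax.whiskerLeft (T.mapLax (T.mult D.carrier)) D.evalMultLax.hom ≫
      eqToHom (by rw [← SigmaLax.assoc, ← SigmaLax.assoc, T.multLax_mult]) := by
  refine SigmaLax.hom_ext_single ((T.mapLax_isStrong _).comp
    ((T.mapLax_isStrong _).comp D.eval_isStrong)) fun W => ?_
  simp only [SigmaLax.comp_app, SigmaLax.eqToHom_nat]
  have h₁ : (T.map₂ D.evalMult.hom).app (T.single W) = T.of (D.evalMult.hom.app W) :=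
    (T.map₂_single _ W).trans ((Category.id_comp _).trans (Category.comp_id _))
  -- Concatenating `[W]` returns `W` only propositionally, so the comparison there is that at `W`
  -- conjugated by `eqToHom`.
  have h₂ := NatTrans.congr D.evalMult.hom (T.mult_obj_single W)
  have hs (X : T D.carrier) : D.evalMult.hom.app (T.single X) = (D.singleIso X).hom :=
    D.evalMultLax_single X
  have e : D.evalFunctor.map ((T.map₂ D.evalMult.hom).app (T.single W)) =
      D.evalMult.hom.app W ⊗ₘ 𝟙 (𝟙_ D.carrier) := congrArg D.evalFunctor.map h₁
  have l : (D.singleIso ((T.map D.evalFunctor).obj W)).hom ≫ eqToHom (by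
        rw [T.mult_obj_single, T.mult_obj_single]; rfl) ≫
      D.evalMult.hom.app ((T.mult (T D.carrier)).obj (T.single W)) =
    (D.evalMult.hom.app W ⊗ₘ 𝟙 (𝟙_ D.carrier)) ≫
      (D.singleIso ((T.mult D.carrier).obj W)).hom ≫ eqToHom (by
        rw [T.mult_obj_single, T.mult_obj_single]; rfl) := by
    rw [h₂, singleIso_hom, singleIso_hom, tensorHom_id]
    have hn := rightUnitor_naturality (D.evalMult.hom.app W)
    simp only [Category.assoc, Functor.comp_map, eqToHom_map, eqToHom_trans_assoc, eqToHom_refl,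
      Category.id_comp, eqToHom_trans, Functor.comp_obj] at hn ⊢
    rw [reassoc_of% hn]
  refine Eq.trans (congrArg (fun k => k ≫ eqToHom _ ≫ _) (hs ((T.map D.evalFunctor).obj W))) ?_
  refine l.trans ?_
  refine Eq.symm ((Category.id_comp _).trans ((congrArg (fun k => k ≫ _) e).trans ?_))
  refine congrArg (fun k => _ ≫ k) ((Category.id_comp _).trans ?_)
  exact congrArg (fun k => k ≫ _) (hs ((T.mult D.carrier).obj W))

/-- The pseudoalgebra of a distorted monoidal category, given by the tensor products of words. -/
noncomputable def pseudoAlgebra : PseudoAlgebra D.carrier where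
  act := D.evalFunctor
  unitIso := D.evalUnit
  multIso := D.evalMult
  unit_left X := by
    -- At a one-letter word of words the multiplication comparison was chosen to be the right
    -- unitor, the inverse of the unit comparison.
    refine (congrArg (fun k => (ρ_ (D.evalFunctor.obj X)).inv ≫ k)
      (D.evalMultLax_single X)).trans ?_
    exact Iso.inv_hom_id_assoc _ _
  unit_right X := by
    -- The pseudoalgebra law is the component at `X` of the equation of monoidal transformations,
    -- with `eqToHom` moved through the action.
    have h := SigmaLax.app_congr D.evalMultLax_unit_right X
    simp only [SigmaLax.comp_app, SigmaLax.eqToHom_nat] at h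
    rw [Functor.map_comp, Functor.map_comp, eqToHom_map, eqToHom_map, eqToHom_map,
      Category.assoc, Category.assoc]
    exact h
  assoc V := by
    have h := SigmaLax.app_congr D.evalMultLax_assoc V
    simp only [SigmaLax.comp_app, SigmaLax.eqToHom_nat] at h
    rw [Functor.map_comp, Functor.map_comp, eqToHom_map, eqToHom_map, eqToHom_map, eqToHom_map,
      Category.assoc, Category.assoc]
    exact h

/-- The pseudoalgebra of a distorted monoidal category. -/
noncomputable def toPsAlg : PsAlg.{v, u} where
  carrier := D.carrier
  str := D.pseudoAlgebra

end DistMon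

/-! ### The comparisons of a pseudoalgebra -/

namespace T

/-- On explicit two-letter words the corrections by `eqToHom` have definitionally equal endpoints,
hence are identities. -/
theorem map₂_pair {C : Type u₁} [Category.{v₁} C] {D : Type u₂} [Category.{v₂} D] {F G : C ⥤ D}
    (θ : F ⟶ G) (x y : C) :
    (map₂ θ).app (append (single x) (single y)) = tensor (of (θ.app x)) (of (θ.app y)) := by
  have h (z : C) : (map₂ θ).app (single z) = of (θ.app z) :=
    (map₂_single θ z).trans ((Category.id_comp _).trans (Category.comp_id _))
  refine (map₂_append θ _ _).trans ((Category.id_comp _).trans ((Category.comp_id _).trans ?_))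
  rw [h, h]
  rfl

theorem map_map_tensor_of {C : Type u₁} [Category.{v₁} C] {D : Type u₂} [Category.{v₂} D]
    (F : C ⥤ D) {x x' y y' : C} (f : x ⟶ x') (g : y ⟶ y') :
    (map F).map (tensor (of f) (of g)) = tensor (of (F.map f)) (of (F.map g)) :=
  ((map_isStrict F).map_tensor _ _).trans ((Category.id_comp _).trans (Category.comp_id _))

theorem map_map_swap_single {C : Type u₁} [Category.{v₁} C] {D : Type u₂} [Category.{v₂} D]
    (F : C ⥤ D) (x y : C) :
    (map F).map (swap (single x) (single y)) = swap (single (F.obj x)) (single (F.obj y)) :=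
  ((map_isStrict F).map_swap _ _).trans ((Category.id_comp _).trans (Category.comp_id _))

variable {C : Type u} [Category.{v} C]

/-- Here the corrections remain, since concatenating the word `[X, Y]` leaves a trailing empty word.
-/
theorem mult_map_tensor_of {X X' Y Y' : T C} (f : X ⟶ X') (g : Y ⟶ Y') :
    (mult C).map (tensor (of f) (of g)) =
      eqToHom (join_pair X Y) ≫ tensor f g ≫ eqToHom (join_pair X' Y').symm := by
  rw [mult_isStrict.map_tensor, mult_map_of, mult_map_of, tensor_congr_left, tensor_congr_right]
  simp only [Category.assoc, eqToHom_trans, eqToHom_trans_assoc]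
  rfl

theorem mult_map_swap_single (X Y : T C) :
    (mult C).map (swap (single X) (single Y)) =
      eqToHom (join_pair X Y) ≫ swap X Y ≫ eqToHom (join_pair Y X).symm := by
  rw [mult_isStrict.map_swap, swap_eqToHom (mult_obj_single X) (mult_obj_single Y)]
  simp only [Category.assoc, eqToHom_trans, eqToHom_trans_assoc]
  rfl

end T

namespace PseudoAlgebra

variable {A : Type u} [Category.{v} A] (a : PseudoAlgebra A)

theorem tensorHom_id (x y : A) : a.tensorHom (𝟙 x) (𝟙 y) = 𝟙 (a.tensorObj x y) := by
  unfold tensorHom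
  rw [T.of_id, T.of_id, T.tensor_id]
  exact a.act.map_id _

theorem tensorHom_comp {x x' x'' y y' y'' : A} (f : x ⟶ x') (f' : x' ⟶ x'') (g : y ⟶ y')
    (g' : y' ⟶ y'') :
    a.tensorHom f g ≫ a.tensorHom f' g' = a.tensorHom (f ≫ f') (g ≫ g') := by
  unfold tensorHom
  rw [T.of_comp, T.of_comp, T.tensor_comp]
  exact (a.act.map_comp _ _).symm

theorem tensorHom_comp_assoc {x x' x'' y y' y'' z : A} (f : x ⟶ x') (f' : x' ⟶ x'') (g : y ⟶ y')
    (g' : y' ⟶ y'') (k : a.tensorObj x'' y'' ⟶ z) :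
    a.tensorHom f g ≫ a.tensorHom f' g' ≫ k = a.tensorHom (f ≫ f') (g ≫ g') ≫ k := by
  rw [← Category.assoc, tensorHom_comp]

/-- The morphism induced by an equality of words. -/
def actEq {X Y : T A} (h : X = Y) : a.act.obj X ⟶ a.act.obj Y := a.act.map (eqToHom h)

@[simp]
theorem actEq_refl {X : T A} (h : X = X) : a.actEq h = 𝟙 _ := a.act.map_id _

@[simp]
theorem actEq_trans {X Y Z : T A} (h : X = Y) (h' : Y = Z) :
    a.actEq h ≫ a.actEq h' = a.actEq (h.trans h') := by
  subst h h'; simp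

@[simp]
theorem actEq_trans_assoc {X Y Z : T A} (h : X = Y) (h' : Y = Z) {x : A} (k : a.act.obj Z ⟶ x) :
    a.actEq h ≫ a.actEq h' ≫ k = a.actEq (h.trans h') ≫ k := by
  rw [← Category.assoc, actEq_trans]

/-- The multiplication comparison at a word of words. -/
def multApp (W : T (T A)) :
    a.act.obj ((T.map a.act).obj W) ≅ a.act.obj ((T.mult A).obj W) :=
  a.multIso.app W

/-- The multiplication comparison at a word of words, with source and target prescribed up to
equality. -/
def mul (W : T (T A)) {V X : T A} (hV : V = (T.map a.act).obj W) (hX : (T.mult A).obj W = X) :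
    a.act.obj V ≅ a.act.obj X :=
  a.act.mapIso (eqToIso hV) ≪≫ a.multApp W ≪≫ a.act.mapIso (eqToIso hX)

theorem mul_hom (W : T (T A)) {V X : T A} (hV : V = (T.map a.act).obj W)
    (hX : (T.mult A).obj W = X) :
    (a.mul W hV hX).hom = a.actEq hV ≫ (a.multApp W).hom ≫ a.actEq hX := rfl

theorem mul_comp_actEq {W W' : T (T A)} (h : W = W') {V V' X X' : T A}
    (hV : V = (T.map a.act).obj W) (hX : (T.mult A).obj W = X) (hV' : V' = (T.map a.act).obj W')
    (hX' : (T.mult A).obj W' = X') (e : X = X') (e' : V = V') :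
    (a.mul W hV hX).hom ≫ a.actEq e = a.actEq e' ≫ (a.mul W' hV' hX').hom := by
  subst h e e'; simp

/-- Adjusts the endpoints of an instance of the associativity law to prescribed words; all
equalities are eliminated by substitution. -/
theorem comp_mul_eq {x y : A} {W W' : T (T A)} (hW : W = W') {X X' V V' : T A} (t : x ⟶ y)
    (p : y ⟶ a.act.obj X) (q : x ⟶ a.act.obj V) (eX : X = (T.mult A).obj W)
    (eV : V = (T.map a.act).obj W) (h : t ≫ p ≫ a.actEq eX = q ≫ a.actEq eV ≫ (a.multApp W).hom)
    (hX : X = X') (hV : V = V') (hV' : V' = (T.map a.act).obj W') (hX' : (T.mult A).obj W' = X') :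
    t ≫ p ≫ a.actEq hX = (q ≫ a.actEq hV) ≫ (a.mul W' hV' hX').hom := by
  subst hW hX' hV hV'
  simpa [mul_hom] using h

theorem mul_pair (X Y : T A) :
    a.mul (V := T.append (T.single (a.act.obj X)) (T.single (a.act.obj Y)))
      (T.append (T.single X) (T.single Y)) rfl (T.join_pair X Y) = a.tensorCmp X Y := by
  ext
  exact (congrArg (fun k => k ≫ _) (a.act.map_id _)).trans (Category.id_comp _)

/-- The left unit law: the unit comparison followed by multiplication at `[X]` is an equality of
words, so multiplication there inverts the unit comparison. -/
theorem mul_single (X : T A) :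
    a.mul (V := T.single (a.act.obj X)) (T.single X) rfl (T.mult_obj_single X) =
      (a.unitCmp (a.act.obj X)).symm := by
  ext
  refine (congrArg (fun k => k ≫ _) (a.act.map_id _)).trans ((Category.id_comp _).trans ?_)
  refine (cancel_epi (a.unitCmp (a.act.obj X)).hom).1 (Eq.trans ?_ (Iso.hom_inv_id _).symm)
  refine (Category.assoc _ _ _).symm.trans ((congrArg (fun k => k ≫ _) (a.unit_left X)).trans ?_)
  exact (a.actEq_trans (T.mult_obj_unit X).symm (T.mult_obj_single X)).trans (a.actEq_refl rfl)

/-- The right unit law at the empty word, where the letterwise unit comparison is an identity. -/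
theorem mul_nil : a.mul (V := T.nil) T.nil rfl (Eq.refl T.nil) = Iso.refl (a.act.obj T.nil) := by
  ext
  refine (congrArg (fun k => k ≫ _) (a.act.map_id _)).trans ((Category.id_comp _).trans ?_)
  refine (congrArg (fun k => _ ≫ k) (a.act.map_id _)).trans ((Category.comp_id _).trans ?_)
  have h := a.unit_right T.nil
  rw [T.map₂_nil, eqToHom_trans, eqToHom_trans] at h
  refine Eq.trans ?_ (h.trans (a.act.map_id _))
  exact ((congrArg (fun k => k ≫ _) (a.act.map_id _)).trans (Category.id_comp _)).symm

/-- The associativity law of the pseudoalgebra at the two-letter word `[W, W']`: the multiplication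
comparison is itself monoidal with respect to `tensorCmp`. All coherence of the underlying tensor
product is extracted from this. -/
theorem multApp_append (W W' : T (T A)) :
    a.tensorHom (a.multApp W).hom (a.multApp W').hom ≫
        (a.tensorCmp ((T.mult A).obj W) ((T.mult A).obj W')).hom =
      (a.tensorCmp ((T.map a.act).obj W) ((T.map a.act).obj W')).hom ≫
        (a.mul (T.append W W') ((T.map_isStrict a.act).obj_append W W').symm
          (T.mult_isStrict.obj_append W W')).hom := by
  have h := a.assoc (T.append (T.single W) (T.single W'))
  have h₁ : a.act.map (eqToHom (T.map_obj_comp (T.map a.act) a.act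
      (T.append (T.single W) (T.single W'))).symm ≫
        (T.map₂ a.multIso.hom).app (T.append (T.single W) (T.single W')) ≫
          eqToHom (T.map_obj_comp (T.mult A) a.act (T.append (T.single W) (T.single W')))) =
      a.tensorHom (a.multApp W).hom (a.multApp W').hom :=
    congrArg a.act.map ((Category.id_comp _).trans
      ((Category.comp_id _).trans (T.map₂_pair a.multIso.hom W W')))
  have h₂ : a.tensorHom (a.multApp W).hom (a.multApp W').hom ≫
      (a.multApp (T.append (T.single ((T.mult A).obj W)) (T.single ((T.mult A).obj W')))).hom ≫
        a.actEq (T.mult_obj_map_mult (T.append (T.single W) (T.single W'))) =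
      (a.multApp (T.append (T.single ((T.map a.act).obj W))
          (T.single ((T.map a.act).obj W')))).hom ≫
        a.actEq (T.mult_obj_map a.act (T.append (T.single W) (T.single W'))) ≫
          (a.multApp ((T.mult (T A)).obj (T.append (T.single W) (T.single W')))).hom :=
    (congrArg (fun k => k ≫ _) h₁).symm.trans h.symm
  exact a.comp_mul_eq (T.join_pair W W') _ _ _ _ _ h₂ (T.join_pair _ _) (T.join_pair _ _)
    ((T.map_isStrict a.act).obj_append W W').symm (T.mult_isStrict.obj_append W W')

theorem mul_append {W W' : T (T A)} {V V' X X' : T A} (hV : V = (T.map a.act).obj W)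
    (hV' : V' = (T.map a.act).obj W') (hX : (T.mult A).obj W = X) (hX' : (T.mult A).obj W' = X') :
    a.tensorHom (a.mul W hV hX).hom (a.mul W' hV' hX').hom ≫ (a.tensorCmp X X').hom =
      (a.tensorCmp V V').hom ≫
        (a.mul (T.append W W')
          ((congrArg₂ T.append hV hV').trans ((T.map_isStrict a.act).obj_append W W').symm)
          ((T.mult_isStrict.obj_append W W').trans (congrArg₂ T.append hX hX'))).hom := by
  subst hV hV' hX hX'
  simpa [mul_hom] using a.multApp_append W W'

end PseudoAlgebra

/-! ### Monoidal structures presented by a monoidal category -/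

section Presentation

variable {S : Type u₁} [Category.{v₁} S] [MonoidalCategory S] {A : Type u} [Category.{v} A]
  [MonoidalCategoryStruct A]

/-- The data of a monoidal category, presented by a functor from a monoidal category which is
surjective on objects up to isomorphism and compatible with the structure. -/
structure MonoidalPresentation (P : S ⥤ A) (m : ∀ X Y, P.obj X ⊗ P.obj Y ≅ P.obj (X ⊗ Y))
    (e : 𝟙_ A ≅ P.obj (𝟙_ S)) : Prop where
  whiskerLeft_eq (x : A) {y z : A} (f : y ⟶ z) : x ◁ f = 𝟙 x ⊗ₘ f
  whiskerRight_eq {x y : A} (f : x ⟶ y) (z : A) : f ▷ z = f ⊗ₘ 𝟙 z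
  tensor_id (x y : A) : 𝟙 x ⊗ₘ 𝟙 y = 𝟙 (x ⊗ y)
  tensor_comp {x x' x'' y y' y'' : A} (f : x ⟶ x') (f' : x' ⟶ x'') (g : y ⟶ y') (g' : y' ⟶ y'') :
    (f ⊗ₘ g) ≫ (f' ⊗ₘ g') = f ≫ f' ⊗ₘ g ≫ g'
  associator_nat {x x' y y' z z' : A} (f : x ⟶ x') (g : y ⟶ y') (h : z ⟶ z') :
    ((f ⊗ₘ g) ⊗ₘ h) ≫ (α_ x' y' z').hom = (α_ x y z).hom ≫ (f ⊗ₘ (g ⊗ₘ h))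
  leftUnitor_nat {x y : A} (f : x ⟶ y) : (𝟙 _ ⊗ₘ f) ≫ (λ_ y).hom = (λ_ x).hom ≫ f
  rightUnitor_nat {x y : A} (f : x ⟶ y) : (f ⊗ₘ 𝟙 _) ≫ (ρ_ y).hom = (ρ_ x).hom ≫ f
  nat {X X' Y Y' : S} (f : X ⟶ X') (g : Y ⟶ Y') :
    (P.map f ⊗ₘ P.map g) ≫ (m X' Y').hom = (m X Y).hom ≫ P.map (f ⊗ₘ g)
  assoc (X Y Z : S) : ((m X Y).hom ⊗ₘ 𝟙 _) ≫ (m (X ⊗ Y) Z).hom ≫ P.map (α_ X Y Z).hom =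
    (α_ _ _ _).hom ≫ (𝟙 _ ⊗ₘ (m Y Z).hom) ≫ (m X (Y ⊗ Z)).hom
  left_unit (X : S) : (e.hom ⊗ₘ 𝟙 _) ≫ (m (𝟙_ S) X).hom ≫ P.map (λ_ X).hom = (λ_ _).hom
  right_unit (X : S) : (𝟙 _ ⊗ₘ e.hom) ≫ (m X (𝟙_ S)).hom ≫ P.map (ρ_ X).hom = (ρ_ _).hom
  dense (x : A) : ∃ X : S, Nonempty (P.obj X ≅ x)

namespace MonoidalPresentation

variable {P : S ⥤ A} {m : ∀ X Y, P.obj X ⊗ P.obj Y ≅ P.obj (X ⊗ Y)} {e : 𝟙_ A ≅ P.obj (𝟙_ S)}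
  (p : MonoidalPresentation P m e)

include p

theorem tensor_comp_assoc {x x' x'' y y' y'' z : A} (f : x ⟶ x') (f' : x' ⟶ x'') (g : y ⟶ y')
    (g' : y' ⟶ y'') (k : x'' ⊗ y'' ⟶ z) :
    (f ⊗ₘ g) ≫ (f' ⊗ₘ g') ≫ k = (f ≫ f' ⊗ₘ g ≫ g') ≫ k := by
  rw [← Category.assoc, p.tensor_comp]

theorem associator_nat_assoc {x x' y y' z z' w : A} (f : x ⟶ x') (g : y ⟶ y') (h : z ⟶ z')
    (k : x' ⊗ y' ⊗ z' ⟶ w) :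
    ((f ⊗ₘ g) ⊗ₘ h) ≫ (α_ x' y' z').hom ≫ k =
      (α_ x y z).hom ≫ (f ⊗ₘ (g ⊗ₘ h)) ≫ k := by
  rw [← Category.assoc, p.associator_nat, Category.assoc]

theorem nat_assoc {X X' Y Y' : S} (f : X ⟶ X') (g : Y ⟶ Y') {z : A} (k : P.obj (X' ⊗ Y') ⟶ z) :
    (P.map f ⊗ₘ P.map g) ≫ (m X' Y').hom ≫ k = (m X Y).hom ≫ P.map (f ⊗ₘ g) ≫ k := by
  rw [← Category.assoc, p.nat, Category.assoc]

theorem assoc_assoc (X Y Z : S) {w : A} (k : P.obj (X ⊗ Y ⊗ Z) ⟶ w) :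
    ((m X Y).hom ⊗ₘ 𝟙 _) ≫ (m (X ⊗ Y) Z).hom ≫ P.map (α_ X Y Z).hom ≫ k =
      (α_ _ _ _).hom ≫ (𝟙 _ ⊗ₘ (m Y Z).hom) ≫ (m X (Y ⊗ Z)).hom ≫ k := by
  have h := congrArg (fun t => t ≫ k) (p.assoc X Y Z)
  simpa only [Category.assoc] using h

theorem isIso_tensor {x x' y y' : A} (f : x ⟶ x') (g : y ⟶ y') [IsIso f] [IsIso g] :
    IsIso (f ⊗ₘ g) :=
  ⟨⟨inv f ⊗ₘ inv g, by simp [p.tensor_comp, p.tensor_id], by simp [p.tensor_comp, p.tensor_id]⟩⟩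

/-- The usual transport along a strong monoidal functor: after comparison with `P` of the fourfold
tensor product, each associator of `A` is traded for the image of one in `S`, where the pentagon
holds. -/
theorem pentagon_obj (W X Y Z : S) :
    ((α_ (P.obj W) (P.obj X) (P.obj Y)).hom ⊗ₘ 𝟙 (P.obj Z)) ≫ (α_ _ _ _).hom ≫
        (𝟙 (P.obj W) ⊗ₘ (α_ (P.obj X) (P.obj Y) (P.obj Z)).hom) =
      (α_ (P.obj W ⊗ P.obj X) (P.obj Y) (P.obj Z)).hom ≫ (α_ _ _ _).hom := by
  have := p.isIso_tensor (𝟙 (P.obj X)) (m Y Z).hom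
  have := p.isIso_tensor (𝟙 (P.obj W)) ((𝟙 (P.obj X) ⊗ₘ (m Y Z).hom) ≫ (m X (Y ⊗ Z)).hom)
  -- The comparison of the right-nested fourfold product, invertible and hence cancellable.
  rw [← cancel_mono ((𝟙 (P.obj W) ⊗ₘ ((𝟙 (P.obj X) ⊗ₘ (m Y Z).hom) ≫ (m X (Y ⊗ Z)).hom)) ≫
    (m W (X ⊗ Y ⊗ Z)).hom)]
  calc _ = ((α_ (P.obj W) (P.obj X) (P.obj Y)).hom ⊗ₘ 𝟙 (P.obj Z)) ≫ (α_ _ _ _).hom ≫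
        (𝟙 (P.obj W) ⊗ₘ (((m X Y).hom ⊗ₘ 𝟙 (P.obj Z)) ≫ (m (X ⊗ Y) Z).hom ≫
          P.map (α_ X Y Z).hom)) ≫ (m W (X ⊗ Y ⊗ Z)).hom := by
        simp only [Category.assoc, p.tensor_comp_assoc, Category.comp_id, p.assoc]
    _ = ((α_ (P.obj W) (P.obj X) (P.obj Y)).hom ⊗ₘ 𝟙 (P.obj Z)) ≫ (α_ _ _ _).hom ≫
        (𝟙 (P.obj W) ⊗ₘ ((m X Y).hom ⊗ₘ 𝟙 (P.obj Z))) ≫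
          (𝟙 (P.obj W) ⊗ₘ (m (X ⊗ Y) Z).hom) ≫ (m W ((X ⊗ Y) ⊗ Z)).hom ≫
            P.map (𝟙 W ⊗ₘ (α_ X Y Z).hom) := by
        rw [← p.nat]
        simp only [p.tensor_comp_assoc, Category.comp_id, P.map_id]
    _ = (((α_ (P.obj W) (P.obj X) (P.obj Y)).hom ≫ (𝟙 (P.obj W) ⊗ₘ (m X Y).hom)) ⊗ₘ
          𝟙 (P.obj Z)) ≫ ((m W (X ⊗ Y)).hom ⊗ₘ 𝟙 (P.obj Z)) ≫
          (m (W ⊗ X ⊗ Y) Z).hom ≫ P.map (α_ W (X ⊗ Y) Z).hom ≫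
            P.map (𝟙 W ⊗ₘ (α_ X Y Z).hom) := by
        rw [← p.associator_nat_assoc, p.assoc_assoc, p.tensor_comp_assoc, Category.comp_id]
    _ = (((m W X).hom ⊗ₘ 𝟙 (P.obj Y)) ⊗ₘ 𝟙 (P.obj Z)) ≫ ((m (W ⊗ X) Y).hom ⊗ₘ 𝟙 (P.obj Z)) ≫
          (m ((W ⊗ X) ⊗ Y) Z).hom ≫ P.map ((α_ W X Y).hom ⊗ₘ 𝟙 Z) ≫
            P.map (α_ W (X ⊗ Y) Z).hom ≫ P.map (𝟙 W ⊗ₘ (α_ X Y Z).hom) := by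
        rw [← p.nat_assoc, p.tensor_comp_assoc, p.tensor_comp_assoc, p.tensor_comp_assoc, P.map_id]
        simp only [Category.assoc, Category.comp_id, p.assoc]
    -- The pentagon of `S` is used here, under `P`; the remaining steps undo the trade.
    _ = (((m W X).hom ⊗ₘ 𝟙 (P.obj Y)) ⊗ₘ 𝟙 (P.obj Z)) ≫ ((m (W ⊗ X) Y).hom ⊗ₘ 𝟙 (P.obj Z)) ≫
          (m ((W ⊗ X) ⊗ Y) Z).hom ≫ P.map (α_ (W ⊗ X) Y Z).hom ≫ P.map (α_ W X (Y ⊗ Z)).hom := by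
        rw [← P.map_comp, ← P.map_comp, ← P.map_comp]
        simp
    _ = (α_ (P.obj W ⊗ P.obj X) (P.obj Y) (P.obj Z)).hom ≫
          (𝟙 (P.obj W ⊗ P.obj X) ⊗ₘ (m Y Z).hom) ≫ ((m W X).hom ⊗ₘ 𝟙 (P.obj (Y ⊗ Z))) ≫
            (m (W ⊗ X) (Y ⊗ Z)).hom ≫ P.map (α_ W X (Y ⊗ Z)).hom := by
        rw [p.assoc_assoc, p.associator_nat_assoc, p.tensor_id, p.tensor_comp_assoc,
          p.tensor_comp_assoc]
        simp only [Category.comp_id, Category.id_comp]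
    _ = (α_ (P.obj W ⊗ P.obj X) (P.obj Y) (P.obj Z)).hom ≫
          (α_ (P.obj W) (P.obj X) (P.obj Y ⊗ P.obj Z)).hom ≫
            (𝟙 (P.obj W) ⊗ₘ (𝟙 (P.obj X) ⊗ₘ (m Y Z).hom)) ≫
              (𝟙 (P.obj W) ⊗ₘ (m X (Y ⊗ Z)).hom) ≫ (m W (X ⊗ Y ⊗ Z)).hom := by
        rw [p.assoc, ← p.tensor_id, p.associator_nat_assoc]
    _ = _ := by
        simp only [Category.assoc, p.tensor_comp_assoc, Category.comp_id]

theorem triangle_obj (X Y : S) :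
    (α_ (P.obj X) (𝟙_ A) (P.obj Y)).hom ≫ (𝟙 _ ⊗ₘ (λ_ (P.obj Y)).hom) =
      (ρ_ (P.obj X)).hom ⊗ₘ 𝟙 (P.obj Y) := by
  rw [← cancel_mono (m X Y).hom, ← p.left_unit, ← p.right_unit]
  calc _ = (α_ (P.obj X) (𝟙_ A) (P.obj Y)).hom ≫ (𝟙 (P.obj X) ⊗ₘ (e.hom ⊗ₘ 𝟙 (P.obj Y))) ≫
        (𝟙 (P.obj X) ⊗ₘ (m (𝟙_ S) Y).hom) ≫ (m X (𝟙_ S ⊗ Y)).hom ≫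
          P.map (𝟙 X ⊗ₘ (λ_ Y).hom) := by
        rw [← p.nat]
        simp only [Category.assoc, p.tensor_comp_assoc, Category.comp_id, P.map_id]
    _ = ((𝟙 (P.obj X) ⊗ₘ e.hom) ⊗ₘ 𝟙 (P.obj Y)) ≫ ((m X (𝟙_ S)).hom ⊗ₘ 𝟙 (P.obj Y)) ≫
        (m (X ⊗ 𝟙_ S) Y).hom ≫ P.map (α_ X (𝟙_ S) Y).hom ≫ P.map (𝟙 X ⊗ₘ (λ_ Y).hom) := by
        rw [p.assoc_assoc, p.associator_nat_assoc]
    _ = ((𝟙 (P.obj X) ⊗ₘ e.hom) ⊗ₘ 𝟙 (P.obj Y)) ≫ ((m X (𝟙_ S)).hom ⊗ₘ 𝟙 (P.obj Y)) ≫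
        (m (X ⊗ 𝟙_ S) Y).hom ≫ P.map ((ρ_ X).hom ⊗ₘ 𝟙 Y) := by
        rw [← P.map_comp]; simp
    _ = _ := by
        rw [← p.nat]
        simp only [p.tensor_comp_assoc, Category.comp_id, P.map_id]

/-- Naturality of the associator conjugates the pentagon by isomorphisms from objects in the image
of `P`, where it is already known. -/
theorem pentagon (w x y z : A) :
    ((α_ w x y).hom ⊗ₘ 𝟙 z) ≫ (α_ _ _ _).hom ≫ (𝟙 w ⊗ₘ (α_ x y z).hom) =
      (α_ (w ⊗ x) y z).hom ≫ (α_ _ _ _).hom := by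
  obtain ⟨W, ⟨i⟩⟩ := p.dense w
  obtain ⟨X, ⟨j⟩⟩ := p.dense x
  obtain ⟨Y, ⟨k⟩⟩ := p.dense y
  obtain ⟨Z, ⟨l⟩⟩ := p.dense z
  have := p.isIso_tensor i.hom j.hom
  have := p.isIso_tensor (i.hom ⊗ₘ j.hom) k.hom
  have := p.isIso_tensor ((i.hom ⊗ₘ j.hom) ⊗ₘ k.hom) l.hom
  rw [← cancel_epi (((i.hom ⊗ₘ j.hom) ⊗ₘ k.hom) ⊗ₘ l.hom), p.associator_nat_assoc,
    p.associator_nat, ← Category.assoc (α_ _ _ _).hom (α_ _ _ _).hom, ← p.pentagon_obj,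
    p.tensor_comp_assoc, p.associator_nat, Category.comp_id]
  have h₁ : (α_ (P.obj W) (P.obj X) (P.obj Y)).hom ≫ (i.hom ⊗ₘ j.hom ⊗ₘ k.hom) ⊗ₘ l.hom =
      ((α_ (P.obj W) (P.obj X) (P.obj Y)).hom ⊗ₘ 𝟙 _) ≫ ((i.hom ⊗ₘ j.hom ⊗ₘ k.hom) ⊗ₘ l.hom) := by
    rw [p.tensor_comp, Category.id_comp]
  rw [h₁, Category.assoc, p.associator_nat_assoc, p.tensor_comp, p.associator_nat,
    Category.assoc, Category.assoc, p.tensor_comp, Category.comp_id, Category.id_comp]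

theorem triangle (x y : A) :
    (α_ x (𝟙_ A) y).hom ≫ (𝟙 _ ⊗ₘ (λ_ y).hom) = (ρ_ x).hom ⊗ₘ 𝟙 y := by
  obtain ⟨X, ⟨i⟩⟩ := p.dense x
  obtain ⟨Y, ⟨j⟩⟩ := p.dense y
  have := p.isIso_tensor i.hom (𝟙 (𝟙_ A))
  have := p.isIso_tensor (i.hom ⊗ₘ 𝟙 (𝟙_ A)) j.hom
  rw [← cancel_epi ((i.hom ⊗ₘ 𝟙 (𝟙_ A)) ⊗ₘ j.hom), p.associator_nat_assoc, p.tensor_comp,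
    p.tensor_comp, p.leftUnitor_nat, p.rightUnitor_nat]
  have h := congrArg (fun t => t ≫ (i.hom ⊗ₘ j.hom)) (p.triangle_obj X Y)
  simpa only [Category.assoc, p.tensor_comp, Category.comp_id, Category.id_comp] using h

/-- A presented monoidal structure satisfies the axioms of a monoidal category. -/
theorem isMonoidalStruct : IsMonoidalStruct (inferInstance : MonoidalCategoryStruct A) :=
  ⟨{ tensorHom_def := fun f g => by
      rw [p.whiskerLeft_eq, p.whiskerRight_eq, p.tensor_comp, Category.comp_id, Category.id_comp]
     id_tensorHom_id := p.tensor_id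
     tensorHom_comp_tensorHom := fun f g f' g' => p.tensor_comp f f' g g'
     whiskerLeft_id := fun x y => by rw [p.whiskerLeft_eq, p.tensor_id]
     id_whiskerRight := fun x y => by rw [p.whiskerRight_eq, p.tensor_id]
     associator_naturality := p.associator_nat
     leftUnitor_naturality := fun f => by rw [p.whiskerLeft_eq, p.leftUnitor_nat]
     rightUnitor_naturality := fun f => by rw [p.whiskerRight_eq, p.rightUnitor_nat]
     pentagon := fun w x y z => by
      rw [p.whiskerLeft_eq, p.whiskerRight_eq, p.pentagon]
     triangle := fun x y => by rw [p.whiskerLeft_eq, p.whiskerRight_eq, p.triangle] }, rfl⟩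

end MonoidalPresentation

end Presentation

section

variable {C : Type u} [Category.{v} C] [MonoidalCategory C]

theorem tensorHom_comp_right {x x' y y' y'' : C} (f : x ⟶ x') (g : y ⟶ y') (h : y' ⟶ y'') :
    f ⊗ₘ (g ≫ h) = (𝟙 x ⊗ₘ g) ≫ (f ⊗ₘ h) := by
  rw [tensorHom_comp_tensorHom, Category.id_comp]

theorem tensorHom_comp_left {x x' y y' y'' : C} (f : x ⟶ x') (g : y ⟶ y') (h : y' ⟶ y'') :
    (g ≫ h) ⊗ₘ f = (g ⊗ₘ 𝟙 x) ≫ (h ⊗ₘ f) := by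
  rw [tensorHom_comp_tensorHom, Category.id_comp]

end

/-! ### Transport of distortions along a dense strong monoidal functor -/

section Distortion

open Functor.LaxMonoidal

variable {S : DistMon.{v₁, u₁}} {A : Type u} [Category.{v} A] [MonoidalCategory A]
  (P : S.carrier ⥤ A) [P.LaxMonoidal]

theorem laxMonoidal_assoc (X Y Z : S.carrier) :
    (μ P X Y ⊗ₘ 𝟙 (P.obj Z)) ≫ μ P (X ⊗ Y) Z ≫ P.map (α_ X Y Z).hom =
      (α_ _ _ _).hom ≫ (𝟙 (P.obj X) ⊗ₘ μ P Y Z) ≫ μ P X (Y ⊗ Z) := by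
  rw [tensorHom_id, id_tensorHom]
  exact associativity P X Y Z

theorem laxMonoidal_assoc_inv (X Y Z : S.carrier) :
    (𝟙 (P.obj X) ⊗ₘ μ P Y Z) ≫ μ P X (Y ⊗ Z) ≫ P.map (α_ X Y Z).inv =
      (α_ _ _ _).inv ≫ (μ P X Y ⊗ₘ 𝟙 (P.obj Z)) ≫ μ P (X ⊗ Y) Z := by
  rw [Iso.eq_inv_comp, ← cancel_mono (P.map (α_ X Y Z).hom)]
  simp only [Category.assoc, laxMonoidal_assoc, ← P.map_comp, Iso.inv_hom_id, P.map_id,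
    Category.comp_id]

/-- The axioms for distortions can be checked on the image of a strong monoidal functor which is
surjective on objects up to isomorphism. -/
theorem isDistortion_of_dense (hμ : ∀ X Y, IsIso (μ P X Y)) (hε : IsIso (ε P))
    (Λ : 𝟭 A ⟶ 𝟭 A) (σ : ∀ x y : A, x ⊗ y ⟶ y ⊗ x)
    (hσ : ∀ {x x' y y' : A} (f : x ⟶ x') (g : y ⟶ y'), σ x y ≫ (g ⊗ₘ f) = (f ⊗ₘ g) ≫ σ x' y')
    (map_Λ : ∀ X, P.map (S.Λ.app X) = Λ.app (P.obj X))
    (map_σ : ∀ X Y, μ P X Y ≫ P.map (S.σ X Y) = σ (P.obj X) (P.obj Y) ≫ μ P Y X)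
    (dense : ∀ x : A, ∃ X : S.carrier, Nonempty (P.obj X ≅ x)) : IsDistortion A Λ σ where
  binatural := hσ
  σ_unit x := by
    obtain ⟨X, ⟨i⟩⟩ := dense x
    -- Naturality reduces to `x = P X`. There both unitors are expressed through `ε` and `μ`, σ is
    -- moved past them, and the identity becomes the image of the one in `S`.
    rw [← cancel_epi (i.hom ⊗ₘ 𝟙 (𝟙_ A)), ← hσ, tensorHom_id, rightUnitor_naturality_assoc,
      id_tensorHom, leftUnitor_inv_naturality, ← Category.assoc]
    refine congrArg (fun k => k ≫ _) ?_
    rw [← cancel_mono (λ_ (P.obj X)).hom, Category.assoc, Iso.inv_hom_id, Category.comp_id,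
      left_unitality P X, right_unitality P X, ← tensorHom_id, ← id_tensorHom,
      reassoc_of% hσ, ← reassoc_of% map_σ, ← P.map_comp, S.isDistortion.σ_unit]
    simp
  unit_σ x := by
    obtain ⟨X, ⟨i⟩⟩ := dense x
    rw [← cancel_epi (𝟙 (𝟙_ A) ⊗ₘ i.hom), ← hσ, tensorHom_id, id_tensorHom,
      leftUnitor_naturality_assoc, rightUnitor_inv_naturality, ← Category.assoc]
    refine congrArg (fun k => k ≫ _) ?_
    rw [← cancel_mono (ρ_ (P.obj X)).hom, Category.assoc, Iso.inv_hom_id, Category.comp_id,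
      left_unitality P X, right_unitality P X, ← tensorHom_id, ← id_tensorHom,
      reassoc_of% hσ, ← reassoc_of% map_σ, ← P.map_comp, S.isDistortion.unit_σ]
    simp
  Λ_unit := by
    -- Naturality along the invertible `ε` compares `Λ` at the unit with its value at `P` of the
    -- unit, which is the image of an identity.
    have h := Λ.naturality (ε P)
    rw [← map_Λ, S.isDistortion.Λ_unit] at h
    refine (cancel_mono (ε P)).1 (h.symm.trans ?_)
    exact (congrArg (fun k => ε P ≫ k) (P.map_id _)).trans
      ((Category.comp_id _).trans (Category.id_comp _).symm)
  hexagon_left x y z := by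
    obtain ⟨X, ⟨i⟩⟩ := dense x
    obtain ⟨Y, ⟨j⟩⟩ := dense y
    obtain ⟨Z, ⟨k⟩⟩ := dense z
    -- The hexagon on the image of `P`: composing with the comparison of the target turns each σ and
    -- associator into an image from `S`. Binaturality afterwards carries it to arbitrary objects.
    have h : σ (P.obj X ⊗ P.obj Y) (P.obj Z) = (α_ _ _ _).hom ≫ (𝟙 _ ⊗ₘ σ _ _) ≫
        (α_ _ _ _).inv ≫ (σ _ _ ⊗ₘ 𝟙 _) ≫ (α_ _ _ _).hom := by
      have := hμ X Y
      have := hμ Z (X ⊗ Y)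
      rw [← cancel_mono ((𝟙 (P.obj Z) ⊗ₘ μ P X Y) ≫ μ P Z (X ⊗ Y)), reassoc_of% hσ, ← map_σ,
        S.isDistortion.hexagon_left]
      simp only [P.map_comp, Category.assoc]
      rw [reassoc_of% laxMonoidal_assoc P X Y Z, ← μ_natural_assoc, tensorHom_comp_tensorHom_assoc,
        map_σ, P.map_id, Category.comp_id, ← laxMonoidal_assoc P Z X Y, tensorHom_comp_right,
        Category.assoc, reassoc_of% laxMonoidal_assoc_inv P X Z Y, ← μ_natural_assoc,
        tensorHom_comp_tensorHom_assoc, tensorHom_comp_tensorHom_assoc, map_σ,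
        P.map_id, Category.comp_id]
    rw [← cancel_epi ((i.hom ⊗ₘ j.hom) ⊗ₘ k.hom), ← hσ, h, associator_naturality_assoc,
      tensorHom_comp_tensorHom_assoc, ← hσ, Category.comp_id, tensorHom_comp_right]
    simp only [Category.assoc]
    rw [associator_inv_naturality_assoc, tensorHom_comp_tensorHom_assoc, ← hσ, Category.comp_id,
      tensorHom_comp_left]
    simp only [Category.assoc]
    rw [associator_naturality]
  hexagon_right x y z := by
    obtain ⟨X, ⟨i⟩⟩ := dense x
    obtain ⟨Y, ⟨j⟩⟩ := dense y
    obtain ⟨Z, ⟨k⟩⟩ := dense z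
    have h : σ (P.obj X) (P.obj Y ⊗ P.obj Z) = (α_ _ _ _).inv ≫ (σ _ _ ⊗ₘ 𝟙 _) ≫
        (α_ _ _ _).hom ≫ (𝟙 _ ⊗ₘ σ _ _) ≫ (α_ _ _ _).inv := by
      have := hμ Y Z
      have := hμ (Y ⊗ Z) X
      rw [← cancel_mono ((μ P Y Z ⊗ₘ 𝟙 (P.obj X)) ≫ μ P (Y ⊗ Z) X), reassoc_of% hσ, ← map_σ,
        S.isDistortion.hexagon_right]
      simp only [P.map_comp, Category.assoc]
      rw [reassoc_of% laxMonoidal_assoc_inv P X Y Z, ← μ_natural_assoc,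
        tensorHom_comp_tensorHom_assoc, map_σ, P.map_id, Category.comp_id,
        ← laxMonoidal_assoc_inv P Y Z X, tensorHom_comp_left, Category.assoc,
        reassoc_of% laxMonoidal_assoc P Y X Z, ← μ_natural_assoc, tensorHom_comp_tensorHom_assoc,
        tensorHom_comp_tensorHom_assoc, map_σ, P.map_id, Category.comp_id]
    rw [← cancel_epi (i.hom ⊗ₘ (j.hom ⊗ₘ k.hom)), ← hσ, h, associator_inv_naturality_assoc,
      tensorHom_comp_tensorHom_assoc, ← hσ, Category.comp_id, tensorHom_comp_left]
    simp only [Category.assoc]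
    rw [associator_naturality_assoc, tensorHom_comp_tensorHom_assoc, ← hσ, Category.comp_id,
      tensorHom_comp_right]
    simp only [Category.assoc]
    rw [associator_inv_naturality]
  Λ_tensor x y := by
    obtain ⟨X, ⟨i⟩⟩ := dense x
    obtain ⟨Y, ⟨j⟩⟩ := dense y
    have := hμ X Y
    have h₁ : Λ.app (P.obj X ⊗ P.obj Y) = Λ.app (P.obj X) ⊗ₘ Λ.app (P.obj Y) := by
      rw [← cancel_mono (μ P X Y)]
      refine (Λ.naturality (μ P X Y)).symm.trans ?_
      rw [← map_Λ, ← map_Λ, ← map_Λ, S.isDistortion.Λ_tensor]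
      exact (μ_natural P _ _).symm
    have h₂ := Λ.naturality (i.hom ⊗ₘ j.hom)
    have h₃ := Λ.naturality i.hom
    have h₄ := Λ.naturality j.hom
    rw [h₁] at h₂
    dsimp at h₂ h₃ h₄
    rw [← cancel_epi (i.hom ⊗ₘ j.hom), h₂, tensorHom_comp_tensorHom, tensorHom_comp_tensorHom,
      h₃, h₄]

end Distortion

/-! ### The distorted monoidal category underlying a pseudoalgebra -/

section Pasting

variable {C : Type u} [Category.{v} C]

/-- The pasting lemmas use abstract morphisms, so that they apply by unification to equations whose
objects agree only definitionally. -/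
theorem square_comp {x x' y y' z z' : C} {d : x ⟶ x'} {m : x ⟶ y} {m' : x' ⟶ y'} {d₁ : y ⟶ y'}
    {e : y ⟶ z} {e' : y' ⟶ z'} {d₂ : z ⟶ z'} (h : d ≫ m' = m ≫ d₁) (h' : d₁ ≫ e' = e ≫ d₂) :
    d ≫ m' ≫ e' = (m ≫ e) ≫ d₂ := by
  rw [reassoc_of% h, h', Category.assoc]

theorem comp_symm_trans_hom {x₁ x₂ x₃ x₄ x₅ x₆ : C} (e₁ : x₁ ≅ x₂) (e₂ : x₂ ≅ x₃) (e₃ : x₃ ≅ x₄)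
    (e₄ : x₅ ≅ x₄) (e₅ : x₆ ≅ x₅) :
    (e₁ ≪≫ e₂ ≪≫ e₃ ≪≫ e₄.symm ≪≫ e₅.symm).hom ≫ e₅.hom ≫ e₄.hom = e₁.hom ≫ e₂.hom ≫ e₃.hom := by
  simp

theorem naturality_of_conj {x x₁ x₂ x₃ y₁ y₂ x' x₁' x₂' x₃' y₁' y₂' : C} {F : x ⟶ x'}
    {α : x ⟶ y₁} {i : y₁ ⟶ y₂} {c : y₂ ⟶ x₃} {p : x ⟶ x₁} {d : x₁ ⟶ x₂} {t : x₂ ⟶ x₃}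
    {α' : x' ⟶ y₁'} {i' : y₁' ⟶ y₂'} {c' : y₂' ⟶ x₃'} {p' : x' ⟶ x₁'} {d' : x₁' ⟶ x₂'}
    {t' : x₂' ⟶ x₃'} {G : y₁ ⟶ y₁'} {w : y₂ ⟶ y₂'} {q : x₁ ⟶ x₁'} {r : x₂ ⟶ x₂'} {s : x₃ ⟶ x₃'}
    (hi' : IsIso i') (hc' : IsIso c')
    (h : α ≫ i ≫ c = p ≫ d ≫ t) (h' : α' ≫ i' ≫ c' = p' ≫ d' ≫ t')
    (h₁ : F ≫ p' = p ≫ q) (h₂ : q ≫ d' = d ≫ r) (h₃ : r ≫ t' = t ≫ s) (h₄ : G ≫ i' = i ≫ w)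
    (h₅ : w ≫ c' = c ≫ s) : F ≫ α' = α ≫ G := by
  rw [← cancel_mono (i' ≫ c')]
  simp only [Category.assoc]
  rw [h', reassoc_of% h₁, reassoc_of% h₂, h₃, reassoc_of% h₄, h₅, reassoc_of% h]

theorem paste_assoc {x₀ x₁ x₂ x₃ x₄ y₁ y₂ y₃ y₄ z : C} {c₁ : x₀ ⟶ x₁} {p : x₀ ⟶ x₂} {q : x₂ ⟶ x₁}
    {r : x₁ ⟶ x₃} {s : x₂ ⟶ x₄} {m : x₄ ⟶ x₃} {k : x₃ ⟶ z} {α : x₀ ⟶ y₁} {c₂ : y₁ ⟶ y₃}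
    {p' : y₁ ⟶ y₂} {q' : y₂ ⟶ y₃} {r' : y₃ ⟶ z} {s' : y₂ ⟶ y₄} {m' : y₄ ⟶ z} {t : x₄ ⟶ y₄}
    (e₁ : c₁ = p ≫ q) (h₁ : q ≫ r = s ≫ m) (e₂ : c₂ = p' ≫ q') (h₂ : q' ≫ r' = s' ≫ m')
    (h₃ : α ≫ p' ≫ s' = p ≫ s ≫ t) (h₄ : m ≫ k = t ≫ m') : c₁ ≫ r ≫ k = α ≫ c₂ ≫ r' := by
  rw [e₁, e₂, Category.assoc, Category.assoc, reassoc_of% h₁, h₄, h₂, reassoc_of% h₃]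

end Pasting

namespace PseudoAlgebra

variable {A : Type u} [Category.{v} A] (a : PseudoAlgebra A)

theorem unitCmp_nat {x y : A} (f : x ⟶ y) :
    f ≫ (a.unitCmp y).hom = (a.unitCmp x).hom ≫ a.act.map (T.of f) :=
  a.unitIso.hom.naturality f

/-- Naturality of the multiplication comparison at the morphism `[f] ⊗ [g]` of words of words, whose
concatenation is `f ⊗ g` up to equality of words. -/
theorem tensorCmp_nat {X X' Y Y' : T A} (f : X ⟶ X') (g : Y ⟶ Y') :
    a.tensorHom (a.act.map f) (a.act.map g) ≫ (a.tensorCmp X' Y').hom =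
      (a.tensorCmp X Y).hom ≫ a.act.map (T.tensor f g) := by
  have h := a.multIso.hom.naturality (T.tensor (T.of f) (T.of g))
  have h₁ : (T.map a.act ⋙ a.act).map (T.tensor (T.of f) (T.of g)) =
      a.tensorHom (a.act.map f) (a.act.map g) :=
    congrArg a.act.map (T.map_map_tensor_of a.act f g)
  have h₂ : (T.mult A ⋙ a.act).map (T.tensor (T.of f) (T.of g)) ≫ a.actEq (T.join_pair X' Y') =
      a.actEq (T.join_pair X Y) ≫ a.act.map (T.tensor f g) := by
    refine (congrArg (fun k => a.act.map k ≫ a.actEq (T.join_pair X' Y'))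
      (T.mult_map_tensor_of f g)).trans ?_
    refine (a.act.map_comp _ _).symm.trans (Eq.trans ?_ (a.act.map_comp _ _))
    refine congrArg a.act.map ((Category.assoc _ _ _).trans ?_)
    refine congrArg (fun k => _ ≫ k) ((Category.assoc _ _ _).trans ?_)
    rw [eqToHom_trans, eqToHom_refl, Category.comp_id]
  rw [h₁] at h
  refine (Category.assoc _ _ _).symm.trans ((congrArg (fun k => k ≫ _) h).trans ?_)
  refine (Category.assoc _ _ _).trans ((congrArg (fun k => _ ≫ k) h₂).trans ?_)
  exact (Category.assoc _ _ _).symm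

theorem tensorCmp_nat_assoc {X X' Y Y' : T A} (f : X ⟶ X') (g : Y ⟶ Y') {z : A}
    (k : a.act.obj (T.append X' Y') ⟶ z) :
    a.tensorHom (a.act.map f) (a.act.map g) ≫ (a.tensorCmp X' Y').hom ≫ k =
      (a.tensorCmp X Y).hom ≫ a.act.map (T.tensor f g) ≫ k := by
  rw [← Category.assoc, tensorCmp_nat, Category.assoc]

/-- The associator of a pseudoalgebra. -/
abbrev assocIso (x y z : A) :
    a.tensorObj (a.tensorObj x y) z ≅ a.tensorObj x (a.tensorObj y z) :=
  a.monoidalStruct.associator x y z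

/-- The left unitor of a pseudoalgebra. -/
abbrev leftIso (x : A) : a.tensorObj (a.act.obj T.nil) x ≅ x := a.monoidalStruct.leftUnitor x

/-- The right unitor of a pseudoalgebra. -/
abbrev rightIso (x : A) : a.tensorObj x (a.act.obj T.nil) ≅ x := a.monoidalStruct.rightUnitor x

theorem isIso_tensorHom {x x' y y' : A} (f : x ⟶ x') (g : y ⟶ y') [IsIso f] [IsIso g] :
    IsIso (a.tensorHom f g) :=
  (a.tensorIso (asIso f) (asIso g)).isIso_hom

/-- The definition of the associator with its inverse factors moved to the left-hand side; this
characterises it, since those factors are invertible. -/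
theorem assocIso_hom_comp (x y z : A) :
    (a.assocIso x y z).hom ≫ a.tensorHom (a.unitCmp x).hom (𝟙 _) ≫
        (a.tensorCmp (T.single x) (T.append (T.single y) (T.single z))).hom =
      a.tensorHom (𝟙 _) (a.unitCmp z).hom ≫
        (a.tensorCmp (T.append (T.single x) (T.single y)) (T.single z)).hom ≫
          a.actEq (T.append_assoc _ _ _) := by
  exact comp_symm_trans_hom (a.tensorIso (Iso.refl _) (a.unitCmp z))
    (a.tensorCmp (T.append (T.single x) (T.single y)) (T.single z))
    (a.act.mapIso (eqToIso (T.append_assoc _ _ _)))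
    (a.tensorCmp (T.single x) (T.append (T.single y) (T.single z)))
    (a.tensorIso (a.unitCmp x) (Iso.refl _))

theorem leftIso_hom (x : A) : (a.leftIso x).hom = a.tensorHom (𝟙 _) (a.unitCmp x).hom ≫
    (a.tensorCmp T.nil (T.single x)).hom ≫ a.actEq (T.nil_append _) ≫ (a.unitCmp x).inv := rfl

theorem rightIso_hom (x : A) : (a.rightIso x).hom = a.tensorHom (a.unitCmp x).hom (𝟙 _) ≫
    (a.tensorCmp (T.single x) T.nil).hom ≫ a.actEq (T.append_nil _) ≫ (a.unitCmp x).inv := rfl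

theorem map_actEq {X Y X' Y' : T A} (f : X ⟶ Y) (f' : X' ⟶ Y') (hX : X = X') (hY : Y = Y')
    (h : f = eqToHom hX ≫ f' ≫ eqToHom hY.symm) :
    a.act.map f ≫ a.actEq hY = a.actEq hX ≫ a.act.map f' := by
  subst hX hY
  simp [h]

theorem unitCmp_inv_nat {x y : A} (f : x ⟶ y) :
    a.act.map (T.of f) ≫ (a.unitCmp y).inv = (a.unitCmp x).inv ≫ f := by
  rw [Iso.comp_inv_eq, Category.assoc, unitCmp_nat, Iso.inv_hom_id_assoc]

theorem assocIso_nat {x x' y y' z z' : A} (f : x ⟶ x') (g : y ⟶ y') (h : z ⟶ z') :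
    a.tensorHom (a.tensorHom f g) h ≫ (a.assocIso x' y' z').hom =
      (a.assocIso x y z).hom ≫ a.tensorHom f (a.tensorHom g h) := by
  have h₁ : a.tensorHom (a.tensorHom f g) h ≫
        a.tensorHom (𝟙 (a.tensorObj x' y')) (a.unitCmp z').hom =
      a.tensorHom (𝟙 (a.tensorObj x y)) (a.unitCmp z).hom ≫
        a.tensorHom (a.tensorHom f g) (a.act.map (T.of h)) := by
    rw [tensorHom_comp, tensorHom_comp, unitCmp_nat, Category.id_comp, Category.comp_id]
  have h₂ : a.tensorHom f (a.tensorHom g h) ≫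
        a.tensorHom (a.unitCmp x').hom (𝟙 (a.tensorObj y' z')) =
      a.tensorHom (a.unitCmp x).hom (𝟙 (a.tensorObj y z)) ≫
        a.tensorHom (a.act.map (T.of f)) (a.tensorHom g h) := by
    rw [tensorHom_comp, tensorHom_comp, unitCmp_nat, Category.id_comp, Category.comp_id]
  exact naturality_of_conj (a.isIso_tensorHom (a.unitCmp x').hom (𝟙 (a.tensorObj y' z')))
    (a.tensorCmp (T.single x') (T.append (T.single y') (T.single z'))).isIso_hom
    (a.assocIso_hom_comp x y z) (a.assocIso_hom_comp x' y' z') h₁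
    (a.tensorCmp_nat (T.tensor (T.of f) (T.of g)) (T.of h))
    (a.map_actEq _ _ _ _ (T.tensor_assoc (T.of f) (T.of g) (T.of h))) h₂
    (a.tensorCmp_nat (T.of f) (T.tensor (T.of g) (T.of h)))

theorem leftIso_nat {x y : A} (f : x ⟶ y) :
    a.tensorHom (𝟙 _) f ≫ (a.leftIso y).hom = (a.leftIso x).hom ≫ f := by
  have e : a.tensorHom (𝟙 (a.act.obj T.nil)) ((a.unitCmp x).hom ≫ a.act.map (T.of f)) =
      a.tensorHom (𝟙 (a.act.obj T.nil)) (a.unitCmp x).hom ≫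
        a.tensorHom (a.act.map (𝟙 T.nil)) (a.act.map (T.of f)) := by
    rw [tensorHom_comp, a.act.map_id, Category.comp_id]
  have h : T.tensor (𝟙 T.nil) (T.of f) = eqToHom (T.nil_append _) ≫ T.of f ≫
    eqToHom (T.nil_append _).symm := T.unit_tensor' rfl _
  rw [leftIso_hom, leftIso_hom, tensorHom_comp_assoc, Category.comp_id, unitCmp_nat, e,
    Category.assoc, tensorCmp_nat_assoc, ← Category.assoc (a.act.map _) (a.actEq _),
    a.map_actEq _ _ _ _ h]
  simp only [Category.assoc, unitCmp_inv_nat]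

theorem rightIso_nat {x y : A} (f : x ⟶ y) :
    a.tensorHom f (𝟙 _) ≫ (a.rightIso y).hom = (a.rightIso x).hom ≫ f := by
  have e : a.tensorHom ((a.unitCmp x).hom ≫ a.act.map (T.of f)) (𝟙 (a.act.obj T.nil)) =
      a.tensorHom (a.unitCmp x).hom (𝟙 (a.act.obj T.nil)) ≫
        a.tensorHom (a.act.map (T.of f)) (a.act.map (𝟙 T.nil)) := by
    rw [tensorHom_comp, a.act.map_id, Category.comp_id]
  rw [rightIso_hom, rightIso_hom, tensorHom_comp_assoc, Category.comp_id, unitCmp_nat, e,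
    Category.assoc, tensorCmp_nat_assoc, ← Category.assoc (a.act.map _) (a.actEq _),
    a.map_actEq _ _ _ _ (T.tensor_unit (T.of f))]
  simp only [Category.assoc, unitCmp_inv_nat]

/-- Monoidality of multiplication is applied to the splittings `[X, Y] + [Z]` and `[X] + [Y, Z]`.
Both lead to the multiplication comparison at `[X, Y, Z]`, while on the source side they differ by
the comparisons that define the associator. -/
theorem tensorCmp_assoc (X Y Z : T A) :
    a.tensorHom (a.tensorCmp X Y).hom (𝟙 (a.act.obj Z)) ≫ (a.tensorCmp (T.append X Y) Z).hom ≫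
        a.actEq (T.append_assoc X Y Z) =
      (a.assocIso (a.act.obj X) (a.act.obj Y) (a.act.obj Z)).hom ≫
        a.tensorHom (𝟙 (a.act.obj X)) (a.tensorCmp Y Z).hom ≫
          (a.tensorCmp X (T.append Y Z)).hom := by
  have h₁ := a.mul_append (W := T.append (T.single X) (T.single Y)) (W' := T.single Z)
    (V := T.append (T.single (a.act.obj X)) (T.single (a.act.obj Y)))
    (V' := T.single (a.act.obj Z)) rfl rfl (T.join_pair X Y) (T.mult_obj_single Z)
  have h₂ := a.mul_append (W := T.single X) (W' := T.append (T.single Y) (T.single Z))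
    (V := T.single (a.act.obj X)) (V' := T.append (T.single (a.act.obj Y)) (T.single (a.act.obj Z)))
    rfl rfl (T.mult_obj_single X) (T.join_pair Y Z)
  rw [mul_pair, mul_single, Iso.symm_hom] at h₁ h₂
  -- Multiplication at `[Z]` is an inverse unit comparison, so an identity factor is split into a
  -- unit comparison and its inverse to expose it.
  have e₁ : a.tensorHom (a.tensorCmp X Y).hom (𝟙 (a.act.obj Z)) =
      a.tensorHom (𝟙 _) (a.unitCmp (a.act.obj Z)).hom ≫
        a.tensorHom (a.tensorCmp X Y).hom (a.unitCmp (a.act.obj Z)).inv := by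
    rw [tensorHom_comp, Category.id_comp, Iso.hom_inv_id]
  have e₂ : a.tensorHom (𝟙 (a.act.obj X)) (a.tensorCmp Y Z).hom =
      a.tensorHom (a.unitCmp (a.act.obj X)).hom (𝟙 _) ≫
        a.tensorHom (a.unitCmp (a.act.obj X)).inv (a.tensorCmp Y Z).hom := by
    rw [tensorHom_comp, Category.id_comp, Iso.hom_inv_id]
  exact paste_assoc e₁ h₁ e₂ h₂
    (a.assocIso_hom_comp (a.act.obj X) (a.act.obj Y) (a.act.obj Z))
    (a.mul_comp_actEq (T.append_assoc (T.single X) (T.single Y) (T.single Z)) _ _ _ _ _ _)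

/-- Monoidality of multiplication at the empty word and `[X]`: multiplication is trivial at the
first and inverts the unit comparison at the second, leaving the defining composite of the unitor.
-/
theorem tensorCmp_leftUnit (X : T A) :
    (a.tensorCmp T.nil X).hom ≫ a.actEq (T.nil_append X) = (a.leftIso (a.act.obj X)).hom := by
  have h := a.mul_append (W := T.nil) (W' := T.single X) (V := T.nil)
    (V' := T.single (a.act.obj X)) (X := T.nil) rfl rfl rfl (T.mult_obj_single X)
  rw [mul_nil, mul_single, Iso.symm_hom] at h
  have e : (a.tensorCmp T.nil X).hom =
      a.tensorHom (𝟙 _) (a.unitCmp (a.act.obj X)).hom ≫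
        a.tensorHom (𝟙 _) (a.unitCmp (a.act.obj X)).inv ≫ (a.tensorCmp T.nil X).hom := by
    rw [tensorHom_comp_assoc, Category.id_comp, Iso.hom_inv_id, tensorHom_id, Category.id_comp]
  rw [e, leftIso_hom]
  refine (Category.assoc _ _ _).trans (congrArg (fun k => _ ≫ k) ?_)
  refine (congrArg (fun k => k ≫ _) h).trans ((Category.assoc _ _ _).trans ?_)
  refine congrArg (fun k => _ ≫ k) ?_
  have h' : (a.unitCmp (a.act.obj X)).inv = _ := congrArg Iso.hom (a.mul_single X).symm
  exact (a.mul_comp_actEq (T.nil_append (T.single X)) _ _ _ _ _ _).trans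
    (congrArg (fun k => _ ≫ k) h'.symm)

theorem tensorCmp_rightUnit (X : T A) :
    (a.tensorCmp X T.nil).hom ≫ a.actEq (T.append_nil X) = (a.rightIso (a.act.obj X)).hom := by
  have h := a.mul_append (W := T.single X) (W' := T.nil) (V := T.single (a.act.obj X))
    (V' := T.nil) (X' := T.nil) rfl rfl (T.mult_obj_single X) rfl
  rw [mul_nil, mul_single, Iso.symm_hom] at h
  have e : (a.tensorCmp X T.nil).hom =
      a.tensorHom (a.unitCmp (a.act.obj X)).hom (𝟙 _) ≫
        a.tensorHom (a.unitCmp (a.act.obj X)).inv (𝟙 _) ≫ (a.tensorCmp X T.nil).hom := by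
    rw [tensorHom_comp_assoc, Category.id_comp, Iso.hom_inv_id, tensorHom_id, Category.id_comp]
  rw [e, rightIso_hom]
  refine (Category.assoc _ _ _).trans (congrArg (fun k => _ ≫ k) ?_)
  refine (congrArg (fun k => k ≫ _) h).trans ((Category.assoc _ _ _).trans ?_)
  refine congrArg (fun k => _ ≫ k) ?_
  have h' : (a.unitCmp (a.act.obj X)).inv = _ := congrArg Iso.hom (a.mul_single X).symm
  exact (a.mul_comp_actEq (T.append_nil (T.single X)) _ _ _ _ _ _).trans
    (congrArg (fun k => _ ≫ k) h'.symm)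

theorem presentation :
    letI := a.monoidalStruct
    MonoidalPresentation (S := T A) a.act a.tensorCmp (Iso.refl (a.act.obj T.nil)) :=
  letI := a.monoidalStruct
  { whiskerLeft_eq := fun _ _ _ _ => rfl
    whiskerRight_eq := fun _ _ => rfl
    tensor_id := a.tensorHom_id
    tensor_comp := a.tensorHom_comp
    associator_nat := a.assocIso_nat
    leftUnitor_nat := a.leftIso_nat
    rightUnitor_nat := a.rightIso_nat
    nat := a.tensorCmp_nat
    assoc := a.tensorCmp_assoc
    left_unit := fun X => (congrArg (fun k => k ≫ _) (a.tensorHom_id _ _)).trans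
      ((Category.id_comp _).trans (a.tensorCmp_leftUnit X))
    right_unit := fun X => (congrArg (fun k => k ≫ _) (a.tensorHom_id _ _)).trans
      ((Category.id_comp _).trans (a.tensorCmp_rightUnit X))
    dense := fun x => ⟨T.single x, ⟨(a.unitCmp x).symm⟩⟩ }

theorem isMonoidalStruct : IsMonoidalStruct a.monoidalStruct :=
  letI := a.monoidalStruct
  a.presentation.isMonoidalStruct

theorem Λ_app (x : A) :
    a.Λ.app x = (a.unitCmp x).hom ≫ a.act.map (T.dist (T.single x)) ≫ (a.unitCmp x).inv := rfl

/-- Naturality of multiplication at the unit distortion of `[X]`, which both the action on letters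
and concatenation preserve. Since multiplication at `[X]` inverts the unit comparison, this unfolds
to the definition of `Λ` at `aX`. -/
theorem act_map_dist (X : T A) : a.act.map (T.dist X) = a.Λ.app (a.act.obj X) := by
  have h := a.multIso.hom.naturality (T.dist (T.single X))
  have h₁ : (T.map a.act).map (T.dist (T.single X)) = T.dist (T.single (a.act.obj X)) :=
    (T.map_isStrict a.act).map_dist _
  have h₂ : (T.mult A).map (T.dist (T.single X)) = T.dist ((T.mult A).obj (T.single X)) :=
    T.mult_isStrict.map_dist _
  have h₃ : a.act.map (T.dist (T.single (a.act.obj X))) ≫ (a.multApp (T.single X)).hom =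
      (a.multApp (T.single X)).hom ≫ a.act.map (T.dist ((T.mult A).obj (T.single X))) :=
    (congrArg (fun k => a.act.map k ≫ (a.multApp (T.single X)).hom) h₁).symm.trans
      (h.trans (congrArg (fun k => (a.multApp (T.single X)).hom ≫ a.act.map k) h₂))
  have h₄ : (a.unitCmp (a.act.obj X)).inv =
      (a.multApp (T.single X)).hom ≫ a.actEq (T.mult_obj_single X) :=
    (congrArg Iso.hom (a.mul_single X).symm).trans
      ((congrArg (fun k => k ≫ _) (a.act.map_id _)).trans (Category.id_comp _))
  have h₅ : a.act.map (T.dist (T.single (a.act.obj X))) ≫ (a.unitCmp (a.act.obj X)).inv =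
      (a.unitCmp (a.act.obj X)).inv ≫ a.act.map (T.dist X) := by
    rw [h₄]
    exact square_comp h₃ (a.map_actEq _ _ _ _ (T.dist_eqToHom (T.mult_obj_single X)))
  rw [Λ_app, h₅, Iso.hom_inv_id_assoc]

/-- Naturality of the multiplication comparison at the swap of the one-letter words `[X]` and `[Y]`.
-/
theorem tensorCmp_swap (X Y : T A) :
    (a.tensorCmp X Y).hom ≫ a.act.map (T.swap X Y) =
      a.σ (a.act.obj X) (a.act.obj Y) ≫ (a.tensorCmp Y X).hom := by
  have h := a.multIso.hom.naturality (T.swap (T.single X) (T.single Y))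
  have h₁ : (T.map a.act ⋙ a.act).map (T.swap (T.single X) (T.single Y)) =
      a.σ (a.act.obj X) (a.act.obj Y) :=
    congrArg a.act.map (T.map_map_swap_single a.act X Y)
  have h₂ : (T.mult A ⋙ a.act).map (T.swap (T.single X) (T.single Y)) ≫
      a.actEq (T.join_pair Y X) = a.actEq (T.join_pair X Y) ≫ a.act.map (T.swap X Y) :=
    a.map_actEq _ _ _ _ (T.mult_map_swap_single X Y)
  rw [h₁] at h
  refine Eq.symm ?_
  refine (Category.assoc _ _ _).symm.trans ((congrArg (fun k => k ≫ _) h).trans ?_)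
  refine (Category.assoc _ _ _).trans ((congrArg (fun k => _ ≫ k) h₂).trans ?_)
  exact (Category.assoc _ _ _).symm

theorem σ_nat {x x' y y' : A} (f : x ⟶ x') (g : y ⟶ y') :
    a.σ x y ≫ a.tensorHom g f = a.tensorHom f g ≫ a.σ x' y' :=
  (a.act.map_comp _ _).symm.trans
    ((congrArg a.act.map (T.swap_natural (T.of f) (T.of g))).trans (a.act.map_comp _ _))

/-- The action of a pseudoalgebra as a lax monoidal functor. -/
@[reducible]
def actLaxMonoidal : letI := monoidalOfStruct a.monoidalStruct a.isMonoidalStruct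
    (a.act : (T.distMon A).carrier ⥤ A).LaxMonoidal :=
  letI := monoidalOfStruct a.monoidalStruct a.isMonoidalStruct
  { ε := 𝟙 (a.act.obj T.nil)
    μ := fun X Y => (a.tensorCmp X Y).hom
    μ_natural_left := fun f X' =>
      (congrArg (fun k => a.tensorHom _ k ≫ _) (a.act.map_id X').symm).trans
        (a.tensorCmp_nat f (𝟙 X'))
    μ_natural_right := fun X' f =>
      (congrArg (fun k => a.tensorHom k _ ≫ _) (a.act.map_id X').symm).trans
        (a.tensorCmp_nat (𝟙 X') f)
    associativity := a.tensorCmp_assoc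
    left_unitality := fun X => ((congrArg (fun k => k ≫ _) (a.tensorHom_id _ _)).trans
      ((Category.id_comp _).trans (a.tensorCmp_leftUnit X))).symm
    right_unitality := fun X => ((congrArg (fun k => k ≫ _) (a.tensorHom_id _ _)).trans
      ((Category.id_comp _).trans (a.tensorCmp_rightUnit X))).symm }

theorem isDistortion :
    @IsDistortion A _ (monoidalOfStruct a.monoidalStruct a.isMonoidalStruct) a.Λ a.σ :=
  letI := monoidalOfStruct a.monoidalStruct a.isMonoidalStruct
  letI := a.actLaxMonoidal
  isDistortion_of_dense (S := T.distMon A) a.act (fun X Y => (a.tensorCmp X Y).isIso_hom)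
    (inferInstanceAs (IsIso (𝟙 (a.act.obj T.nil)))) a.Λ a.σ a.σ_nat a.act_map_dist
    a.tensorCmp_swap fun x => ⟨T.single x, ⟨(a.unitCmp x).symm⟩⟩

end PseudoAlgebra

/-! ### The action as a strong σ-lax functor -/

namespace PsAlg

theorem isDistorted (A : PsAlg.{v, u}) : A.IsDistorted :=
  ⟨A.str.isMonoidalStruct, A.str.isDistortion⟩

/-- The distorted monoidal category underlying a pseudoalgebra. -/
abbrev distMon (A : PsAlg.{v, u}) : DistMon.{v, u} := A.toDistMon A.isDistorted

/-- The action of a pseudoalgebra as a `σ`-lax monoidal functor. -/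
def actLax (A : PsAlg.{v, u}) : SigmaLax (T.distMon A.carrier) A.distMon where
  functor := A.str.act
  lax := A.str.actLaxMonoidal
  map_Λ := A.str.act_map_dist
  map_σ := A.str.tensorCmp_swap

theorem actLax_isStrong (A : PsAlg.{v, u}) : A.actLax.IsStrong where
  isIso_μ X Y := (A.str.tensorCmp X Y).isIso_hom
  isIso_μ₀ := inferInstanceAs (IsIso (𝟙 (A.str.act.obj T.nil)))

end PsAlg

/-! ### Lax monoidal functors presented by a strong monoidal functor -/

/-- The data of a lax monoidal functor `F`, presented by a transformation from `Q` to `P ⋙ F`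
compatible with the laxators, for a strong functor `P` which is surjective on objects up to
isomorphism. -/
structure LaxPresentation {S : DistMon.{v₁, u₁}} {A : DistMon.{v₂, u₂}} {B : DistMon.{v₃, u₃}}
    (P : SigmaLax S A) (Q : SigmaLax S B) (F : A.carrier ⥤ B.carrier)
    (μ : ∀ x y : A.carrier, F.obj x ⊗ F.obj y ⟶ F.obj (x ⊗ y))
    (μ₀ : 𝟙_ B.carrier ⟶ F.obj (𝟙_ A.carrier))
    (l : ∀ X : S.carrier, Q.functor.obj X ⟶ F.obj (P.functor.obj X)) : Prop where
  isIso_μ (X Y : S.carrier) : IsIso (P.μ X Y)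
  μ_nat {x x' y y' : A.carrier} (f : x ⟶ x') (g : y ⟶ y') :
    (F.map f ⊗ₘ F.map g) ≫ μ x' y' = μ x y ≫ F.map (f ⊗ₘ g)
  l_nat {X Y : S.carrier} (f : X ⟶ Y) :
    Q.functor.map f ≫ l Y = l X ≫ F.map (P.functor.map f)
  comp_μ (X Y : S.carrier) :
    Q.μ X Y ≫ l (X ⊗ Y) =
      (l X ⊗ₘ l Y) ≫ μ (P.functor.obj X) (P.functor.obj Y) ≫ F.map (P.μ X Y)
  comp_μ₀ : Q.μ₀ ≫ l (𝟙_ S.carrier) = μ₀ ≫ F.map P.μ₀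
  dense (x : A.carrier) : ∃ X : S.carrier, Nonempty (P.functor.obj X ≅ x) ∧ IsIso (l X)

namespace LaxPresentation

variable {S : DistMon.{v₁, u₁}} {A : DistMon.{v₂, u₂}} {B : DistMon.{v₃, u₃}}
  {P : SigmaLax S A} {Q : SigmaLax S B} {F : A.carrier ⥤ B.carrier}
  {μ : ∀ x y : A.carrier, F.obj x ⊗ F.obj y ⟶ F.obj (x ⊗ y)}
  {μ₀ : 𝟙_ B.carrier ⟶ F.obj (𝟙_ A.carrier)}
  {l : ∀ X : S.carrier, Q.functor.obj X ⟶ F.obj (P.functor.obj X)}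
  (p : LaxPresentation P Q F μ μ₀ l)

include p

theorem μ_nat_assoc {x x' y y' : A.carrier} (f : x ⟶ x') (g : y ⟶ y') {z : B.carrier}
    (k : F.obj (x' ⊗ y') ⟶ z) :
    (F.map f ⊗ₘ F.map g) ≫ μ x' y' ≫ k = μ x y ≫ F.map (f ⊗ₘ g) ≫ k := by
  rw [← Category.assoc, p.μ_nat, Category.assoc]

/-- The pattern for every axiom in this section: at `x = P X` the invertible `l X` compares `F` with
`Q`, for which the axiom holds, and naturality along `P X ≅ x` gives the rest. -/
theorem map_Λ (x : A.carrier) : F.map (A.Λ.app x) = B.Λ.app (F.obj x) := by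
  obtain ⟨X, ⟨i⟩, _⟩ := p.dense x
  have h : F.map (A.Λ.app (P.functor.obj X)) = B.Λ.app (F.obj (P.functor.obj X)) := by
    rw [← cancel_epi (l X), ← P.map_Λ, ← p.l_nat, Q.map_Λ]
    exact (B.Λ.naturality (l X)).symm
  have h₁ := A.Λ.naturality i.hom
  have h₂ := B.Λ.naturality (F.map i.hom)
  dsimp at h₁ h₂
  rw [← cancel_epi (F.map i.hom), ← F.map_comp, h₁, h₂, F.map_comp, h]

theorem map_σ (x y : A.carrier) :
    μ x y ≫ F.map (A.σ x y) = B.σ (F.obj x) (F.obj y) ≫ μ y x := by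
  obtain ⟨X, ⟨i⟩, _⟩ := p.dense x
  obtain ⟨Y, ⟨j⟩, _⟩ := p.dense y
  have := p.isIso_μ Y X
  have h : μ (P.functor.obj X) (P.functor.obj Y) ≫ F.map (A.σ _ _) = B.σ _ _ ≫ μ _ _ := by
    have h₁ := P.map_σ X Y
    have h₂ := Q.map_σ X Y
    change P.μ X Y ≫ _ = _ ≫ P.μ Y X at h₁
    change Q.μ X Y ≫ _ = _ ≫ Q.μ Y X at h₂
    rw [← cancel_epi (l X ⊗ₘ l Y), ← cancel_mono (F.map (P.μ Y X))]
    simp only [Category.assoc]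
    rw [← F.map_comp, ← h₁, F.map_comp, ← reassoc_of% p.comp_μ X Y, ← p.l_nat, reassoc_of% h₂,
      p.comp_μ, ← reassoc_of% B.isDistortion.binatural]
  rw [← cancel_epi (F.map i.hom ⊗ₘ F.map j.hom), p.μ_nat_assoc, ← F.map_comp,
    ← A.isDistortion.binatural, F.map_comp, reassoc_of% h, ← p.μ_nat,
    ← reassoc_of% B.isDistortion.binatural]

theorem associativity (x y z : A.carrier) :
    (μ x y ⊗ₘ 𝟙 (F.obj z)) ≫ μ (x ⊗ y) z ≫ F.map (α_ x y z).hom =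
      (α_ _ _ _).hom ≫ (𝟙 (F.obj x) ⊗ₘ μ y z) ≫ μ x (y ⊗ z) := by
  obtain ⟨X, ⟨i⟩, _⟩ := p.dense x
  obtain ⟨Y, ⟨j⟩, _⟩ := p.dense y
  obtain ⟨Z, ⟨k⟩, _⟩ := p.dense z
  have h : (μ (P.functor.obj X) (P.functor.obj Y) ⊗ₘ 𝟙 (F.obj (P.functor.obj Z))) ≫
      μ _ _ ≫ F.map (α_ _ _ _).hom = (α_ _ _ _).hom ≫ (𝟙 _ ⊗ₘ μ _ _) ≫ μ _ _ := by
    have := p.isIso_μ Y Z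
    have := p.isIso_μ X (Y ⊗ Z)
    -- Surrounded by the components of `l` and the laxators of `P`, both sides become the
    -- associativity law of `Q`, followed by `l` at the triple product.
    rw [← cancel_epi ((l X ⊗ₘ l Y) ⊗ₘ l Z),
      ← cancel_mono (F.map ((𝟙 (P.functor.obj X) ⊗ₘ P.μ Y Z) ≫ P.μ X (Y ⊗ Z)))]
    simp only [Category.assoc]
    rw [← F.map_comp, ← P.μ_assoc, F.map_comp, ← p.μ_nat_assoc, F.map_id, F.map_comp,
      tensorHom_comp_tensorHom_assoc, tensorHom_comp_tensorHom_assoc, Category.comp_id,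
      Category.comp_id, Category.assoc, ← p.comp_μ]
    rw [show (Q.μ X Y ≫ l (X ⊗ Y)) ⊗ₘ l Z = (Q.μ X Y ⊗ₘ 𝟙 _) ≫ (l (X ⊗ Y) ⊗ₘ l Z) by
        rw [tensorHom_comp_tensorHom, Category.id_comp], Category.assoc,
      ← reassoc_of% p.comp_μ, ← p.l_nat, reassoc_of% Q.μ_assoc, p.comp_μ,
      tensorHom_comp_tensorHom_assoc, Category.id_comp, p.comp_μ, associator_naturality_assoc,
      F.map_comp, ← p.μ_nat_assoc, tensorHom_comp_tensorHom_assoc, tensorHom_comp_tensorHom_assoc,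
      F.map_id, Category.comp_id, Category.comp_id, Category.assoc]
  rw [← cancel_epi ((F.map i.hom ⊗ₘ F.map j.hom) ⊗ₘ F.map k.hom), tensorHom_comp_tensorHom_assoc,
    p.μ_nat, Category.comp_id,
    show (μ _ _ ≫ F.map (i.hom ⊗ₘ j.hom)) ⊗ₘ F.map k.hom =
      (μ _ _ ⊗ₘ 𝟙 _) ≫ (F.map (i.hom ⊗ₘ j.hom) ⊗ₘ F.map k.hom) by
        rw [tensorHom_comp_tensorHom, Category.id_comp], Category.assoc, p.μ_nat_assoc,
    ← F.map_comp, associator_naturality, F.map_comp, reassoc_of% h, ← p.μ_nat,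
    associator_naturality_assoc, tensorHom_comp_tensorHom_assoc, tensorHom_comp_tensorHom_assoc,
    p.μ_nat, Category.comp_id, Category.id_comp]

theorem left_unitality (x : A.carrier) :
    (λ_ (F.obj x)).hom = (μ₀ ⊗ₘ 𝟙 (F.obj x)) ≫ μ (𝟙_ A.carrier) x ≫ F.map (λ_ x).hom := by
  obtain ⟨X, ⟨i⟩, _⟩ := p.dense x
  have h : (λ_ (F.obj (P.functor.obj X))).hom =
      (μ₀ ⊗ₘ 𝟙 _) ≫ μ (𝟙_ A.carrier) _ ≫ F.map (λ_ _).hom := by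
    rw [← cancel_epi (𝟙 (𝟙_ B.carrier) ⊗ₘ l X), id_tensorHom, leftUnitor_naturality,
      ← id_tensorHom, tensorHom_comp_tensorHom_assoc, Category.id_comp, Category.comp_id,
      ← P.μ_leftUnit, F.map_comp, F.map_comp, ← p.μ_nat_assoc, F.map_id,
      tensorHom_comp_tensorHom_assoc, Category.comp_id, ← p.comp_μ₀,
      show (Q.μ₀ ≫ l (𝟙_ S.carrier)) ⊗ₘ l X = (Q.μ₀ ⊗ₘ 𝟙 _) ≫ (l (𝟙_ S.carrier) ⊗ₘ l X) by
        rw [tensorHom_comp_tensorHom, Category.id_comp], Category.assoc,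
      ← reassoc_of% p.comp_μ, ← p.l_nat, reassoc_of% Q.μ_leftUnit]
  rw [← cancel_epi (𝟙 (𝟙_ B.carrier) ⊗ₘ F.map i.hom), tensorHom_comp_tensorHom_assoc,
    Category.id_comp, Category.comp_id, id_tensorHom, leftUnitor_naturality, h,
    show μ₀ ⊗ₘ F.map i.hom = (μ₀ ⊗ₘ 𝟙 _) ≫ (F.map (𝟙 (𝟙_ A.carrier)) ⊗ₘ F.map i.hom) by
        rw [tensorHom_comp_tensorHom, Category.id_comp, F.map_id, Category.comp_id],
    Category.assoc, Category.assoc, Category.assoc, p.μ_nat_assoc, ← F.map_comp, ← F.map_comp,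
    id_tensorHom _ i.hom, leftUnitor_naturality]

theorem right_unitality (x : A.carrier) :
    (ρ_ (F.obj x)).hom = (𝟙 (F.obj x) ⊗ₘ μ₀) ≫ μ x (𝟙_ A.carrier) ≫ F.map (ρ_ x).hom := by
  obtain ⟨X, ⟨i⟩, _⟩ := p.dense x
  have h : (ρ_ (F.obj (P.functor.obj X))).hom =
      (𝟙 _ ⊗ₘ μ₀) ≫ μ _ (𝟙_ A.carrier) ≫ F.map (ρ_ _).hom := by
    rw [← cancel_epi (l X ⊗ₘ 𝟙 (𝟙_ B.carrier)), tensorHom_id, rightUnitor_naturality,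
      ← tensorHom_id, tensorHom_comp_tensorHom_assoc, Category.id_comp, Category.comp_id,
      ← P.μ_rightUnit, F.map_comp, F.map_comp, ← p.μ_nat_assoc, F.map_id,
      tensorHom_comp_tensorHom_assoc, Category.comp_id, ← p.comp_μ₀,
      show l X ⊗ₘ (Q.μ₀ ≫ l (𝟙_ S.carrier)) = (𝟙 _ ⊗ₘ Q.μ₀) ≫ (l X ⊗ₘ l (𝟙_ S.carrier)) by
        rw [tensorHom_comp_tensorHom, Category.id_comp], Category.assoc,
      ← reassoc_of% p.comp_μ, ← p.l_nat, reassoc_of% Q.μ_rightUnit]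
  rw [← cancel_epi (F.map i.hom ⊗ₘ 𝟙 (𝟙_ B.carrier)), tensorHom_comp_tensorHom_assoc,
    Category.id_comp, Category.comp_id, tensorHom_id, rightUnitor_naturality, h,
    show F.map i.hom ⊗ₘ μ₀ = (𝟙 _ ⊗ₘ μ₀) ≫ (F.map i.hom ⊗ₘ F.map (𝟙 (𝟙_ A.carrier))) by
        rw [tensorHom_comp_tensorHom, Category.id_comp, F.map_id, Category.comp_id],
    Category.assoc, Category.assoc, Category.assoc, p.μ_nat_assoc, ← F.map_comp, ← F.map_comp,
    tensorHom_id i.hom, rightUnitor_naturality]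

theorem isSigmaLax : IsSigmaLax F μ μ₀ where
  lax := ⟨.ofTensorHom μ₀ μ p.μ_nat p.associativity p.left_unitality p.right_unitality, rfl, rfl⟩
  map_Λ := p.map_Λ
  map_σ := p.map_σ

end LaxPresentation

/-! ### Lax morphisms as lax monoidal functors -/

theorem comp_comp_comp_assoc {C : Type u} [Category.{v} C] {x y z w t : C} (f : x ⟶ y) (g : y ⟶ z)
    (h : z ⟶ w) (k : w ⟶ t) : f ≫ g ≫ h ≫ k = (f ≫ g ≫ h) ≫ k := by
  simp only [Category.assoc]

theorem PsAlg.app_actEq {A : PsAlg.{v₁, u₁}} {B : PsAlg.{v₂, u₂}} {F : A.carrier ⥤ B.carrier}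
    (θ : T.map F ⋙ B.str.act ⟶ A.str.act ⋙ F) {X Y : T A.carrier} (h : X = Y)
    (h' : (T.map F).obj X = (T.map F).obj Y) :
    θ.app X ≫ F.map (A.str.actEq h) = B.str.actEq h' ≫ θ.app Y := by
  subst h; simp

namespace LaxMor

variable {A : PsAlg.{v₁, u₁}} {B : PsAlg.{v₂, u₂}} (F : LaxMor A B)

theorem μ_nat {x x' y y' : A.carrier} (f : x ⟶ x') (g : y ⟶ y') :
    B.str.tensorHom (F.functor.map f) (F.functor.map g) ≫ F.μ x' y' =
      F.μ x y ≫ F.functor.map (A.str.tensorHom f g) :=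
  (congrArg (fun k => B.str.act.map k ≫ F.μ x' y') (T.map_map_tensor_of F.functor f g)).symm.trans
    (F.lax.naturality (T.tensor (T.of f) (T.of g)))

/-- The multiplication law of the lax morphism at the word `[X, Y]` of words; it says that the
comparison of `F` is a monoidal transformation. -/
theorem tensorCmp_lax (X Y : T A.carrier) :
    ((B.str.tensorCmp ((T.map F.functor).obj X) ((T.map F.functor).obj Y)).hom ≫
        B.str.actEq ((T.map_isStrict F.functor).obj_append X Y).symm) ≫
          F.lax.app (T.append X Y) =
      B.str.tensorHom (F.lax.app X) (F.lax.app Y) ≫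
        F.μ (A.str.act.obj X) (A.str.act.obj Y) ≫ F.functor.map (A.str.tensorCmp X Y).hom := by
  have h := F.mult (T.append (T.single X) (T.single Y))
  have h₁ : B.str.act.map (eqToHom (T.map_obj_comp (T.map F.functor) B.str.act
      (T.append (T.single X) (T.single Y))).symm ≫
        (T.map₂ F.lax).app (T.append (T.single X) (T.single Y)) ≫
          eqToHom (T.map_obj_comp A.str.act F.functor (T.append (T.single X) (T.single Y)))) =
      B.str.tensorHom (F.lax.app X) (F.lax.app Y) :=
    congrArg B.str.act.map ((Category.id_comp _).trans
      ((Category.comp_id _).trans (T.map₂_pair F.lax X Y)))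
  have h₂ := PsAlg.app_actEq F.lax (T.join_pair X Y) (congrArg _ (T.join_pair X Y))
  have h₃ : F.functor.map (A.str.tensorCmp X Y).hom =
      F.functor.map (A.str.multIso.hom.app (T.append (T.single X) (T.single Y))) ≫
        F.functor.map (A.str.actEq (T.join_pair X Y)) := F.functor.map_comp _ _
  refine Eq.symm ((congrArg (fun k => _ ≫ _ ≫ k) h₃).trans ?_)
  refine Eq.trans (b := (B.str.act.map _ ≫ _ ≫ _) ≫
    F.functor.map (A.str.actEq (T.join_pair X Y))) ?_
    ((congrArg (fun k => k ≫ F.functor.map (A.str.actEq (T.join_pair X Y))) h.symm).trans ?_)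
  · exact (congrArg (fun k => k ≫ _) h₁.symm).trans (comp_comp_comp_assoc _ _ _ _)
  · refine (Category.assoc _ _ _).trans (Eq.trans ?_ (Category.assoc _ _ _).symm)
    refine Eq.trans ?_ (Category.assoc _ _ _).symm
    refine congrArg (fun k => _ ≫ k) ((Category.assoc _ _ _).trans ?_)
    refine (congrArg (fun k => _ ≫ k) h₂).trans ?_
    refine (B.str.actEq_trans_assoc _ _ _).trans ?_
    exact (B.str.actEq_trans_assoc (T.join_pair ((T.map F.functor).obj X) _) _ _).symm

/-- The unit law writes the image of an isomorphism as an isomorphism followed by this component.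
This holds although `F` is only lax. -/
theorem isIso_lax_single (x : A.carrier) : IsIso (F.lax.app (T.single x)) :=
  @IsIso.of_isIso_fac_left _ _ _ _ _ (B.str.unitCmp (F.functor.obj x)).hom
    (F.lax.app (T.single x)) _ (B.str.unitCmp (F.functor.obj x)).isIso_hom
    (inferInstanceAs (IsIso (F.functor.map (A.str.unitCmp x).hom))) (F.unit x)

theorem lax_nil : B.actLax.μ₀ ≫ B.str.actEq (T.map_isStrict F.functor).obj_nil.symm ≫
    F.lax.app T.nil = F.μ₀ ≫ F.functor.map A.actLax.μ₀ := by
  refine (Category.id_comp _).trans ((congrArg (fun k => k ≫ _) (B.str.act.map_id _)).trans ?_)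
  refine (Category.id_comp _).trans (Eq.symm ?_)
  exact (congrArg (fun k => _ ≫ k) (F.functor.map_id _)).trans (Category.comp_id _)

/-- The comparison of `F` plays the role of `l`; density is witnessed by one-letter words, where it
is invertible. -/
theorem laxPresentation :
    LaxPresentation (A := A.distMon) (B := B.distMon) A.actLax
      (SigmaLax.comp (T.mapLax F.functor) B.actLax) F.functor F.μ F.μ₀ F.lax.app where
  isIso_μ := A.actLax_isStrong.isIso_μ
  μ_nat := F.μ_nat
  l_nat f := F.lax.naturality f
  comp_μ := F.tensorCmp_lax
  comp_μ₀ := (Category.assoc _ _ _).trans F.lax_nil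
  dense x := ⟨T.single x, ⟨(A.str.unitCmp x).symm⟩, F.isIso_lax_single x⟩

theorem isSigmaLax :
    IsSigmaLax (A := A.distMon) (B := B.distMon) F.functor F.μ F.μ₀ :=
  F.laxPresentation.isSigmaLax

/-- The `σ`-lax monoidal functor underlying a lax morphism. -/
def sigmaLax : SigmaLax A.distMon B.distMon := F.isSigmaLax.toSigmaLax

/-- The comparison of a lax morphism as a monoidal transformation. -/
def laxHom : SigmaLax.comp (T.mapLax F.functor) B.actLax ⟶ SigmaLax.comp A.actLax F.sigmaLax :=
  SigmaLax.homMk F.lax ((Category.assoc _ _ _).trans F.lax_nil) fun X Y => F.tensorCmp_lax X Y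

variable {F} {G : LaxMor A B}

theorem hom_μ₀ (θ : F ⟶ G) : F.μ₀ ≫ θ.nat.app (A.str.act.obj T.nil) = G.μ₀ :=
  (θ.comm T.nil).trans ((congrArg (fun k => k ≫ _) (B.str.act.map_id _)).trans
    (Category.id_comp _))

/-- The compatibility of a transformation with comparisons, read at the word `[x, y]`. -/
theorem hom_μ (θ : F ⟶ G) (x y : A.carrier) :
    F.μ x y ≫ θ.nat.app (A.str.tensorObj x y) =
      B.str.tensorHom (θ.nat.app x) (θ.nat.app y) ≫ G.μ x y :=
  (θ.comm (T.append (T.single x) (T.single y))).trans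
    (congrArg (fun k => B.str.act.map k ≫ G.μ x y) (T.map₂_pair θ.nat x y))

/-- The monoidal transformation underlying a transformation of lax morphisms. -/
def sigmaHom (θ : F ⟶ G) : F.sigmaLax ⟶ G.sigmaLax :=
  SigmaLax.homMk θ.nat (hom_μ₀ θ) (hom_μ θ)

end LaxMor

theorem hasUnderlying : HasUnderlying.{v, u} where
  obj A := A.isDistorted
  map F := LaxMor.isSigmaLax F
  map₂ θ := (LaxMor.sigmaHom θ).isMonoidal

/-! ### Lax monoidal functors as lax morphisms -/

namespace PseudoAlgebra

variable {A : Type u} [Category.{v} A] (a : PseudoAlgebra A)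

theorem multApp_single (X : T A) :
    (a.multApp (T.single X)).hom =
      (a.unitCmp (a.act.obj X)).inv ≫ a.actEq (T.mult_obj_single X).symm := by
  have h : (a.unitCmp (a.act.obj X)).inv =
      (a.multApp (T.single X)).hom ≫ a.actEq (T.mult_obj_single X) :=
    (congrArg Iso.hom (a.mul_single X).symm).trans
      ((congrArg (fun k => k ≫ _) (a.act.map_id _)).trans (Category.id_comp _))
  rw [h]
  refine Eq.symm ((Category.assoc _ _ _).trans ?_)
  rw [actEq_trans, actEq_refl]
  exact Category.comp_id _

/-- The right unit law of the pseudoalgebra at the word `[x, y]`. -/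
theorem tensorHom_unitCmp_tensorCmp (x y : A) :
    a.tensorHom (a.unitCmp x).hom (a.unitCmp y).hom ≫
      (a.tensorCmp (T.single x) (T.single y)).hom = 𝟙 (a.tensorObj x y) := by
  have h := a.unit_right (T.append (T.single x) (T.single y))
  have h₁ : a.act.map (eqToHom (T.map_obj_id (T.append (T.single x) (T.single y))).symm ≫
      (T.map₂ a.unitIso.hom).app (T.append (T.single x) (T.single y)) ≫
        eqToHom (T.map_obj_comp (T.unit A) a.act (T.append (T.single x) (T.single y)))) =
      a.tensorHom (a.unitCmp x).hom (a.unitCmp y).hom :=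
    congrArg a.act.map ((Category.id_comp _).trans
      ((Category.comp_id _).trans (T.map₂_pair a.unitIso.hom x y)))
  refine (Category.assoc _ _ _).symm.trans ?_
  refine (congrArg (fun k => k ≫ _) ((congrArg (fun k => k ≫ _) h₁).symm.trans h)).trans ?_
  have e := T.mult_obj_map_unit (T.append (T.single x) (T.single y))
  exact (a.actEq_trans e.symm e).trans (a.actEq_refl rfl)

theorem tensorCmp_single (x y : A) :
    (a.tensorCmp (T.single x) (T.single y)).hom =
      a.tensorHom (a.unitCmp x).inv (a.unitCmp y).inv := by
  have := a.isIso_tensorHom (a.unitCmp x).hom (a.unitCmp y).hom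
  refine (cancel_epi (a.tensorHom (a.unitCmp x).hom (a.unitCmp y).hom)).1
    ((a.tensorHom_unitCmp_tensorCmp x y).trans ?_)
  refine Eq.symm ((a.tensorHom_comp _ _ _ _).trans ?_)
  rw [Iso.hom_inv_id, Iso.hom_inv_id, tensorHom_id]

theorem multApp_nil : (a.multApp T.nil).hom = 𝟙 (a.act.obj T.nil) :=
  ((congrArg (fun k => k ≫ _) (a.act.map_id _)).trans ((Category.id_comp _).trans
    ((congrArg (fun k => _ ≫ k) (a.act.map_id _)).trans (Category.comp_id _)))).symm.trans
      (congrArg Iso.hom a.mul_nil)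

end PseudoAlgebra

/-- The multiplication comparison of a pseudoalgebra as a monoidal transformation. -/
def PsAlg.multHom (A : PsAlg.{v, u}) :
    SigmaLax.comp (T.mapLax A.str.act) A.actLax ⟶ SigmaLax.comp (T.multLax A.carrier) A.actLax :=
  SigmaLax.homMk A.str.multIso.hom
    ((congrArg (fun k => _ ≫ k) A.str.multApp_nil).trans (Category.comp_id _)) fun W W' => by
    have e := T.mult_isStrict.obj_append W W'
    refine (Category.assoc _ _ _).trans (Eq.trans ?_
      ((congrArg (fun k => k ≫ _) (A.str.multApp_append W W').symm).trans (Category.assoc _ _ _)))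
    refine Eq.trans ?_ (Category.assoc _ _ _).symm
    refine congrArg (fun k => _ ≫ k) ?_
    refine Eq.trans ?_ (comp_comp_comp_assoc _ _ _ _)
    refine congrArg (fun k => _ ≫ k) ?_
    refine (Category.comp_id _).symm.trans (congrArg (fun k => _ ≫ k) ?_)
    exact ((A.str.actEq_trans e e.symm).trans (A.str.actEq_refl rfl)).symm

namespace LaxMor

variable {A : PsAlg.{v₁, u₁}} {B : PsAlg.{v₂, u₂}}

theorem lax_single (F : LaxMor A B) (x : A.carrier) :
    F.lax.app (T.single x) =
      (B.str.unitCmp (F.functor.obj x)).inv ≫ F.functor.map (A.str.unitCmp x).hom :=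
  (Iso.eq_inv_comp (B.str.unitCmp (F.functor.obj x))).2 (F.unit x)

theorem mapLax_actLax_isStrong (F : A.carrier ⥤ B.carrier) :
    (SigmaLax.comp (T.mapLax F) B.actLax).IsStrong :=
  (T.mapLax_isStrong F).comp B.actLax_isStrong

/-- A lax morphism is determined by its underlying `σ`-lax monoidal functor. -/
theorem sigmaLax_injective : Function.Injective (sigmaLax (A := A) (B := B)) := by
  intro F G h
  have e : F.functor = G.functor := congrArg SigmaLax.functor h
  obtain ⟨F, l, hl, hl'⟩ := F
  obtain ⟨G, l', hk, hk'⟩ := G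
  obtain rfl : F = G := e
  -- The hypothesis identifies the targets of the two comparisons as σ-lax functors. Both are then
  -- monoidal transformations, with one-letter components dictated by the unit law.
  have k : laxHom ⟨F, l, hl, hl'⟩ ≫ eqToHom (congrArg (fun H => SigmaLax.comp A.actLax H) h) =
      laxHom ⟨F, l', hk, hk'⟩ := by
    refine SigmaLax.hom_ext_single (mapLax_actLax_isStrong F) fun x => ?_
    rw [SigmaLax.comp_app, SigmaLax.eqToHom_nat]
    exact (Category.comp_id _).trans ((lax_single ⟨F, l, hl, hl'⟩ x).trans
      (lax_single ⟨F, l', hk, hk'⟩ x).symm)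
  refine ext_of_app rfl fun X => ?_
  have k' := SigmaLax.app_congr k X
  rw [SigmaLax.comp_app, SigmaLax.eqToHom_nat] at k'
  exact ((Category.comp_id _).symm.trans k').trans
    ((Category.id_comp _).trans (Category.comp_id _)).symm

section Extension

variable (G : SigmaLax A.distMon B.distMon)

/-- The functor underlying a `σ`-lax monoidal functor between pseudoalgebras. -/
def base : A.carrier ⥤ B.carrier := G.functor

/-- The comparison at one-letter words of the lax morphism of a `σ`-lax monoidal functor. -/
def singleLax (x : A.carrier) :
    B.str.act.obj (T.single ((base G).obj x)) ⟶ (base G).obj (A.str.act.obj (T.single x)) :=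
  (B.str.unitCmp ((base G).obj x)).inv ≫ (base G).map (A.str.unitCmp x).hom

theorem singleLax_naturality {x y : A.carrier} (f : x ⟶ y) :
    B.str.act.map ((T.map (base G)).map (T.of f)) ≫ singleLax G y =
      singleLax G x ≫ (base G).map (A.str.act.map (T.of f)) := by
  have h : B.str.act.map ((T.map (base G)).map (T.of f)) =
    B.str.act.map (T.of ((base G).map f)) := rfl
  have h₁ := B.str.unitCmp_inv_nat ((base G).map f)
  have h₂ := A.str.unitCmp_nat f
  have h₃ := congrArg (base G).map h₂
  rw [h]
  refine (Category.assoc _ _ _).symm.trans ((congrArg (fun k => k ≫ _) h₁).trans ?_)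
  refine (Category.assoc _ _ _).trans (Eq.trans ?_ (Category.assoc _ _ _).symm)
  refine congrArg (fun k => _ ≫ k) ?_
  exact ((base G).map_comp _ _).symm.trans (h₃.trans ((base G).map_comp _ _))

/-- The comparison of the lax morphism of a `σ`-lax monoidal functor, as a monoidal
transformation. -/
noncomputable def extendLax :
    SigmaLax.comp (T.mapLax (base G)) B.actLax ⟶
      SigmaLax.comp A.actLax G :=
  SigmaLax.extend (mapLax_actLax_isStrong (base G)) (singleLax G)
    (singleLax_naturality G)

theorem extendLax_single (x : A.carrier) :
    (extendLax G).nat.app (T.single x) = singleLax G x :=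
  SigmaLax.extend_single (P := SigmaLax.comp (T.mapLax (base G)) B.actLax)
    (Q := SigmaLax.comp A.actLax G) _ _ (singleLax_naturality G) x

end Extension

end LaxMor

theorem paste_single {C : Type u} [Category.{v} C] {x₀ x₁ x₂ x₃ x₄ y₁ y₂ z : C} {m : x₀ ⟶ x₁}
    {q : x₁ ⟶ x₂} {L : x₂ ⟶ z} {b : x₀ ⟶ y₁} {s : y₁ ⟶ y₂} {n : y₂ ⟶ z} {c : x₀ ⟶ x₃}
    {p : x₃ ⟶ x₁} {l : x₃ ⟶ x₄} {g : x₄ ⟶ z} {w : y₁ ⟶ x₄} {k : x₄ ⟶ y₂} {k' : y₂ ⟶ x₄}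
    (h₁ : m = c ≫ p) (h₂ : p ≫ q ≫ L = l ≫ g) (h₃ : b ≫ w = c ≫ l) (h₄ : s = w ≫ k)
    (h₅ : n = k' ≫ g) (h₆ : k ≫ k' = 𝟙 _) : m ≫ q ≫ L = b ≫ s ≫ n := by
  rw [h₁, h₄, h₅, Category.assoc, Category.assoc, h₂, reassoc_of% h₆, reassoc_of% h₃]

theorem PseudoAlgebra.actEq_eq_eqToHom {A : Type u} [Category.{v} A] (a : PseudoAlgebra A)
    {X Y : T A} (h : X = Y) (h' : a.act.obj X = a.act.obj Y) : a.actEq h = eqToHom h' := by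
  subst h; simp

namespace LaxMor

variable {A : PsAlg.{v₁, u₁}} {B : PsAlg.{v₂, u₂}} (G : SigmaLax A.distMon B.distMon)

/-- The comparison of the lax morphism of a `σ`-lax monoidal functor. -/
noncomputable def extendNat :
    T.map (base G) ⋙ B.str.act ⟶ A.str.act ⋙ (base G) :=
  (extendLax G).nat

theorem extendNat_single (x : A.carrier) :
    (extendNat G).app (T.single x) = singleLax G x :=
  extendLax_single G x

/-- The multiplication law on a one-letter word of words. Both multiplications are inverse unit
comparisons there, so it reduces to naturality of the unit comparison of `B` and cancellation of
that of `A`. -/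
theorem extendNat_mult_single (X : T A.carrier)
    (e : (T.mult B.carrier).obj (T.single ((T.map (base G)).obj X)) =
      (T.map (base G)).obj ((T.mult A.carrier).obj (T.single X))) :
    (B.str.multApp (T.single ((T.map (base G)).obj X))).hom ≫ B.str.actEq e ≫
        (extendNat G).app ((T.mult A.carrier).obj (T.single X)) =
      B.str.act.map (T.of ((extendNat G).app X)) ≫
        (extendNat G).app (T.single (A.str.act.obj X)) ≫
          (base G).map (A.str.multApp (T.single X)).hom := by
  refine paste_single (B.str.multApp_single _) ?_ (B.str.unitCmp_inv_nat _)
    (extendNat_single G _)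
    ((congrArg (base G).map (A.str.multApp_single X)).trans ((base G).map_comp _ _)) ?_
  · refine (B.str.actEq_trans_assoc _ _ _).trans ?_
    exact (PsAlg.app_actEq (extendNat G)
      (T.mult_obj_single X).symm _).symm
  · exact ((base G).map_comp _ _).symm.trans
      ((congrArg (base G).map (Iso.hom_inv_id _)).trans ((base G).map_id _))

/-- The multiplication law as an equation of monoidal transformations out of a strong functor; the
one-letter case is the previous lemma. -/
theorem extendLax_mult :
    SigmaLax.whiskerLeft (T.mapLax (T.map (base G))) B.multHom ≫
      eqToHom (by rw [← SigmaLax.assoc, T.mapLax_mult, SigmaLax.assoc]) ≫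
      SigmaLax.whiskerLeft (T.multLax A.carrier) (extendLax G) =
    eqToHom (by rw [← SigmaLax.assoc, ← T.mapLax_comp]) ≫
      SigmaLax.whiskerRight (T.map₂Lax (extendNat G)) B.actLax ≫
      eqToHom (by
        rw [← SigmaLax.assoc]
        exact congrArg (fun k => SigmaLax.comp k B.actLax)
          (T.mapLax_comp A.str.act (base G))) ≫
      SigmaLax.whiskerLeft (T.mapLax A.str.act) (extendLax G) ≫
      eqToHom (SigmaLax.assoc _ _ _).symm ≫
      SigmaLax.whiskerRight A.multHom G ≫ eqToHom (SigmaLax.assoc _ _ _) := by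
  refine SigmaLax.hom_ext_single ((T.mapLax_isStrong _).comp
    ((T.mapLax_isStrong _).comp B.actLax_isStrong)) fun X => ?_
  simp only [SigmaLax.comp_app, SigmaLax.eqToHom_nat]
  have e : (T.mult B.carrier).obj (T.single ((T.map (base G)).obj X)) =
      (T.map (base G)).obj ((T.mult A.carrier).obj (T.single X)) :=
    T.mult_obj_map (base G) (T.single X)
  have h₁ : (T.map₂ (extendNat G)).app (T.single X) = T.of ((extendNat G).app X) :=
    (T.map₂_single _ X).trans ((Category.id_comp _).trans (Category.comp_id _))
  have h := extendNat_mult_single G X e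
  rw [B.str.actEq_eq_eqToHom e (congrArg B.str.act.obj e)] at h
  refine h.trans (Eq.symm ((Category.id_comp _).trans ?_))
  refine (congrArg (fun k => B.str.act.map k ≫ _) h₁).trans (congrArg (fun k => _ ≫ k) ?_)
  refine (Category.id_comp _).trans (congrArg (fun k => _ ≫ k) ?_)
  exact (Category.id_comp _).trans (Category.comp_id _)

/-- The lax morphism of a `σ`-lax monoidal functor. -/
noncomputable def ofSigmaLax : LaxMor A B where
  functor := (base G)
  lax := extendNat G
  unit x := by
    refine (congrArg (fun k => _ ≫ k) (extendNat_single G x)).trans ?_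
    exact Iso.hom_inv_id_assoc (B.str.unitCmp ((base G).obj x)) _
  mult W := by
    have h := SigmaLax.app_congr (extendLax_mult G) W
    simp only [SigmaLax.comp_app, SigmaLax.eqToHom_nat] at h
    rw [Functor.map_comp, Functor.map_comp, eqToHom_map, eqToHom_map, eqToHom_map,
      Category.assoc, Category.assoc]
    refine h.trans (congrArg (fun k => _ ≫ _ ≫ _ ≫ _ ≫ k) ?_)
    exact (Category.id_comp _).trans (Category.comp_id _)

end LaxMor

theorem paste_pair {C : Type u} [Category.{v} C] {x x' y y' z : C} {c c' : x ⟶ y} {e : y ⟶ y}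
    {L m' : y ⟶ z} {t : x ⟶ x'} {m : x' ⟶ y'} {g : y' ⟶ z} {r : y ⟶ x'} {n : z ⟶ y'}
    (h : (c ≫ e) ≫ L = t ≫ m ≫ g) (he : e = 𝟙 y) (ht : t = c' ≫ r) (hm : r ≫ m = m' ≫ n)
    (hn : n ≫ g = 𝟙 z) (hc : c = c') (hc' : IsIso c) : L = m' := by
  subst hc he
  rw [← cancel_epi c]
  rw [ht, Category.assoc, Category.assoc, reassoc_of% hm, hn, Category.comp_id,
    Category.id_comp] at h
  exact h

namespace LaxMor

variable {A : PsAlg.{v₁, u₁}} {B : PsAlg.{v₂, u₂}}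

/-! ### Recovering the laxators from the extended comparison -/

section Extension

variable (G : SigmaLax A.distMon B.distMon)

/-- Monoidality of the extended comparison at `[x]` and `[y]`. The unit comparisons inside
`singleLax` cancel against `tensorCmp`, which at one-letter words is a tensor product of inverse
unit comparisons. -/
theorem ofSigmaLax_μ (x y : A.carrier) : (ofSigmaLax G).μ x y = G.μ x y := by
  have h := SigmaLax.hom_tensor (extendLax G) (T.single x) (T.single y)
  have ht : B.str.tensorHom (singleLax G x) (singleLax G y) =
      B.str.tensorHom (B.str.unitCmp _).inv (B.str.unitCmp _).inv ≫
        B.str.tensorHom ((base G).map (A.str.unitCmp x).hom)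
          ((base G).map (A.str.unitCmp y).hom) := (B.str.tensorHom_comp _ _ _ _).symm
  rw [extendLax_single, extendLax_single] at h
  refine paste_pair h (B.str.act.map_id _) ht (SigmaLax.μ_naturality G _ _) ?_
    (B.str.tensorCmp_single _ _) (B.str.tensorCmp _ _).isIso_hom
  exact (G.functor.map_comp _ _).symm.trans
    ((congrArg G.functor.map (A.str.tensorHom_unitCmp_tensorCmp x y)).trans (G.functor.map_id _))

theorem ofSigmaLax_μ₀ : (ofSigmaLax G).μ₀ = G.μ₀ := by
  have h := SigmaLax.hom_unit (extendLax G)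
  refine Eq.trans ?_ (h.trans ?_)
  · exact ((congrArg (fun k => (𝟙 _ ≫ k) ≫ _) (B.str.act.map_id _)).trans
      ((congrArg (fun k => k ≫ _) (Category.id_comp _)).trans (Category.id_comp _))).symm
  · exact (congrArg (fun k => _ ≫ k) (G.functor.map_id _)).trans (Category.comp_id _)

theorem sigmaLax_ofSigmaLax : (ofSigmaLax G).sigmaLax = G :=
  SigmaLax.ext_of_app rfl ((ofSigmaLax_μ₀ G).trans (Category.comp_id _).symm) fun x y =>
    (ofSigmaLax_μ G x y).trans ((Category.id_comp _).trans (Category.comp_id _)).symm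

end Extension

/-- Lax morphisms of pseudoalgebras are `σ`-lax monoidal functors. -/
theorem sigmaLax_bijective : Function.Bijective (sigmaLax (A := A) (B := B)) :=
  ⟨sigmaLax_injective, fun G => ⟨ofSigmaLax G, sigmaLax_ofSigmaLax G⟩⟩

/-! ### Monoidal transformations as transformations of lax morphisms -/

section Hom

variable {F G : LaxMor A B} (θ : F.sigmaLax ⟶ G.sigmaLax)

/-- The natural transformation underlying a monoidal transformation. -/
def homNat : F.functor ⟶ G.functor := θ.nat

/-- On one-letter words the comparisons are built from unit comparisons, so the equation is
naturality of `θ` and of the unit comparison of `B`; the universal property extends it to all words.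
-/
theorem laxHom_comp :
    F.laxHom ≫ SigmaLax.whiskerLeft A.actLax θ =
      SigmaLax.whiskerRight (T.map₂Lax (homNat θ)) B.actLax ≫ G.laxHom := by
  refine SigmaLax.hom_ext_single (mapLax_actLax_isStrong F.functor) fun x => ?_
  rw [SigmaLax.comp_app, SigmaLax.comp_app]
  have h₁ : (T.map₂ (homNat θ)).app (T.single x) = T.of ((homNat θ).app x) :=
    (T.map₂_single _ x).trans ((Category.id_comp _).trans (Category.comp_id _))
  refine Eq.trans ?_ (congrArg (fun k => B.str.act.map k ≫ G.lax.app (T.single x)) h₁).symm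
  refine (congrArg (fun k => k ≫ _) (F.lax_single x)).trans
    (Eq.trans ?_ (congrArg (fun k => _ ≫ k) (G.lax_single x)).symm)
  have h₂ := (homNat θ).naturality (A.str.unitCmp x).hom
  have h₃ := B.str.unitCmp_inv_nat ((homNat θ).app x)
  refine (Category.assoc _ _ _).trans ((congrArg (fun k => _ ≫ k) h₂).trans ?_)
  refine (Category.assoc _ _ _).symm.trans ((congrArg (fun k => k ≫ _) h₃.symm).trans ?_)
  exact Category.assoc _ _ _

/-- The transformation of lax morphisms given by a monoidal transformation. -/
def ofSigmaHom : F ⟶ G where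
  nat := homNat θ
  comm X := SigmaLax.app_congr (laxHom_comp θ) X

end Hom

/-- Transformations of lax morphisms are monoidal transformations. -/
theorem sigmaHom_bijective {F G : LaxMor A B} :
    Function.Bijective (sigmaHom (F := F) (G := G)) :=
  ⟨fun _ _ h => hom_ext (congrArg SigmaLax.Hom.nat h), fun θ => ⟨ofSigmaHom θ, rfl⟩⟩

end LaxMor

/-! ### Distorted monoidal categories up to equivalence -/

section Pasting

variable {C : Type u} [Category.{v} C]

theorem naturality_of_epi {x x' y y' z z' : C} {F : x ⟶ x'} {W : x ⟶ y} {W' : x' ⟶ y'}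
    {t : y ⟶ y'} {p : y ⟶ z} {p' : y' ⟶ z'} {r : x ⟶ z} {r' : x' ⟶ z'} {f : z ⟶ z'}
    (hW : IsIso W) (h : F ≫ W' = W ≫ t) (hr : W ≫ p = r) (hr' : W' ≫ p' = r')
    (hf : F ≫ r' = r ≫ f) : t ≫ p' = p ≫ f := by
  rw [← cancel_epi W, ← reassoc_of% h, hr', hf, ← hr, Category.assoc]

theorem eq_of_comp_epi {x y z x' y' z' w : C} {W : x ⟶ y} {m : y ⟶ z} {s : x ⟶ x'} {t : x' ⟶ y'}
    {d : y' ⟶ z} {k : z ⟶ w} {r : x ⟶ z'} {n : z' ⟶ w} {d' : w ⟶ y'} {p : y ⟶ z'}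
    (hW : IsIso W) (h : W ≫ m = s ≫ t ≫ d) (hs : s ≫ t = r ≫ n ≫ d') (hd : d' ≫ d ≫ k = 𝟙 w)
    (hr : W ≫ p = r) : m ≫ k = p ≫ n := by
  rw [← cancel_epi W, reassoc_of% h, reassoc_of% hs, hd, Category.comp_id, ← hr, Category.assoc]

end Pasting

namespace DistMon

variable (D : DistMon.{v, u})

/-- The tensor product of a two-letter word. -/
def pairIso (x y : D.carrier) : D.pseudoAlgebra.tensorObj x y ≅ x ⊗ y :=
  whiskerLeftIso x (ρ_ y)

/-- The triangle axiom: the word `[x, y]` evaluates to `x ⊗ (y ⊗ 𝟙_)`, and removing its trailing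
unit amounts to removing the unit of each letter. -/
theorem wordTensor_pairIso (x y : D.carrier) :
    (D.wordTensor (T.single x) (T.single y)).hom ≫ (D.pairIso x y).hom =
      (ρ_ x).hom ⊗ₘ (ρ_ y).hom := by
  have h : ((α_ x (𝟙_ D.carrier) (y ⊗ 𝟙_ D.carrier)).hom ≫ x ◁ (λ_ (y ⊗ 𝟙_ D.carrier)).hom) ≫
      x ◁ (ρ_ y).hom = (ρ_ x).hom ⊗ₘ (ρ_ y).hom := by
    rw [triangle, MonoidalCategory.tensorHom_def]
  exact h

theorem pairIso_naturality {x x' y y' : D.carrier} (f : x ⟶ x') (g : y ⟶ y') :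
    D.pseudoAlgebra.tensorHom f g ≫ (D.pairIso x' y').hom = (D.pairIso x y).hom ≫ (f ⊗ₘ g) := by
  have h := D.wordTensor_naturality (T.of f) (T.of g)
  have h₁ : (D.evalFunctor.map (T.of f) ⊗ₘ D.evalFunctor.map (T.of g)) ≫
      ((ρ_ x').hom ⊗ₘ (ρ_ y').hom) = ((ρ_ x).hom ⊗ₘ (ρ_ y).hom) ≫ (f ⊗ₘ g) := by
    have h₂ : ((f ⊗ₘ 𝟙 (𝟙_ D.carrier)) ⊗ₘ (g ⊗ₘ 𝟙 (𝟙_ D.carrier))) ≫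
        ((ρ_ x').hom ⊗ₘ (ρ_ y').hom) = ((ρ_ x).hom ⊗ₘ (ρ_ y).hom) ≫ (f ⊗ₘ g) := by
      simp only [tensorHom_comp_tensorHom, tensorHom_id, rightUnitor_naturality]
    exact h₂
  exact naturality_of_epi (D.wordTensor (T.single x) (T.single y)).isIso_hom h
    (D.wordTensor_pairIso x y) (D.wordTensor_pairIso x' y') h₁

theorem singleIso_tensor (X Y : T D.carrier) :
    ((D.singleIso X).hom ⊗ₘ (D.singleIso Y).hom) ≫
        (D.wordTensor ((T.mult D.carrier).obj (T.single X))
          ((T.mult D.carrier).obj (T.single Y))).hom =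
      ((ρ_ (D.wordObj X)).hom ⊗ₘ (ρ_ (D.wordObj Y)).hom) ≫ (D.wordTensor X Y).hom ≫
        D.evalFunctor.map (T.tensor (eqToHom (T.mult_obj_single X).symm)
          (eqToHom (T.mult_obj_single Y).symm)) := by
  rw [singleIso_hom, singleIso_hom, ← wordTensor_naturality]
  exact ((tensorHom_comp_tensorHom_assoc _ _ _ _ _).symm)

/-- Monoidality of the multiplication comparison at `[X]` and `[Y]`, where it consists of right
unitors. The laxator of the action thus differs from that of evaluation only by the removal of a
trailing unit. -/
theorem tensorCmp_eq (X Y : T D.carrier) :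
    (D.pseudoAlgebra.tensorCmp X Y).hom =
      (D.pairIso (D.wordObj X) (D.wordObj Y)).hom ≫ (D.wordTensor X Y).hom := by
  have h := SigmaLax.hom_tensor D.evalMultLax.hom (T.single X) (T.single Y)
  rw [evalMultLax_single, evalMultLax_single] at h
  have e := T.mult_isStrict.obj_append (T.single X) (T.single Y)
  have h₁ : (D.wordTensor (T.single (D.wordObj X)) (T.single (D.wordObj Y))).hom ≫
      (D.pseudoAlgebra.multApp (T.append (T.single X) (T.single Y))).hom =
    ((D.singleIso X).hom ⊗ₘ (D.singleIso Y).hom) ≫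
        (D.wordTensor ((T.mult D.carrier).obj (T.single X))
          ((T.mult D.carrier).obj (T.single Y))).hom ≫ D.evalFunctor.map (eqToHom e.symm) :=
    ((congrArg (fun k => k ≫ _) ((congrArg (fun k => _ ≫ k) (D.evalFunctor.map_id _)).trans
      (Category.comp_id _))).symm.trans h)
  refine eq_of_comp_epi (D.wordTensor (T.single (D.wordObj X)) (T.single (D.wordObj Y))).isIso_hom
    h₁ (D.singleIso_tensor X Y) ?_ (D.wordTensor_pairIso (D.wordObj X) (D.wordObj Y))
  rw [T.tensor_eqToHom]
  refine (congrArg (fun k => _ ≫ k) (D.evalFunctor.map_comp _ _).symm).trans ?_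
  refine (D.evalFunctor.map_comp _ _).symm.trans (Eq.trans ?_ (D.evalFunctor.map_id _))
  refine congrArg D.evalFunctor.map ?_
  exact (congrArg (fun k => _ ≫ k) (eqToHom_trans e.symm (T.join_pair X Y))).trans
    (eqToHom_trans _ _)

/-- Evaluation and the action have the same underlying functor, so the presenting transformation is
an identity and only the laxators differ, by `pairIso`. -/
theorem evalPresentation :
    LaxPresentation (A := D) (B := D.toPsAlg.distMon) D.eval D.toPsAlg.actLax (𝟭 D.carrier)
      (fun x y => (D.pairIso x y).hom) (𝟙 (𝟙_ D.carrier)) (fun X => 𝟙 (D.wordObj X)) where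
  isIso_μ := D.eval_isStrong.isIso_μ
  μ_nat f g := D.pairIso_naturality f g
  l_nat _ := (Category.comp_id _).trans (Category.id_comp _).symm
  comp_μ X Y := (Category.comp_id _).trans ((D.tensorCmp_eq X Y).trans
    ((congrArg (fun k => k ≫ _) (D.pseudoAlgebra.tensorHom_id _ _)).trans
      (Category.id_comp _)).symm)
  comp_μ₀ := rfl
  dense x := ⟨T.single x, ⟨ρ_ x⟩, inferInstanceAs (IsIso (𝟙 (D.wordObj (T.single x))))⟩

theorem actPresentation :
    LaxPresentation (A := D.toPsAlg.distMon) (B := D) D.toPsAlg.actLax D.eval (𝟭 D.carrier)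
      (fun x y => (D.pairIso x y).inv) (𝟙 (𝟙_ D.carrier)) (fun X => 𝟙 (D.wordObj X)) where
  isIso_μ := D.toPsAlg.actLax_isStrong.isIso_μ
  μ_nat f g := by
    refine (Iso.eq_inv_comp (D.pairIso _ _)).2 ?_
    refine (Category.assoc _ _ _).symm.trans ((Iso.comp_inv_eq (D.pairIso _ _)).2 ?_)
    exact (D.pairIso_naturality f g).symm
  l_nat _ := (Category.comp_id _).trans (Category.id_comp _).symm
  comp_μ X Y := by
    have e : 𝟙 (D.wordObj X) ⊗ₘ 𝟙 (D.wordObj Y) = 𝟙 (D.wordObj X ⊗ D.wordObj Y) :=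
      id_tensorHom_id _ _
    exact (Category.comp_id _).trans (((Iso.eq_inv_comp (D.pairIso _ _)).2
      (D.tensorCmp_eq X Y).symm).trans
        ((congrArg (fun k => k ≫ _) e).trans (Category.id_comp _)).symm)
  comp_μ₀ := rfl
  dense x := ⟨T.single x, ⟨(D.pseudoAlgebra.unitCmp x).symm⟩,
    inferInstanceAs (IsIso (𝟙 (D.wordObj (T.single x))))⟩

/-- The identity functor, from a distorted monoidal category to that of its pseudoalgebra. -/
noncomputable def toAct : SigmaLax D D.toPsAlg.distMon := D.evalPresentation.isSigmaLax.toSigmaLax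

/-- The identity functor, to a distorted monoidal category from that of its pseudoalgebra. -/
noncomputable def ofAct : SigmaLax D.toPsAlg.distMon D := D.actPresentation.isSigmaLax.toSigmaLax

/-- Both functors are the identity with mutually inverse laxators, so the composites are identities
on the nose. -/
theorem ofAct_toAct : SigmaLax.comp D.ofAct D.toAct = SigmaLax.id D.toPsAlg.distMon :=
  SigmaLax.ext_of_app rfl rfl fun x y =>
    ((D.pairIso x y).hom_inv_id).trans ((Category.id_comp _).trans (Category.comp_id _)).symm

theorem toAct_ofAct : SigmaLax.comp D.toAct D.ofAct = SigmaLax.id D :=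
  SigmaLax.ext_of_app rfl rfl fun x y =>
    ((D.pairIso x y).inv_hom_id).trans ((Category.id_comp _).trans (Category.comp_id _)).symm

/-- A distorted monoidal category is equivalent to that underlying its pseudoalgebra. -/
noncomputable def actEquivalence : Bicategory.Equivalence D.toPsAlg.distMon D :=
  .mkOfAdjointifyCounit (f := D.ofAct) (g := D.toAct) (eqToIso D.ofAct_toAct.symm)
    (eqToIso D.toAct_ofAct)

end DistMon

theorem isBiequivalence : IsBiequivalence hasUnderlying.{v, u}.functor where
  essSurj D := ⟨D.toPsAlg, ⟨D.actEquivalence⟩⟩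
  isEquivalence A B :=
    { faithful := ⟨fun {_ _} _ _ h => LaxMor.sigmaHom_bijective.1 h⟩
      full := ⟨fun θ => LaxMor.sigmaHom_bijective.2 θ⟩
      essSurj := ⟨fun G => by
        obtain ⟨F, hF⟩ := LaxMor.sigmaLax_bijective.2 G
        exact ⟨F, ⟨eqToIso hF⟩⟩⟩ }

/-! ### Strictness and horizontal composition -/

theorem hcomp_comp {B : Type u} [Bicategory.{v₁, v} B] {a b c : B} {f f' f'' : a ⟶ b}
    {g g' g'' : b ⟶ c} (θ : f ⟶ f') (η : f' ⟶ f'') (φ : g ⟶ g') (ψ : g' ⟶ g'') :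
    hcomp (θ ≫ η) (φ ≫ ψ) = hcomp θ φ ≫ hcomp η ψ := by
  unfold hcomp
  rw [Bicategory.comp_whiskerRight, Bicategory.whiskerLeft_comp, Category.assoc, Category.assoc,
    Bicategory.whisker_exchange_assoc]

/-- The associators and unitors were defined from these very equalities, so their comparison is
reflexive. -/
theorem PsAlg.strict : Bicategory.Strict PsAlg.{v, u} where
  id_comp := LaxMor.id_comp
  comp_id := LaxMor.comp_id
  assoc := LaxMor.assoc
  leftUnitor_eqToIso _ := rfl
  rightUnitor_eqToIso _ := rfl
  associator_eqToIso _ _ _ := rfl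

theorem DistMon.strict : Bicategory.Strict DistMon.{v, u} where
  id_comp := SigmaLax.id_comp
  comp_id := SigmaLax.comp_id
  assoc := SigmaLax.assoc
  leftUnitor_eqToIso _ := rfl
  rightUnitor_eqToIso _ := rfl
  associator_eqToIso _ _ _ := rfl

namespace LaxMor

/-- `hcomp` and `◫` whisker in opposite orders; naturality of `φ` exchanges them. -/
theorem hcomp_nat {A B C : PsAlg.{v, u}} {F F' : A ⟶ B} {G G' : B ⟶ C} (θ : F ⟶ F')
    (φ : G ⟶ G') : Hom.nat (hcomp θ φ) = Hom.nat θ ◫ Hom.nat φ :=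
  NatTrans.ext (funext fun x => (Hom.nat φ).naturality ((Hom.nat θ).app x))

variable {A : PsAlg.{v₁, u₁}} {B : PsAlg.{v₂, u₂}} {C : PsAlg.{v₃, u₃}} {D : PsAlg.{v₄, u₄}}
  (F : LaxMor A B) (G : LaxMor B C) (H : LaxMor C D)

theorem comp_assoc_μ (x y : A.carrier) :
    (comp (comp F G) H).μ x y = (comp F (comp G H)).μ x y := by
  refine (comp_μ (comp F G) H x y).trans (Eq.trans ?_ (comp_μ F (comp G H) x y).symm)
  refine (congrArg (fun k => _ ≫ H.functor.map k) (comp_μ F G x y)).trans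
    (Eq.trans ?_ (congrArg (fun k => k ≫ _) (comp_μ G H _ _)).symm)
  exact (congrArg (fun k => _ ≫ k) (H.functor.map_comp _ _)).trans (Category.assoc _ _ _).symm

theorem comp_assoc_μ₀ : (comp (comp F G) H).μ₀ = (comp F (comp G H)).μ₀ := by
  refine (comp_μ₀ (comp F G) H).trans (Eq.trans ?_ (comp_μ₀ F (comp G H)).symm)
  refine (congrArg (fun k => _ ≫ H.functor.map k) (comp_μ₀ F G)).trans
    (Eq.trans ?_ (congrArg (fun k => k ≫ _) (comp_μ₀ G H)).symm)
  exact (congrArg (fun k => _ ≫ k) (H.functor.map_comp _ _)).trans (Category.assoc _ _ _).symm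

end LaxMor

namespace SigmaLax

theorem hcomp_nat {A B C : DistMon.{v, u}} {F F' : A ⟶ B} {G G' : B ⟶ C} (θ : F ⟶ F')
    (φ : G ⟶ G') : Hom.nat (hcomp θ φ) = Hom.nat θ ◫ Hom.nat φ :=
  NatTrans.ext (funext fun x => (Hom.nat φ).naturality ((Hom.nat θ).app x))

/-- Stated for underlying natural transformations, where the two bracketings of the functors agree
definitionally, so that no transport of 2-cells is needed. -/
theorem hcomp_assoc_nat {A B C D : DistMon.{v, u}} {F F' : A ⟶ B} {G G' : B ⟶ C} {H H' : C ⟶ D}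
    (θ : F ⟶ F') (φ : G ⟶ G') (ψ : H ⟶ H') :
    Hom.nat (hcomp (hcomp θ φ) ψ) = Hom.nat (hcomp θ (hcomp φ ψ)) :=
  NatTrans.ext (funext fun _ => (congrArg (fun k => k ≫ _)
    ((functor H).map_comp _ _)).trans (Category.assoc _ _ _))

theorem id_hcomp_nat {A B : DistMon.{v, u}} {F F' : A ⟶ B} (θ : F ⟶ F') :
    Hom.nat (hcomp (𝟙 (𝟙 A)) θ) = Hom.nat θ :=
  NatTrans.ext (funext fun _ => (congrArg (fun k => k ≫ _)
    ((functor F).map_id _)).trans (Category.id_comp _))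

theorem hcomp_id_nat {A B : DistMon.{v, u}} {F F' : A ⟶ B} (θ : F ⟶ F') :
    Hom.nat (hcomp θ (𝟙 (𝟙 B))) = Hom.nat θ :=
  NatTrans.ext (funext fun _ => Category.comp_id _)

variable {A : DistMon.{v₁, u₁}} {B : DistMon.{v₂, u₂}} {C : DistMon.{v₃, u₃}}
  {D : DistMon.{v₄, u₄}} (F : SigmaLax A B) (G : SigmaLax B C) (H : SigmaLax C D)

theorem comp_assoc_μ (x y : A.carrier) :
    (comp (comp F G) H).μ x y = (comp F (comp G H)).μ x y :=
  (congrArg (fun k => _ ≫ k) (H.functor.map_comp _ _)).trans (Category.assoc _ _ _).symm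

theorem comp_assoc_μ₀ : (comp (comp F G) H).μ₀ = (comp F (comp G H)).μ₀ :=
  (congrArg (fun k => _ ≫ k) (H.functor.map_comp _ _)).trans (Category.assoc _ _ _).symm

end SigmaLax

end Distorted

open Bicategory MonoidalCategory Distorted in
theorem mainTheorem4 :
    -- pseudoalgebras, lax morphisms and transformations form a strict 2-category
    Bicategory.Strict PsAlg.{v, u} ∧
    -- with the usual identities, compositions and whiskerings
    (∀ A : PsAlg.{v, u}, LaxMor.functor (𝟙 A) = 𝟭 A.carrier) ∧
    (∀ {A B C : PsAlg.{v, u}} (F : A ⟶ B) (G : B ⟶ C),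
      LaxMor.functor (F ≫ G) = LaxMor.functor F ⋙ LaxMor.functor G) ∧
    (∀ {A B : PsAlg.{v, u}} (F : A ⟶ B), LaxMor.Hom.nat (𝟙 F) = 𝟙 (LaxMor.functor F)) ∧
    (∀ {A B : PsAlg.{v, u}} {F G H : A ⟶ B} (η : F ⟶ G) (θ : G ⟶ H),
      LaxMor.Hom.nat (η ≫ θ) = LaxMor.Hom.nat η ≫ LaxMor.Hom.nat θ) ∧
    (∀ {A B C : PsAlg.{v, u}} (F : A ⟶ B) {G G' : B ⟶ C} (φ : G ⟶ G'),
      LaxMor.Hom.nat (F ◁ φ) = Functor.whiskerLeft (LaxMor.functor F) (LaxMor.Hom.nat φ)) ∧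
    (∀ {A B C : PsAlg.{v, u}} {F F' : A ⟶ B} (θ : F ⟶ F') (G : B ⟶ C),
      LaxMor.Hom.nat (θ ▷ G) = Functor.whiskerRight (LaxMor.Hom.nat θ) (LaxMor.functor G)) ∧
    (∀ {A B C : PsAlg.{v, u}} {F F' : A ⟶ B} {G G' : B ⟶ C} (θ : F ⟶ F') (φ : G ⟶ G'),
      LaxMor.Hom.nat (hcomp θ φ) = LaxMor.Hom.nat θ ◫ LaxMor.Hom.nat φ) ∧
    -- the composite laxators
    (∀ {A B C : PsAlg.{v, u}} (F : A ⟶ B) (G : B ⟶ C) (X Y : A.carrier),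
      LaxMor.μ (F ≫ G) X Y =
        LaxMor.μ G ((LaxMor.functor F).obj X) ((LaxMor.functor F).obj Y) ≫
          (LaxMor.functor G).map (LaxMor.μ F X Y)) ∧
    (∀ {A B C : PsAlg.{v, u}} (F : A ⟶ B) (G : B ⟶ C),
      LaxMor.μ₀ (F ≫ G) = LaxMor.μ₀ G ≫ (LaxMor.functor G).map (LaxMor.μ₀ F)) ∧
    (∀ (A : PsAlg.{v, u}) (X Y : A.carrier), LaxMor.μ (𝟙 A) X Y = 𝟙 (A.str.tensorObj X Y)) ∧
    (∀ A : PsAlg.{v, u}, LaxMor.μ₀ (𝟙 A) = 𝟙 (A.str.act.obj T.nil)) ∧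
    -- triple composites
    (∀ {A B C D : PsAlg.{v, u}} (F : A ⟶ B) (G : B ⟶ C) (H : C ⟶ D) (X Y : A.carrier),
      LaxMor.μ ((F ≫ G) ≫ H) X Y = LaxMor.μ (F ≫ G ≫ H) X Y) ∧
    (∀ {A B C D : PsAlg.{v, u}} (F : A ⟶ B) (G : B ⟶ C) (H : C ⟶ D),
      LaxMor.μ₀ ((F ≫ G) ≫ H) = LaxMor.μ₀ (F ≫ G ≫ H)) ∧
    -- the interchange law
    (∀ {A B C : PsAlg.{v, u}} {F F' F'' : A ⟶ B} {G G' G'' : B ⟶ C} (θ : F ⟶ F')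
      (η : F' ⟶ F'') (φ : G ⟶ G') (ψ : G' ⟶ G''),
      hcomp (θ ≫ η) (φ ≫ ψ) = hcomp θ φ ≫ hcomp η ψ) ∧
    -- the strict 2-category of distorted monoidal categories, `σ`-lax monoidal functors and
    -- monoidal natural transformations is recovered along the underlying strict 2-functor
    (∃ h : HasUnderlying.{v, u},
      IsBiequivalence h.functor ∧
      (∀ A B : PsAlg.{v, u},
        Function.Bijective fun F : A ⟶ B => h.functor.map F) ∧
      (∀ {A B : PsAlg.{v, u}} (F G : A ⟶ B),
        Function.Bijective fun θ : F ⟶ G => h.functor.map₂ θ)) ∧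
    Bicategory.Strict DistMon.{v, u} ∧
    (∀ A : DistMon.{v, u}, SigmaLax.functor (𝟙 A) = 𝟭 A.carrier) ∧
    (∀ {A B C : DistMon.{v, u}} (F : A ⟶ B) (G : B ⟶ C),
      SigmaLax.functor (F ≫ G) = SigmaLax.functor F ⋙ SigmaLax.functor G) ∧
    (∀ {A B : DistMon.{v, u}} (F : A ⟶ B), SigmaLax.Hom.nat (𝟙 F) = 𝟙 (SigmaLax.functor F)) ∧
    (∀ {A B : DistMon.{v, u}} {F G H : A ⟶ B} (η : F ⟶ G) (θ : G ⟶ H),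
      SigmaLax.Hom.nat (η ≫ θ) = SigmaLax.Hom.nat η ≫ SigmaLax.Hom.nat θ) ∧
    (∀ {A B C : DistMon.{v, u}} {F F' : A ⟶ B} {G G' : B ⟶ C} (θ : F ⟶ F') (φ : G ⟶ G'),
      SigmaLax.Hom.nat (hcomp θ φ) = SigmaLax.Hom.nat θ ◫ SigmaLax.Hom.nat φ) ∧
    (∀ {A B C : DistMon.{v, u}} (F : A ⟶ B) (G : B ⟶ C) (X Y : A.carrier),
      SigmaLax.μ (F ≫ G) X Y =
        SigmaLax.μ G ((SigmaLax.functor F).obj X) ((SigmaLax.functor F).obj Y) ≫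
          (SigmaLax.functor G).map (SigmaLax.μ F X Y)) ∧
    (∀ {A B C : DistMon.{v, u}} (F : A ⟶ B) (G : B ⟶ C),
      SigmaLax.μ₀ (F ≫ G) = SigmaLax.μ₀ G ≫ (SigmaLax.functor G).map (SigmaLax.μ₀ F)) ∧
    (∀ (A : DistMon.{v, u}) (X Y : A.carrier), SigmaLax.μ (𝟙 A) X Y = 𝟙 (X ⊗ Y)) ∧
    (∀ A : DistMon.{v, u}, SigmaLax.μ₀ (𝟙 A) = 𝟙 (𝟙_ A.carrier)) ∧
    (∀ {A B C D : DistMon.{v, u}} (F : A ⟶ B) (G : B ⟶ C) (H : C ⟶ D) (X Y : A.carrier),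
      SigmaLax.μ ((F ≫ G) ≫ H) X Y = SigmaLax.μ (F ≫ G ≫ H) X Y) ∧
    (∀ {A B C D : DistMon.{v, u}} (F : A ⟶ B) (G : B ⟶ C) (H : C ⟶ D),
      SigmaLax.μ₀ ((F ≫ G) ≫ H) = SigmaLax.μ₀ (F ≫ G ≫ H)) ∧
    (∀ {A B C D : DistMon.{v, u}} {F F' : A ⟶ B} {G G' : B ⟶ C} {H H' : C ⟶ D} (θ : F ⟶ F')
      (φ : G ⟶ G') (ψ : H ⟶ H'),
      SigmaLax.Hom.nat (hcomp (hcomp θ φ) ψ) = SigmaLax.Hom.nat (hcomp θ (hcomp φ ψ))) ∧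
    (∀ {A B : DistMon.{v, u}} {F F' : A ⟶ B} (θ : F ⟶ F'),
      SigmaLax.Hom.nat (hcomp (𝟙 (𝟙 A)) θ) = SigmaLax.Hom.nat θ ∧
      SigmaLax.Hom.nat (hcomp θ (𝟙 (𝟙 B))) = SigmaLax.Hom.nat θ) ∧
    (∀ {A B C : DistMon.{v, u}} {F F' F'' : A ⟶ B} {G G' G'' : B ⟶ C} (θ : F ⟶ F')
      (η : F' ⟶ F'') (φ : G ⟶ G') (ψ : G' ⟶ G''),
      hcomp (θ ≫ η) (φ ≫ ψ) = hcomp θ φ ≫ hcomp η ψ) := by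
  exact ⟨PsAlg.strict, fun _ => rfl, fun _ _ => rfl, fun _ => rfl, fun _ _ => rfl,
    fun _ => fun _ => rfl, fun _ _ => rfl, LaxMor.hcomp_nat, LaxMor.comp_μ, LaxMor.comp_μ₀,
    fun A _ _ => A.str.act.map_id _, fun A => A.str.act.map_id _, LaxMor.comp_assoc_μ,
    LaxMor.comp_assoc_μ₀, hcomp_comp,
    ⟨hasUnderlying, isBiequivalence, fun _ _ => LaxMor.sigmaLax_bijective,
      fun _ _ => LaxMor.sigmaHom_bijective⟩,
    DistMon.strict, fun _ => rfl, fun _ _ => rfl, fun _ => rfl, fun _ _ => rfl,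
    SigmaLax.hcomp_nat, SigmaLax.comp_μ, SigmaLax.comp_μ₀, fun _ _ _ => rfl, fun _ => rfl,
    SigmaLax.comp_assoc_μ, SigmaLax.comp_assoc_μ₀, SigmaLax.hcomp_assoc_nat,
    fun θ => ⟨SigmaLax.id_hcomp_nat θ, SigmaLax.hcomp_id_nat θ⟩, hcomp_comp⟩
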